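/- Let $\Gamma_0$ be a finite simple connected $3$-regular graph and let $p$ be an odd prime. **CFI graphs.** The graph $\mathrm{CFI}(\Gamma_0)$ is obtained from $\Gamma_0$ by replacing every vertex $v$ by a gadget. The gadget of $v$ has a pair of external vertices $a^v_w, b^v_w$ for every neighbour $w$ of $v$, and one internal vertex for every $0$-$1$-string $s$ indexed by the neighbours of $v$ with an even number of ones; the internal vertex $s$ is adjacent to $a^v_w$ if $s_w=0$ and to $b^v_w$ if $s_w=1$. For every edge $\{v,w\}$ of $\Gamma_0$ one adds the two edges $\{a^v_w,a^w_v\}$ and $\{b^v_w,b^w_v\}$. The twisted graph $\widetilde{\mathrm{CFI}}(\Gamma_0)$ is obtained by choosing one edge $\{v,w\}$ of $\Gamma_0$ (any edge is allowed) and replacing these two edges for it by $\{a^v_w,b^w_v\}$ and $\{b^v_w,a^w_v\}$. **Mekler groups.** For a finite simple graph $\Gamma$ let $$G_\Gamma=\langle x_v\ (v\in V(\Gamma)) \mid x_v^p=1,\ [[x_u,x_v],x_w]=1 \text{ for all } u,v,w;\ [x_u,x_v]=1 \text{ for } \{u,v\}\in E(\Gamma)\rangle .$$ **Weisfeiler-Leman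 algorithms.** Let $k\ge 2$. Given a colouring $\chi_0$ of $X^k$, put $$\chi_{i+1}(\bar g)=\bigl(\chi_i(\bar g),\{\!\!\{(\chi_i(\bar g_{|1\leftarrow x}),\dots,\chi_i(\bar g_{|k\leftarrow x})) \mid x\in X\}\!\!\}\bigr),$$ where $\bar g_{|j\leftarrow x}$ arises from $\bar g$ by replacing the $j$-th entry by $x$; two tuples have the same final colour if they have the same colour in every round. For groups (Version II), $\bar g\in G^k$ and $\bar h\in H^k$ have the same initial colour iff $g_i\mapsto h_i$ extends to an isomorphism $\langle g_1,\dots,g_k\rangle\to\langle h_1,\dots,h_k\rangle$. The $k$-dimensional WL algorithm *distinguishes* $G$ from $H$ if there is no bijection $G^k\to H^k$ preserving final colours, and it *identifies* $G$ if it distinguishes $G$ from every finite group not isomorphic to $G$. For graphs, two vertex tuples have the same initial colour iff mapping one to the other entrywise is an isomorphism of the induced subgraphs; $k$-WL distinguishes $\Gamma$ from $\Gamma'$ if, when run on the disjoint union, the multisets of final colours of $V(\Gamma)^k$ and $V(\Gamma')^k$ differ. The graph $\Gamma$ has WL-dimension at most $k$ if $k$-WL distinguishes it from every finite graph not isomorphic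 to it. **Theorem.** Let $G_1=G_{\mathrm{CFI}(\Gamma_0)}$ and $G_2=G_{\widetilde{\mathrm{CFI}}(\Gamma_0)}$. The $3$-dimensional WL algorithm (Version II) distinguishes $G_1$ from $G_2$. If in addition $\Gamma_0$ has (graph) WL-dimension at most $3$, then the $3$-dimensional WL algorithm (Version II) identifies $G_1$ as well as $G_2$. -/

import Mathlib

universe u

open scoped commutatorElement

/-! ### Colour refinement on `k`-tuples -/

/-- The colours available after `i` rounds of `k`-dimensional refinement, starting from initial
colours in `C`: a colour of round `i + 1` is a colour of round `i` together with a multiset of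
`k`-tuples of colours of round `i`, given by its multiplicity function. -/
def WLColor (C : Type) (k : ℕ) : ℕ → Type
  | 0 => C
  | i + 1 => WLColor C k i × ((Fin k → WLColor C k i) → ℕ∞)

/-- The colouring `χ_i` of `X^k`:
`χ_{i+1}(g) = (χ_i(g), {{ (χ_i(g|1←x), …, χ_i(g|k←x)) | x ∈ X }})`, for `k ≥ 2`. -/
noncomputable def wlColor {X : Type*} {C : Type} {k : ℕ} (χ₀ : (Fin k → X) → C) :
    (i : ℕ) → (Fin k → X) → WLColor C k i
  | 0 => χ₀
  | i + 1 => fun g =>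
      (wlColor χ₀ i g,
        fun c => Set.encard {x : X | (fun j => wlColor χ₀ i (Function.update g j x)) = c})

/-- The final colour of a tuple, recorded as the sequence of its colours in all rounds. Two tuples
have the same final colour iff no round of the refinement separates them. -/
noncomputable def wlFinalColor {X : Type*} {C : Type} {k : ℕ} (χ₀ : (Fin k → X) → C)
    (g : Fin k → X) : (i : ℕ) → WLColor C k i :=
  fun i => wlColor χ₀ i g

/-! ### The Weisfeiler-Leman algorithm for groups (Version II) -/

/-- The initial colour of a tuple of group elements in Version II: its marked isomorphism type,
encoded by the set of all words in `k` letters that are trivial on the tuple. See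
`markedType_eq_iff` for the characterization by isomorphisms of generated subgroups. -/
def markedType {G : Type*} [Group G] {k : ℕ} (g : Fin k → G) : Subgroup (FreeGroup (Fin k)) :=
  (FreeGroup.lift g).ker

/-- Two tuples have the same initial colour iff `g_i ↦ h_i` extends to an isomorphism between the
subgroups generated by the tuples. -/
theorem markedType_eq_iff {G H : Type*} [Group G] [Group H] {k : ℕ}
    (g : Fin k → G) (h : Fin k → H) :
    markedType g = markedType h ↔
      ∃ φ : Subgroup.closure (Set.range g) ≃* Subgroup.closure (Set.range h),
        ∀ i, (φ ⟨g i, Subgroup.subset_closure (Set.mem_range_self i)⟩ : H) = h i := by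
  constructor
  · intro hgh
    have hG := FreeGroup.range_lift_eq_closure (f := g)
    have hH := FreeGroup.range_lift_eq_closure (f := h)
    have hk : (FreeGroup.lift g).ker = (FreeGroup.lift h).ker := hgh
    refine ⟨(MulEquiv.subgroupCongr hG).symm.trans
      ((QuotientGroup.quotientKerEquivRange (FreeGroup.lift g)).symm.trans
        ((QuotientGroup.quotientMulEquivOfEq hk).trans
          ((QuotientGroup.quotientKerEquivRange (FreeGroup.lift h)).trans
            (MulEquiv.subgroupCongr hH)))), fun i => ?_⟩
    have key : (QuotientGroup.quotientKerEquivRange (FreeGroup.lift g)).symm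
        ((MulEquiv.subgroupCongr hG).symm
          ⟨g i, Subgroup.subset_closure (Set.mem_range_self i)⟩)
        = QuotientGroup.mk (FreeGroup.of i) := by
      rw [MulEquiv.symm_apply_eq]
      apply Subtype.ext
      change g i = FreeGroup.lift g (FreeGroup.of i)
      simp
    simp only [MulEquiv.trans_apply]
    rw [key]
    change FreeGroup.lift h (FreeGroup.of i) = h i
    simp
  · rintro ⟨φ, hφ⟩
    have e1 : FreeGroup.lift g = (Subgroup.closure (Set.range g)).subtype.comp
        (FreeGroup.lift fun i =>
          (⟨g i, Subgroup.subset_closure (Set.mem_range_self i)⟩ :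
            Subgroup.closure (Set.range g))) := by
      ext i; simp
    have e2 : FreeGroup.lift h = ((Subgroup.closure (Set.range h)).subtype.comp φ.toMonoidHom).comp
        (FreeGroup.lift fun i =>
          (⟨g i, Subgroup.subset_closure (Set.mem_range_self i)⟩ :
            Subgroup.closure (Set.range g))) := by
      ext i; simp [hφ]
    ext w
    simp only [markedType, MonoidHom.mem_ker, e1, e2, MonoidHom.comp_apply]
    simp

/-- `G ≡ H` with respect to `k`-WL in Version II: some bijection `G^k → H^k` preserves final
colours. -/
def GroupWLEquiv (k : ℕ) (G H : Type*) [Group G] [Group H] : Prop :=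
  ∃ f : (Fin k → G) ≃ (Fin k → H),
    ∀ g, wlFinalColor markedType g = wlFinalColor markedType (f g)

/-- `k`-WL (Version II) distinguishes `G` from `H`. -/
def GroupWLDistinguishes (k : ℕ) (G H : Type*) [Group G] [Group H] : Prop :=
  ¬ GroupWLEquiv k G H

/-- `k`-WL (Version II) identifies `G`: it distinguishes `G` from every finite group that is not
isomorphic to `G`. -/
def GroupWLIdentifies (k : ℕ) (G : Type u) [Group G] : Prop :=
  ∀ (H : Type u) [Group H] [Finite H], ¬ Nonempty (G ≃* H) → GroupWLDistinguishes k G H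

/-! ### The Weisfeiler-Leman algorithm for graphs -/

/-- The initial colour of a tuple of vertices: which entries are equal and which are adjacent. See
`graphType_eq_iff` for the characterization by isomorphisms of induced subgraphs. -/
def graphType {V : Type*} (Γ : SimpleGraph V) {k : ℕ} (g : Fin k → V) :
    Fin k → Fin k → Prop × Prop :=
  fun i j => (g i = g j, Γ.Adj (g i) (g j))

/-- Two tuples have the same initial colour iff `g_i ↦ h_i` is an isomorphism between the
subgraphs induced by the tuples. -/
theorem graphType_eq_iff {V : Type*} (Γ : SimpleGraph V) {k : ℕ} (g h : Fin k → V) :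
    graphType Γ g = graphType Γ h ↔
      ∃ φ : Γ.induce (Set.range g) ≃g Γ.induce (Set.range h),
        ∀ i, (φ ⟨g i, Set.mem_range_self i⟩ : V) = h i := by
  constructor
  · intro hgh
    have h1 : ∀ i j, (g i = g j ↔ h i = h j) := fun i j =>
      iff_of_eq (congrArg Prod.fst (congrFun (congrFun hgh i) j))
    have h2 : ∀ i j, (Γ.Adj (g i) (g j) ↔ Γ.Adj (h i) (h j)) := fun i j =>
      iff_of_eq (congrArg Prod.snd (congrFun (congrFun hgh i) j))
    let F : Set.range g → Set.range h := fun x => ⟨h x.2.choose, Set.mem_range_self _⟩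
    have hF : ∀ i, F ⟨g i, Set.mem_range_self i⟩ = ⟨h i, Set.mem_range_self i⟩ := fun i =>
      Subtype.ext ((h1 _ _).1 (Set.mem_range_self (f := g) i).choose_spec)
    have hbij : Function.Bijective F := by
      constructor
      · rintro ⟨_, i, rfl⟩ ⟨_, j, rfl⟩ hij
        rw [hF, hF] at hij
        exact Subtype.ext ((h1 i j).2 (congrArg Subtype.val hij))
      · rintro ⟨_, i, rfl⟩
        exact ⟨_, hF i⟩
    refine ⟨⟨Equiv.ofBijective F hbij, ?_⟩, fun i => congrArg Subtype.val (hF i)⟩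
    rintro ⟨_, i, rfl⟩ ⟨_, j, rfl⟩
    change Γ.Adj (F _).1 (F _).1 ↔ Γ.Adj (g i) (g j)
    rw [hF, hF]
    exact (h2 i j).symm
  · rintro ⟨φ, hφ⟩
    funext i j
    refine Prod.ext (propext ?_) (propext ?_)
    · change g i = g j ↔ h i = h j
      rw [← hφ i, ← hφ j, Subtype.coe_inj, φ.injective.eq_iff, Subtype.mk.injEq]
    · change Γ.Adj (g i) (g j) ↔ Γ.Adj (h i) (h j)
      rw [← hφ i, ← hφ j]
      exact (φ.map_rel_iff (a := ⟨g i, Set.mem_range_self i⟩)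
        (b := ⟨g j, Set.mem_range_self j⟩)).symm

/-- `k`-WL (for `k ≥ 2`) distinguishes the graphs `Γ` and `Γ'`: when it is run on their disjoint
union, the multisets of final colours of the tuples of `Γ` and of the tuples of `Γ'` differ, that
is, there is no bijection between these tuples preserving final colours. -/
def GraphWLDistinguishes (k : ℕ) {V W : Type*} (Γ : SimpleGraph V) (Γ' : SimpleGraph W) : Prop :=
  ¬ ∃ f : (Fin k → V) ≃ (Fin k → W),
      ∀ g : Fin k → V,
        wlFinalColor (graphType (Γ ⊕g Γ')) (fun i => Sum.inl (g i)) =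
          wlFinalColor (graphType (Γ ⊕g Γ')) (fun i => Sum.inr (f g i))

/-- `Γ` has (graph) Weisfeiler-Leman dimension at most `k`: `k`-WL distinguishes `Γ` from every
finite graph that is not isomorphic to `Γ`. -/
def GraphWLDimLE {V : Type u} (Γ : SimpleGraph V) (k : ℕ) : Prop :=
  ∀ (W : Type u) [Finite W] (Γ' : SimpleGraph W), ¬ Nonempty (Γ ≃g Γ') →
    GraphWLDistinguishes k Γ Γ'

/-! ### CFI graphs -/

/-- The vertices of the CFI graph over `Γ`. In the gadget of `v`, the external pair associated with
the edge from `v` to `w` is `ext v w _ false` (called `a`) and `ext v w _ true` (called `b`). The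
internal vertices of the gadget are the 0-1-strings, indexed by the edges at `v`, with an even
number of ones. -/
inductive CFIVertex {V : Type u} (Γ : SimpleGraph V) : Type u
  | ext (v w : V) (hvw : Γ.Adj v w) (b : Bool) : CFIVertex Γ
  | int (v : V) (s : Γ.neighborSet v → Bool) (hs : Even (Nat.card {w // s w = true})) :
      CFIVertex Γ

/-- Adjacency in the CFI graph in which exactly the edges in `T` are twisted. -/
def cfiAdj {V : Type u} (Γ : SimpleGraph V) (T : Set (Sym2 V)) : CFIVertex Γ → CFIVertex Γ → Prop
  | .ext v w _ b, .ext v' w' _ b' => v' = w ∧ w' = v ∧ (b = b' ↔ s(v, w) ∉ T)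
  | .int v s _, .ext v' w' h' b' => ∃ hv : v' = v, s ⟨w', hv ▸ h'⟩ = b'
  | .ext v w h b, .int v' s' _ => ∃ hv : v = v', s' ⟨w, hv ▸ h⟩ = b
  | .int _ _ _, .int _ _ _ => False

/-- The CFI graph over `Γ` in which exactly the edges in `T` are twisted. -/
def cfiTwist {V : Type u} (Γ : SimpleGraph V) (T : Set (Sym2 V)) : SimpleGraph (CFIVertex Γ) where
  Adj := cfiAdj Γ T
  symm := ⟨by
    rintro (⟨v, w, h, b⟩ | ⟨v, s, hs⟩) (⟨v', w', h', b'⟩ | ⟨v', s', hs'⟩) hadj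
    · obtain ⟨rfl, rfl, hb⟩ := hadj
      refine ⟨rfl, rfl, ?_⟩
      rw [Sym2.eq_swap, eq_comm]
      exact hb
    · exact hadj
    · exact hadj
    · exact hadj⟩
  loopless := ⟨by
    rintro (⟨v, w, h, b⟩ | ⟨v, s, hs⟩) hadj
    · exact h.ne hadj.1
    · exact hadj⟩

/-- The graph `CFI(Γ)`. -/
def CFI {V : Type u} (Γ : SimpleGraph V) : SimpleGraph (CFIVertex Γ) := cfiTwist Γ ∅

/-- The twisted CFI graph, in which the single edge `e` is twisted. -/
def twistedCFI {V : Type u} (Γ : SimpleGraph V) (e : Sym2 V) : SimpleGraph (CFIVertex Γ) :=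
  cfiTwist Γ {e}

/-! ### Groups from graphs -/

/-- The relations `x_i^p = 1`, `[[x_i, x_j], x_k] = 1`, and `[x_i, x_j] = 1` for every edge. -/
def meklerRels {V : Type u} (p : ℕ) (Γ : SimpleGraph V) : Set (FreeGroup V) :=
  {r | ∃ i : V, r = FreeGroup.of i ^ p} ∪
  {r | ∃ i j k : V, r = ⁅⁅FreeGroup.of i, FreeGroup.of j⁆, FreeGroup.of k⁆} ∪
  {r | ∃ i j : V, Γ.Adj i j ∧ r = ⁅FreeGroup.of i, FreeGroup.of j⁆}

/-- Mekler's group `G_Γ` of exponent `p` and nilpotency class at most `2` (for an odd prime `p`),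
generated by the vertices of `Γ`. -/
abbrev MeklerGroup {V : Type u} (p : ℕ) (Γ : SimpleGraph V) : Type u :=
  PresentedGroup (meklerRels p Γ)

/-! On finite sets equality of final colours is a back-and-forth relation. Hence properties of
triples that are built from word equations by Boolean operations and by quantifying over one further
element `w`, with every clause using at most two of the old entries besides `w`
(`IsBackForth.inv₃_ex`), agree in any two finite groups that 3-WL does not distinguish. The proof
consists in expressing enough structure in this way.

CFI graphs over cubic graphs have no triangles and no 4-cycles, and every vertex has two neighbours.
For such a graph the noncentral elements of the Mekler group with nonabelian centralizer are exactly
those whose exponent vector is supported at one vertex (`MeklerGroup.isSingular_iff`). Two of them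
have the same centralizer iff they sit at the same vertex, and they commute iff their vertices are
equal or adjacent. So the graph is read off from invariant relations with classes of equal size, and
3-WL on groups simulates 3-WL on graphs (`ReadingGame.wlFinalColor_eq`).

Groups offer more: a single element encodes an arbitrary set of vertices, namely its support. Take
`x` whose support contains exactly one internal vertex of every gadget. With one pebble on `x`, two
pebbles remain for vertices. They suffice to see that the partner of `x` again encodes such a
transversal and to count the ordered pairs in it that are joined by a walk of length three. Since
all strings are even, this count is congruent to 2|E| - 2|T| modulo 4, whatever the transversal is
(`card_matched_modEq`), where T is the set of twisted edges. Thus the parity of |T| is detected,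
which distinguishes the two groups.

For identification, let `H` be a finite group that is not distinguished from one of them. Its
commutation graph inherits the sentences in `IsGadgetGraph`, and its graph of gadgets is not
distinguished from the base graph by 3-WL, hence is isomorphic to it by the hypothesis on the
dimension. So the commutation graph is a CFI graph with some set of twists (`IsCFILike.exists_iso`).
By connectedness at most one twist is needed (`CFIVertex.nonempty_iso_cfi`), and parity selects the
right case. Finally, elements of `H` with trivial `p`-th power that represent the vertices satisfy
the Mekler relations. The induced homomorphism is onto, because generation modulo the center and the
inclusion of the center in the commutator subgroup transfer to `H`, and the orders agree
(`MeklerGroup.nonempty_mulEquiv`). -/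

/-! ### Back-and-forth relations and colour refinement -/

/-- A back-and-forth relation between `k`-tuples: any related pair of tuples admits a bijection
of the ground sets such that simultaneous replacements keep the tuples related. -/
structure IsBackForth {X Y : Type*} {k : ℕ} (R : (Fin k → X) → (Fin k → Y) → Prop) : Prop where
  nonempty : ∃ g h, R g h
  step : ∀ g h, R g h →
    ∃ π : X ≃ Y, ∀ j x, R (Function.update g j x) (Function.update h j (π x))

theorem exists_equiv_of_encard_fiber_eq {X Y C : Type*} [Finite X] [Finite Y] (f : X → C)
    (f' : Y → C) (h : ∀ c, Set.encard {x | f x = c} = Set.encard {y | f' y = c}) :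
    ∃ π : X ≃ Y, ∀ x, f' (π x) = f x := by
  have hc : ∀ c, Nonempty ({x // f x = c} ≃ {y // f' y = c}) := fun c => by
    have h1 : Nat.card {x // f x = c} = Nat.card {y // f' y = c} := by
      have := congrArg ENat.toNat (h c)
      exact this
    exact Finite.card_eq.1 h1
  have e := fun c => Classical.choice (hc c)
  refine ⟨(Equiv.sigmaFiberEquiv f).symm.trans
    ((Equiv.sigmaCongrRight e).trans (Equiv.sigmaFiberEquiv f')), fun x => ?_⟩
  exact (e (f x) ⟨x, rfl⟩).2

theorem encard_fiber_eq_of_equiv {X Y C : Type*} (f : X → C) (f' : Y → C) (π : X ≃ Y)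
    (h : ∀ x, f' (π x) = f x) (c : C) :
    Set.encard {x | f x = c} = Set.encard {y | f' y = c} := by
  have : {y | f' y = c} = π '' {x | f x = c} := by
    ext y
    constructor
    · intro hy
      exact ⟨π.symm y, by simpa [← h] using hy, by simp⟩
    · rintro ⟨x, hx, rfl⟩
      exact (h x).trans hx
  rw [this, π.injective.encard_image]

theorem wlColor_eq_of_le {X Y : Type*} {C : Type} {k : ℕ} {χ : (Fin k → X) → C}
    {χ' : (Fin k → Y) → C} {g : Fin k → X} {h : Fin k → Y} {i i' : ℕ} (hi : i ≤ i')
    (he : wlColor χ i' g = wlColor χ' i' h) : wlColor χ i g = wlColor χ' i h := by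
  induction i', hi using Nat.le_induction with
  | base => exact he
  | succ n _ ih => exact ih (congrArg Prod.fst he)

/-- Every round provides its own bijection. As there are only finitely many bijections, one of them
serves infinitely many rounds, and therefore all rounds, because later colours determine earlier
ones. -/
theorem wlFinalColor_step {X Y : Type*} [Finite X] [Finite Y] {C : Type} {k : ℕ}
    {χ : (Fin k → X) → C} {χ' : (Fin k → Y) → C} {g : Fin k → X} {h : Fin k → Y}
    (he : wlFinalColor χ g = wlFinalColor χ' h) :
    ∃ π : X ≃ Y, ∀ j x, wlFinalColor χ (Function.update g j x) =
      wlFinalColor χ' (Function.update h j (π x)) := by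
  have h1 : ∀ i, ∃ π : X ≃ Y, ∀ j x, wlColor χ i (Function.update g j x) =
      wlColor χ' i (Function.update h j (π x)) := by
    intro i
    have := congrArg Prod.snd (congrFun he (i + 1))
    obtain ⟨π, hπ⟩ := exists_equiv_of_encard_fiber_eq _ _ (fun c => congrFun this c)
    exact ⟨π, fun j x => (congrFun (hπ x) j).symm⟩
  choose π hπ using h1
  obtain ⟨σ, hσ⟩ := Finite.exists_infinite_fiber π
  refine ⟨σ, fun j x => funext fun i => ?_⟩
  have hinf : (π ⁻¹' {σ}).Infinite := Set.infinite_coe_iff.1 hσ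
  obtain ⟨i', hi', hlt⟩ := hinf.exists_gt i
  have : π i' = σ := hi'
  subst this
  exact wlColor_eq_of_le hlt.le (hπ i' j x)

theorem isBackForth_wlFinalColor {X Y : Type*} [Finite X] [Finite Y] {C : Type} {k : ℕ}
    {χ : (Fin k → X) → C} {χ' : (Fin k → Y) → C}
    (h0 : ∃ g h, wlFinalColor χ g = wlFinalColor χ' h) :
    IsBackForth fun g h => wlFinalColor χ g = wlFinalColor χ' h :=
  ⟨h0, fun _ _ he => wlFinalColor_step he⟩

namespace IsBackForth

variable {X Y : Type*} {k : ℕ} {R : (Fin k → X) → (Fin k → Y) → Prop}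

theorem symm (hR : IsBackForth R) : IsBackForth fun h g => R g h := by
  refine ⟨?_, fun h g hgh => ?_⟩
  · obtain ⟨g, h, hgh⟩ := hR.nonempty
    exact ⟨h, g, hgh⟩
  · obtain ⟨π, hπ⟩ := hR.step g h hgh
    exact ⟨π.symm, fun j y => by simpa using hπ j (π.symm y)⟩

/-- Starting from any related pair, the entries are changed to those of `g` one at a time; the
partner tuple follows along. -/
theorem exists_right (hR : IsBackForth R) (g : Fin k → X) : ∃ h, R g h := by
  have : ∀ s : Finset (Fin k), ∃ g' h', R g' h' ∧ ∀ j ∈ s, g' j = g j := by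
    intro s
    induction s using Finset.induction_on with
    | empty => simpa using hR.nonempty
    | insert a s ha ih =>
      obtain ⟨g', h', hR', hs⟩ := ih
      obtain ⟨π, hπ⟩ := hR.step g' h' hR'
      refine ⟨_, _, hπ a (g a), fun j hj => ?_⟩
      by_cases hja : j = a
      · subst hja; simp
      · rw [Function.update_of_ne hja]
        exact hs j ((Finset.mem_insert.1 hj).resolve_left hja)
  obtain ⟨g', h', hR', hs⟩ := this Finset.univ
  have : g' = g := funext fun j => hs j (Finset.mem_univ j)
  exact ⟨h', this ▸ hR'⟩

theorem exists_left (hR : IsBackForth R) (h : Fin k → Y) : ∃ g, R g h :=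
  hR.symm.exists_right h

/-- Fixing the first entries of related tuples. -/
theorem cons {R : (Fin (k + 1) → X) → (Fin (k + 1) → Y) → Prop} (hR : IsBackForth R) {x : X}
    {y : Y} (hne : ∃ g h, R (Fin.cons x g : Fin (k + 1) → X) (Fin.cons y h : Fin (k + 1) → Y)) :
    IsBackForth fun (g : Fin k → X) (h : Fin k → Y) =>
      R (Fin.cons x g : Fin (k + 1) → X) (Fin.cons y h : Fin (k + 1) → Y) := by
  refine ⟨hne, fun g h hgh => ?_⟩
  obtain ⟨σ, hσ⟩ := hR.step _ _ hgh
  refine ⟨σ, fun j z => ?_⟩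
  rw [Fin.cons_update, Fin.cons_update]
  exact hσ j.succ z

/-- Induction on `k`: one bijection `π` matches the first entries, and for every first entry `x` the
relation with first entries fixed to `x` and `π x` is again back-and-forth, on `k`-tuples. -/
theorem exists_equiv (hR : IsBackForth R) :
    ∃ f : (Fin k → X) ≃ (Fin k → Y), ∀ g, R g (f g) := by
  induction k with
  | zero =>
    obtain ⟨g, h, hgh⟩ := hR.nonempty
    refine ⟨Equiv.ofUnique _ _, fun g' => ?_⟩
    rwa [Subsingleton.elim g' g, Subsingleton.elim (Equiv.ofUnique _ _ g) h]
  | succ k ih =>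
    obtain ⟨g, h, hgh⟩ := hR.nonempty
    obtain ⟨π, hπ⟩ := hR.step g h hgh
    have hx : ∀ x : X, ∃ g h, R (Fin.cons x g : Fin (k + 1) → X)
        (Fin.cons (π x) h : Fin (k + 1) → Y) := by
      intro x
      refine ⟨Fin.tail g, Fin.tail h, ?_⟩
      have := hπ 0 x
      rwa [← Fin.cons_self_tail g, ← Fin.cons_self_tail h, Fin.update_cons_zero,
        Fin.update_cons_zero] at this
    choose f hf using fun x => ih (hR.cons (hx x))
    refine ⟨(Fin.consEquiv fun _ => X).symm.trans ((Equiv.prodShear π f).trans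
      (Fin.consEquiv fun _ => Y)), fun g' => ?_⟩
    have := hf (g' 0) (Fin.tail g')
    rw [Fin.cons_self_tail] at this
    exact this

/-- The bijection of `step` matches the multisets of the next round. With
`isBackForth_wlFinalColor`, equality of final colours on finite sets is, when nonempty, the coarsest
back-and-forth relation that respects the initial colours. -/
theorem wlFinalColor_eq (hR : IsBackForth R) {C : Type} {χ : (Fin k → X) → C}
    {χ' : (Fin k → Y) → C} (h0 : ∀ g h, R g h → χ g = χ' h) (g : Fin k → X) (h : Fin k → Y)
    (hgh : R g h) : wlFinalColor χ g = wlFinalColor χ' h := by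
  funext i
  change wlColor χ i g = wlColor χ' i h
  induction i generalizing g h with
  | zero => exact h0 g h hgh
  | succ i ih =>
    refine Prod.ext (ih g h hgh) (funext fun c => ?_)
    obtain ⟨π, hπ⟩ := hR.step g h hgh
    exact encard_fiber_eq_of_equiv _ _ π (fun x => funext fun j => (ih _ _ (hπ j x)).symm) c

/-- Restriction of a back-and-forth relation to an invariant subset. -/
theorem restrict (hR : IsBackForth R) {D : Set X} {D' : Set Y}
    (hD : ∀ g h, R g h → ∀ j, g j ∈ D ↔ h j ∈ D') (hne : D.Nonempty) (hk : k ≠ 0) :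
    IsBackForth fun (g : Fin k → D) (h : Fin k → D') =>
      R (fun j => (g j : X)) (fun j => (h j : Y)) := by
  refine ⟨?_, fun g h hgh => ?_⟩
  · obtain ⟨x, hx⟩ := hne
    obtain ⟨h, hh⟩ := hR.exists_right fun _ => x
    exact ⟨fun _ => ⟨x, hx⟩, fun j => ⟨h j, (hD _ _ hh j).1 hx⟩, hh⟩
  · obtain ⟨π, hπ⟩ := hR.step _ _ hgh
    have hmem : ∀ x, x ∈ D ↔ π x ∈ D' := fun x => by
      have j : Fin k := ⟨0, Nat.pos_of_ne_zero hk⟩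
      simpa using hD _ _ (hπ j x) j
    refine ⟨π.subtypeEquiv hmem, fun j x => ?_⟩
    have h1 : (fun i => ((Function.update g j x i : D) : X)) =
        Function.update (fun i => (g i : X)) j x :=
      funext fun i => Function.apply_update (fun _ (y : D) => (y : X)) g j x i
    have h2 : (fun i => ((Function.update h j (π.subtypeEquiv hmem x) i : D') : Y)) =
        Function.update (fun i => (h i : Y)) j (π x) :=
      funext fun i => Function.apply_update (fun _ (y : D') => (y : Y)) h j _ i
    rw [h1, h2]
    exact hπ j x

end IsBackForth

theorem Nat.card_subtype_comp {X A : Type*} [Finite X] [Finite A] (q : X → A) (m : ℕ)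
    (hq : ∀ a, Nat.card {x // q x = a} = m) (P : A → Prop) :
    Nat.card {x // P (q x)} = m * Nat.card {a // P a} := by
  let e : {x // P (q x)} ≃ Σ a : {a // P a}, {x // q x = a} :=
    { toFun := fun x => ⟨⟨q x, x.2⟩, ⟨x, rfl⟩⟩
      invFun := fun y => ⟨y.2, by rw [y.2.2]; exact y.1.2⟩
      left_inv := fun x => rfl
      right_inv := by
        rintro ⟨⟨a, ha⟩, ⟨x, hx⟩⟩
        exact Sigma.subtype_ext (Subtype.ext hx) rfl }
  have := Fintype.ofFinite {a // P a}
  rw [Nat.card_congr e, Nat.card_sigma]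
  simp [hq, mul_comm]

/-- If a back-and-forth relation is compatible with maps to `A` and `B` whose fibres all have the
same size, then final colours of the image tuples agree. -/
theorem IsBackForth.wlFinalColor_comp_eq {X Y A B : Type*} [Finite X] [Finite Y] [Finite A]
    [Finite B] {k : ℕ} {R : (Fin k → X) → (Fin k → Y) → Prop} (hR : IsBackForth R)
    (q : X → A) (q' : Y → B) (m : ℕ) (hm : 0 < m) (hq : ∀ a, Nat.card {x // q x = a} = m)
    (hq' : ∀ b, Nat.card {y // q' y = b} = m) {C : Type} {χ : (Fin k → A) → C}
    {χ' : (Fin k → B) → C} (h0 : ∀ g h, R g h → χ (q ∘ g) = χ' (q' ∘ h))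
    (g : Fin k → X) (h : Fin k → Y) (hgh : R g h) :
    wlFinalColor χ (q ∘ g) = wlFinalColor χ' (q' ∘ h) := by
  funext i
  change wlColor χ i (q ∘ g) = wlColor χ' i (q' ∘ h)
  induction i generalizing g h with
  | zero => exact h0 g h hgh
  | succ i ih =>
    refine Prod.ext (ih g h hgh) (funext fun c => ?_)
    obtain ⟨π, hπ⟩ := hR.step g h hgh
    set f : A → (Fin k → WLColor C k i) :=
      fun a j => wlColor χ i (Function.update (q ∘ g) j a) with hf
    set f' : B → (Fin k → WLColor C k i) :=
      fun b j => wlColor χ' i (Function.update (q' ∘ h) j b) with hf'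
    have hff : ∀ x, f' (q' (π x)) = f (q x) := fun x => funext fun j => by
      have := ih _ _ (hπ j x)
      rw [Function.comp_update, Function.comp_update] at this
      exact this.symm
    -- Counting replacements in `X` and `Y` instead of `A` and `B` multiplies each multiplicity by
    -- `m` on both sides, so `m` can be cancelled.
    have h1 := Nat.card_subtype_comp q m hq (fun a => f a = c)
    have h2 := Nat.card_subtype_comp q' m hq' (fun b => f' b = c)
    have h3 : Nat.card {x // f (q x) = c} = Nat.card {y // f' (q' y) = c} :=
      Nat.card_congr (π.subtypeEquiv fun x => by rw [hff])
    rw [h1, h2] at h3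
    have h4 := Nat.eq_of_mul_eq_mul_left hm h3
    change Set.encard {a | f a = c} = Set.encard {b | f' b = c}
    rw [← Set.toFinite _ |>.cast_ncard_eq, ← Set.toFinite {b | f' b = c} |>.cast_ncard_eq]
    exact congrArg Nat.cast h4

/-! ### Invariant predicates -/

/-- A pair of unary predicates that no related triples separate. -/
def Inv₁ {X Y : Type*} (R : (Fin 3 → X) → (Fin 3 → Y) → Prop) (P : X → Prop) (P' : Y → Prop) :
    Prop :=
  ∀ g h, R g h → ∀ i, P (g i) ↔ P' (h i)

/-- A pair of binary predicates that no related triples separate. -/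
def Inv₂ {X Y : Type*} (R : (Fin 3 → X) → (Fin 3 → Y) → Prop) (P : X → X → Prop)
    (P' : Y → Y → Prop) : Prop :=
  ∀ g h, R g h → ∀ i j, P (g i) (g j) ↔ P' (h i) (h j)

/-- A pair of ternary predicates that no related triples separate. -/
def Inv₃ {X Y : Type*} (R : (Fin 3 → X) → (Fin 3 → Y) → Prop) (P : X → X → X → Prop)
    (P' : Y → Y → Y → Prop) : Prop :=
  ∀ g h, R g h → ∀ i j k, P (g i) (g j) (g k) ↔ P' (h i) (h j) (h k)

namespace IsBackForth

variable {X Y : Type*} {R : (Fin 3 → X) → (Fin 3 → Y) → Prop}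

/-- Any two entries of related triples can be kept while a third one is replaced. -/
theorem step_pair (hR : IsBackForth R) {g : Fin 3 → X} {h : Fin 3 → Y} (hgh : R g h) :
    ∃ π : X ≃ Y, ∀ i j w, ∃ l, R (Function.update g l w) (Function.update h l (π w)) ∧
      Function.update g l w i = g i ∧ Function.update g l w j = g j ∧
      Function.update g l w l = w ∧ Function.update h l (π w) i = h i ∧
      Function.update h l (π w) j = h j ∧ Function.update h l (π w) l = π w := by
  obtain ⟨π, hπ⟩ := hR.step g h hgh
  refine ⟨π, fun i j w => ?_⟩
  have : ∀ i j : Fin 3, ∃ l, i ≠ l ∧ j ≠ l := by decide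
  obtain ⟨l, hil, hjl⟩ := this i j
  exact ⟨l, hπ l w, by simp [hil], by simp [hjl], by simp, by simp [hil], by simp [hjl], by simp⟩

theorem step_inv₃ (hR : IsBackForth R) {g : Fin 3 → X} {h : Fin 3 → Y} (hgh : R g h) :
    ∃ π : X ≃ Y, ∀ A A', Inv₃ R A A' → ∀ i j w, A (g i) (g j) w ↔ A' (h i) (h j) (π w) := by
  obtain ⟨π, hπ⟩ := hR.step_pair hgh
  refine ⟨π, fun A A' hA i j w => ?_⟩
  obtain ⟨l, hl, h1, h2, h3, h4, h5, h6⟩ := hπ i j w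
  have := hA _ _ hl i j l
  rwa [h1, h2, h3, h4, h5, h6] at this

/-- A fourth variable `w` is affordable: every clause omits one of `x`, `y`, `z`, whose pebble can
be put on `w`. The clauses hold for the same `w` because one bijection serves all positions. -/
theorem inv₃_ex (hR : IsBackForth R) {A B C : X → X → X → Prop} {A' B' C' : Y → Y → Y → Prop}
    (hA : Inv₃ R A A') (hB : Inv₃ R B B') (hC : Inv₃ R C C') :
    Inv₃ R (fun x y z => ∃ w, A x y w ∧ B y z w ∧ C x z w)
      (fun x y z => ∃ w, A' x y w ∧ B' y z w ∧ C' x z w) := by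
  intro g h hgh i j k
  obtain ⟨π, hπ⟩ := hR.step_inv₃ hgh
  exact π.exists_congr fun w =>
    and_congr (hπ _ _ hA i j w) (and_congr (hπ _ _ hB j k w) (hπ _ _ hC i k w))

theorem inv₂_ex (hR : IsBackForth R) {A : X → X → X → Prop} {A' : Y → Y → Y → Prop}
    (hA : Inv₃ R A A') :
    Inv₂ R (fun x y => ∃ w, A x y w) (fun x y => ∃ w, A' x y w) := by
  intro g h hgh i j
  obtain ⟨π, hπ⟩ := hR.step_inv₃ hgh
  exact π.exists_congr fun w => hπ _ _ hA i j w

theorem inv₂_all (hR : IsBackForth R) {A : X → X → X → Prop} {A' : Y → Y → Y → Prop}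
    (hA : Inv₃ R A A') :
    Inv₂ R (fun x y => ∀ w, A x y w) (fun x y => ∀ w, A' x y w) := by
  intro g h hgh i j
  obtain ⟨π, hπ⟩ := hR.step_inv₃ hgh
  exact π.forall_congr fun w => hπ _ _ hA i j w

theorem inv₁_ex (hR : IsBackForth R) {A : X → X → Prop} {A' : Y → Y → Prop}
    (hA : Inv₂ R A A') : Inv₁ R (fun x => ∃ w, A x w) (fun x => ∃ w, A' x w) :=
  fun g h hgh i => hR.inv₂_ex (A := fun x _ w => A x w) (A' := fun x _ w => A' x w)
    (fun g h hgh i _ k => hA g h hgh i k) g h hgh i i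

theorem inv₁_all (hR : IsBackForth R) {A : X → X → Prop} {A' : Y → Y → Prop}
    (hA : Inv₂ R A A') : Inv₁ R (fun x => ∀ w, A x w) (fun x => ∀ w, A' x w) :=
  fun g h hgh i => hR.inv₂_all (A := fun x _ w => A x w) (A' := fun x _ w => A' x w)
    (fun g h hgh i _ k => hA g h hgh i k) g h hgh i i

theorem card_eq_of_inv₂ (hR : IsBackForth R) {A : X → X → Prop} {A' : Y → Y → Prop}
    (hA : Inv₂ R A A') {g : Fin 3 → X} {h : Fin 3 → Y} (hgh : R g h) (i : Fin 3) :
    Nat.card {w // A (g i) w} = Nat.card {w // A' (h i) w} := by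
  obtain ⟨π, hπ⟩ := hR.step_inv₃ hgh
  exact Nat.card_congr (π.subtypeEquiv fun w =>
    hπ (fun x _ w => A x w) (fun x _ w => A' x w) (fun g h hgh i _ k => hA g h hgh i k) i i w)

/-- Universal sentences transfer because every element of `Y` is an entry of some triple that has a
partner. -/
theorem forall₁ (hR : IsBackForth R) {P : X → Prop} {P' : Y → Prop} (hP : Inv₁ R P P')
    (h0 : ∀ x, P x) (y : Y) : P' y := by
  obtain ⟨g, hg⟩ := hR.exists_left fun _ => y
  exact (hP _ _ hg 0).1 (h0 _)

theorem forall₂ (hR : IsBackForth R) {P : X → X → Prop} {P' : Y → Y → Prop} (hP : Inv₂ R P P')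
    (h0 : ∀ x y, P x y) (y z : Y) : P' y z := by
  obtain ⟨g, hg⟩ := hR.exists_left ![y, z, z]
  exact (hP _ _ hg 0 1).1 (h0 _ _)

theorem forall₃ (hR : IsBackForth R) {P : X → X → X → Prop} {P' : Y → Y → Y → Prop}
    (hP : Inv₃ R P P') (h0 : ∀ x y z, P x y z) (x y z : Y) : P' x y z := by
  obtain ⟨g, hg⟩ := hR.exists_left ![x, y, z]
  exact (hP _ _ hg 0 1 2).1 (h0 _ _ _)

end IsBackForth

/-! ### Disjoint unions -/

/-- Final colours in a disjoint union: if triples of `Γ` and `Γ'` are related by a back-and-forth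
relation that preserves the graph types, then they have the same final colours in `Γ ⊕g Γ'`. -/
theorem wlFinalColor_sum_eq {V W : Type*} {k : ℕ} {Γ : SimpleGraph V} {Γ' : SimpleGraph W}
    {R : (Fin k → V) → (Fin k → W) → Prop} (hR : IsBackForth R)
    (h0 : ∀ g h, R g h → graphType Γ g = graphType Γ' h) {g : Fin k → V} {h : Fin k → W}
    (hgh : R g h) :
    wlFinalColor (graphType (Γ ⊕g Γ')) (fun i => Sum.inl (g i)) =
      wlFinalColor (graphType (Γ ⊕g Γ')) (fun i => Sum.inr (h i)) := by
  -- `Q` exchanges the two sides of the union. The entries on the left follow one related pair,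
  -- those on the right another; both pairs are full `k`-tuples, with irrelevant values at the
  -- unused places.
  let Q : (Fin k → V ⊕ W) → (Fin k → V ⊕ W) → Prop := fun t t' =>
    ∃ g h g' h', R g h ∧ R g' h' ∧ ∀ i, (t i = Sum.inl (g i) ∧ t' i = Sum.inr (h i)) ∨
      (t i = Sum.inr (h' i) ∧ t' i = Sum.inl (g' i))
  have hQ : IsBackForth Q := by
    refine ⟨⟨_, _, g, h, g, h, hgh, hgh, fun i => Or.inl ⟨rfl, rfl⟩⟩, ?_⟩
    rintro t t' ⟨g, h, g', h', h1, h2, ht⟩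
    obtain ⟨π, hπ⟩ := hR.step g h h1
    obtain ⟨π', hπ'⟩ := hR.step g' h' h2
    refine ⟨(Equiv.sumCongr π π'.symm).trans (Equiv.sumComm W V), ?_⟩
    rintro j (x | y)
    · refine ⟨_, _, g', h', hπ j x, h2, fun i => ?_⟩
      by_cases hij : i = j
      · subst hij; simp
      · simpa [hij] using ht i
    · refine ⟨g, h, _, _, h1, hπ' j (π'.symm y), fun i => ?_⟩
      by_cases hij : i = j
      · subst hij; simp
      · simpa [hij] using ht i
  refine hQ.wlFinalColor_eq ?_ _ _ ⟨g, h, g, h, hgh, hgh, fun i => Or.inl ⟨rfl, rfl⟩⟩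
  rintro t t' ⟨g, h, g', h', h1, h2, ht⟩
  have e1 := h0 _ _ h1
  have e2 := h0 _ _ h2
  have e1' : ∀ i j, (g i = g j ↔ h i = h j) ∧ (Γ.Adj (g i) (g j) ↔ Γ'.Adj (h i) (h j)) :=
    fun i j => by
      have := congrFun (congrFun e1 i) j
      simpa [graphType, Prod.ext_iff] using this
  have e2' : ∀ i j, (g' i = g' j ↔ h' i = h' j) ∧
      (Γ.Adj (g' i) (g' j) ↔ Γ'.Adj (h' i) (h' j)) :=
    fun i j => by
      have := congrFun (congrFun e2 i) j
      simpa [graphType, Prod.ext_iff] using this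
  funext i j
  refine Prod.ext (propext ?_) (propext ?_)
  · change t i = t j ↔ t' i = t' j
    rcases ht i with ⟨a, b⟩ | ⟨a, b⟩ <;> rcases ht j with ⟨c, d⟩ | ⟨c, d⟩ <;>
      simp [a, b, c, d, e1', e2']
  · change (Γ ⊕g Γ').Adj (t i) (t j) ↔ (Γ ⊕g Γ').Adj (t' i) (t' j)
    rcases ht i with ⟨a, b⟩ | ⟨a, b⟩ <;> rcases ht j with ⟨c, d⟩ | ⟨c, d⟩ <;>
      simp [a, b, c, d, e1', e2']

/-! ### Mekler groups -/

/-- The set of exponent vectors and commutator exponents, a concrete model of class `2` in which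
commutation of elements of the Mekler group can be tested. -/
@[ext] structure MeklerModel {V : Type*} (p : ℕ) (Γ : SimpleGraph V) where
  vec : V → ZMod p
  com : V → V → ZMod p

namespace MeklerModel

variable {V : Type*} {p : ℕ} {Γ : SimpleGraph V}

open Classical in
/-- The bilinear map that defines the product of the model. -/
noncomputable def form (Γ : SimpleGraph V) (a b : V → ZMod p) (u v : V) : ZMod p :=
  if u ≠ v ∧ ¬ Γ.Adj u v then a u * b v else 0

theorem form_add_left (a b c : V → ZMod p) (u v : V) :
    form Γ (a + b) c u v = form Γ a c u v + form Γ b c u v := by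
  unfold form; split_ifs <;> simp [add_mul]

theorem form_add_right (a b c : V → ZMod p) (u v : V) :
    form Γ a (b + c) u v = form Γ a b u v + form Γ a c u v := by
  unfold form; split_ifs <;> simp [mul_add]

theorem form_neg_left (a b : V → ZMod p) (u v : V) : form Γ (-a) b u v = -form Γ a b u v := by
  unfold form; split_ifs <;> simp

theorem form_zero_left (b : V → ZMod p) (u v : V) : form Γ 0 b u v = 0 := by simp [form]

theorem form_zero_right (b : V → ZMod p) (u v : V) : form Γ b 0 u v = 0 := by simp [form]

noncomputable instance : Group (MeklerModel p Γ) where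
  mul x y := ⟨x.vec + y.vec, fun u v => x.com u v + y.com u v + form Γ x.vec y.vec u v⟩
  one := ⟨0, 0⟩
  inv x := ⟨-x.vec, fun u v => -x.com u v + form Γ x.vec x.vec u v⟩
  mul_assoc x y z := by
    refine MeklerModel.ext (add_assoc _ _ _) (funext fun u => funext fun v => ?_)
    change x.com u v + y.com u v + form Γ x.vec y.vec u v + z.com u v +
      form Γ (x.vec + y.vec) z.vec u v = x.com u v + (y.com u v + z.com u v +
      form Γ y.vec z.vec u v) + form Γ x.vec (y.vec + z.vec) u v
    rw [form_add_left, form_add_right]; ring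
  one_mul x := by
    refine MeklerModel.ext (zero_add _) (funext fun u => funext fun v => ?_)
    change 0 + x.com u v + form Γ 0 x.vec u v = _
    rw [form_zero_left]; ring
  mul_one x := by
    refine MeklerModel.ext (add_zero _) (funext fun u => funext fun v => ?_)
    change x.com u v + 0 + form Γ x.vec 0 u v = _
    rw [form_zero_right]; ring
  inv_mul_cancel x := by
    refine MeklerModel.ext (neg_add_cancel _) (funext fun u => funext fun v => ?_)
    change -x.com u v + form Γ x.vec x.vec u v + x.com u v + form Γ (-x.vec) x.vec u v = 0
    rw [form_neg_left]; ring

@[simp] theorem vec_mul (x y : MeklerModel p Γ) : (x * y).vec = x.vec + y.vec := rfl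

@[simp] theorem vec_one : (1 : MeklerModel p Γ).vec = 0 := rfl

theorem com_mul (x y : MeklerModel p Γ) (u v : V) :
    (x * y).com u v = x.com u v + y.com u v + form Γ x.vec y.vec u v := rfl

/-- The exponent vector as a homomorphism. -/
def vecHom (p : ℕ) (Γ : SimpleGraph V) : MeklerModel p Γ →* Multiplicative (V → ZMod p) where
  toFun x := Multiplicative.ofAdd x.vec
  map_one' := rfl
  map_mul' _ _ := rfl

/-- The form is not symmetric: `x * y` and `y * x` differ at a nonadjacent pair by the 2×2 minor of
the two exponent vectors, and nowhere else. -/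
theorem commute_iff (x y : MeklerModel p Γ) :
    Commute x y ↔ ∀ u v, u ≠ v → ¬ Γ.Adj u v → x.vec u * y.vec v = y.vec u * x.vec v := by
  constructor
  · intro h u v huv hadj
    have := congrFun (congrFun (congrArg MeklerModel.com h.eq) u) v
    rw [com_mul, com_mul, form, form, if_pos ⟨huv, hadj⟩, if_pos ⟨huv, hadj⟩] at this
    linear_combination this
  · intro h
    refine MeklerModel.ext (add_comm _ _) (funext fun u => funext fun v => ?_)
    rw [com_mul, com_mul, add_comm (x.com u v)]
    congr 1
    unfold form
    split_ifs with huv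
    · exact h u v huv.1 huv.2
    · rfl

open Classical in
/-- The generators of the model. -/
noncomputable def gen (p : ℕ) (Γ : SimpleGraph V) (v : V) : MeklerModel p Γ := ⟨Pi.single v 1, 0⟩

open Classical in
theorem gen_pow (v : V) (n : ℕ) : gen p Γ v ^ n = ⟨Pi.single v (n : ZMod p), 0⟩ := by
  induction n with
  | zero => refine MeklerModel.ext ?_ rfl; simp
  | succ n ih =>
    rw [pow_succ, ih]
    refine MeklerModel.ext ?_ (funext fun u => funext fun w => ?_)
    · simp only [gen, vec_mul, ← Pi.single_add]; push_cast; rfl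
    · rw [com_mul]
      simp only [gen, form, Pi.zero_apply, add_zero, zero_add]
      split_ifs with h
      · by_cases hu : u = v
        · have : w ≠ v := fun hw => h.1 (hu.trans hw.symm)
          simp [this]
        · simp [hu]
      · rfl

end MeklerModel

namespace MeklerGroup

variable {V : Type u} {p : ℕ} {Γ : SimpleGraph V}

/-- The generator `x_v`. -/
def gen (p : ℕ) (Γ : SimpleGraph V) (v : V) : MeklerGroup p Γ := PresentedGroup.of v

theorem gen_pow (v : V) : gen p Γ v ^ p = 1 := by
  have : PresentedGroup.mk (meklerRels p Γ) (FreeGroup.of v ^ p) = 1 :=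
    PresentedGroup.one_of_mem (Or.inl (Or.inl ⟨v, rfl⟩))
  rwa [map_pow] at this

theorem gen_commutator (u v w : V) : ⁅⁅gen p Γ u, gen p Γ v⁆, gen p Γ w⁆ = 1 := by
  have : PresentedGroup.mk (meklerRels p Γ)
      ⁅⁅FreeGroup.of u, FreeGroup.of v⁆, FreeGroup.of w⁆ = 1 :=
    PresentedGroup.one_of_mem (Or.inl (Or.inr ⟨u, v, w, rfl⟩))
  rwa [map_commutatorElement, map_commutatorElement] at this

theorem gen_commute {u v : V} (h : Γ.Adj u v) : Commute (gen p Γ u) (gen p Γ v) := by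
  have : PresentedGroup.mk (meklerRels p Γ) ⁅FreeGroup.of u, FreeGroup.of v⁆ = 1 :=
    PresentedGroup.one_of_mem (Or.inr ⟨u, v, h, rfl⟩)
  rw [← commutatorElement_eq_one_iff_commute]
  rwa [map_commutatorElement] at this

theorem closure_gen : Subgroup.closure (Set.range (gen p Γ)) = ⊤ :=
  PresentedGroup.closure_range_of _

/-- The homomorphism defined by images of the generators that satisfy the relations. -/
def lift {K : Type*} [Group K] (f : V → K) (h1 : ∀ v, f v ^ p = 1)
    (h2 : ∀ u v w, ⁅⁅f u, f v⁆, f w⁆ = 1) (h3 : ∀ u v, Γ.Adj u v → Commute (f u) (f v)) :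
    MeklerGroup p Γ →* K :=
  PresentedGroup.toGroup (f := f) <| by
    rintro r ((⟨i, rfl⟩ | ⟨i, j, k, rfl⟩) | ⟨i, j, hij, rfl⟩)
    · simpa using h1 i
    · simpa [map_commutatorElement] using h2 i j k
    · simpa [map_commutatorElement] using commutatorElement_eq_one_iff_commute.2 (h3 i j hij)

theorem lift_gen {K : Type*} [Group K] (f : V → K) (h1 : ∀ v, f v ^ p = 1)
    (h2 : ∀ u v w, ⁅⁅f u, f v⁆, f w⁆ = 1) (h3 : ∀ u v, Γ.Adj u v → Commute (f u) (f v)) (v : V) :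
    lift f h1 h2 h3 (gen p Γ v) = f v :=
  PresentedGroup.toGroup.of _

theorem mem_center_of_forall_gen {x : MeklerGroup p Γ} (h : ∀ v, Commute x (gen p Γ v)) :
    x ∈ Subgroup.center (MeklerGroup p Γ) := by
  have : Subgroup.closure (Set.range (gen p Γ)) ≤ Subgroup.centralizer {x} := by
    rw [Subgroup.closure_le]
    rintro _ ⟨v, rfl⟩
    exact Subgroup.mem_centralizer_singleton_iff.2 (h v).symm.eq
  rw [closure_gen] at this
  exact Subgroup.mem_center_iff.2 fun g =>
    Subgroup.mem_centralizer_singleton_iff.1 (this (Subgroup.mem_top g))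

/-- By the triple commutator relations the generators commute modulo the center, so the quotient by
the center is abelian. -/
theorem commutator_mem_center (x y : MeklerGroup p Γ) :
    ⁅x, y⁆ ∈ Subgroup.center (MeklerGroup p Γ) := by
  let Z := Subgroup.center (MeklerGroup p Γ)
  let π := QuotientGroup.mk' Z
  have hgen : ∀ u v, Commute (π (gen p Γ u)) (π (gen p Γ v)) := fun u v => by
    rw [← commutatorElement_eq_one_iff_commute, ← map_commutatorElement]
    refine (QuotientGroup.eq_one_iff _).2 (mem_center_of_forall_gen fun w => ?_)
    rw [← commutatorElement_eq_one_iff_commute]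
    exact gen_commutator u v w
  have h1 : ∀ u y, Commute (π (gen p Γ u)) (π y) := fun u y => by
    have hy : y ∈ Subgroup.closure (Set.range (gen p Γ)) := closure_gen ▸ Subgroup.mem_top y
    induction hy using Subgroup.closure_induction with
    | mem _ h => obtain ⟨v, rfl⟩ := h; exact hgen u v
    | one => rw [map_one]; exact Commute.one_right _
    | mul a b _ _ ha hb => rw [map_mul]; exact ha.mul_right hb
    | inv a _ ha => rw [map_inv]; exact ha.inv_right
  have h2 : Commute (π x) (π y) := by
    have hx : x ∈ Subgroup.closure (Set.range (gen p Γ)) := closure_gen ▸ Subgroup.mem_top x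
    induction hx using Subgroup.closure_induction with
    | mem _ h => obtain ⟨v, rfl⟩ := h; exact h1 v y
    | one => rw [map_one]; exact Commute.one_left _
    | mul a b _ _ ha hb => rw [map_mul]; exact ha.mul_left hb
    | inv a _ ha => rw [map_inv]; exact ha.inv_left
  rw [← commutatorElement_eq_one_iff_commute, ← map_commutatorElement] at h2
  exact (QuotientGroup.eq_one_iff _).1 h2

/-- Evaluation in the model. -/
noncomputable def toModel (p : ℕ) (Γ : SimpleGraph V) : MeklerGroup p Γ →* MeklerModel p Γ :=
  lift (MeklerModel.gen p Γ)
    (fun v => by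
      rw [MeklerModel.gen_pow]
      exact MeklerModel.ext (by simp) rfl)
    (fun u v w => by
      rw [commutatorElement_eq_one_iff_commute, MeklerModel.commute_iff]
      have h : (⁅MeklerModel.gen p Γ u, MeklerModel.gen p Γ v⁆).vec = 0 := by
        have : MeklerModel.vecHom p Γ ⁅MeklerModel.gen p Γ u, MeklerModel.gen p Γ v⁆ = 1 := by
          rw [map_commutatorElement, commutatorElement_eq_one_iff_commute]
          exact Commute.all _ _
        exact this
      simp [h])
    (fun u v h => by
      classical
      rw [MeklerModel.commute_iff]
      intro a b hab hadj
      simp only [MeklerModel.gen]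
      by_cases h1 : a = u <;> by_cases h2 : b = v <;> by_cases h3 : a = v <;>
        by_cases h4 : b = u <;> simp_all [SimpleGraph.adj_comm])

/-- The exponent vector of an element. -/
noncomputable def vec (x : MeklerGroup p Γ) : V → ZMod p := (toModel p Γ x).vec

theorem vec_mul (x y : MeklerGroup p Γ) : vec (x * y) = vec x + vec y := by simp [vec]

theorem vec_one : vec (1 : MeklerGroup p Γ) = 0 := by simp [vec]

theorem vec_inv (x : MeklerGroup p Γ) : vec x⁻¹ = -vec x := by
  rw [eq_neg_iff_add_eq_zero, ← vec_mul, inv_mul_cancel, vec_one]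

theorem vec_pow (x : MeklerGroup p Γ) (n : ℕ) : vec (x ^ n) = n • vec x := by
  induction n with
  | zero => simp [vec_one]
  | succ n ih => rw [pow_succ, vec_mul, ih, succ_nsmul]

open Classical in
theorem vec_gen (v : V) : vec (gen p Γ v) = Pi.single v 1 := by
  unfold vec toModel
  rw [lift_gen]
  rfl

theorem mul_vec_eq_of_commute {x y : MeklerGroup p Γ} (h : Commute x y) {u v : V} (huv : u ≠ v)
    (hadj : ¬ Γ.Adj u v) : vec x u * vec y v = vec y u * vec x v :=
  (MeklerModel.commute_iff _ _).1 (h.map (toModel p Γ)) u v huv hadj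

/-- Both sides are multiplicative in `x` and agree on the generators; representatives of residues
may be used as exponents since `p`-th powers of generators vanish. It follows that the kernel of
`vec` lies in the commutator subgroup. -/
theorem exists_abelianization_eq [Fintype V] [Fact p.Prime] (x : MeklerGroup p Γ) :
    Abelianization.of x = ∏ v, Abelianization.of (gen p Γ v) ^ (vec x v).val := by
  have hx : x ∈ Subgroup.closure (Set.range (gen p Γ)) := closure_gen ▸ Subgroup.mem_top x
  have hpow : ∀ v, Abelianization.of (gen p Γ v) ^ p = 1 := fun v => by
    rw [← map_pow, gen_pow, map_one]
  have hadd : ∀ v (a b : ZMod p), Abelianization.of (gen p Γ v) ^ (a + b).val =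
      Abelianization.of (gen p Γ v) ^ a.val * Abelianization.of (gen p Γ v) ^ b.val := by
    intro v a b
    rw [ZMod.val_add, ← pow_add, ← pow_eq_pow_mod _ (hpow v)]
  classical
  induction hx using Subgroup.closure_induction with
  | mem _ h =>
    obtain ⟨v, rfl⟩ := h
    rw [vec_gen, Finset.prod_eq_single v]
    · rw [Pi.single_eq_same, ZMod.val_one, pow_one]
    · intro w _ hw
      simp [Pi.single_eq_of_ne hw]
    · simp
  | one => simp [vec_one]
  | mul a b _ _ ha hb =>
    rw [map_mul, ha, hb, ← Finset.prod_mul_distrib, vec_mul]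
    exact Finset.prod_congr rfl fun v _ => (hadd v _ _).symm
  | inv a _ ha =>
    rw [map_inv, ha, inv_eq_iff_mul_eq_one, ← Finset.prod_mul_distrib]
    refine Finset.prod_eq_one fun v _ => ?_
    rw [← hadd, ← Pi.add_apply, ← vec_mul, mul_inv_cancel, vec_one]
    simp

theorem mem_commutator_of_vec_eq_zero [Fintype V] [Fact p.Prime] {x : MeklerGroup p Γ}
    (h : vec x = 0) : x ∈ commutator (MeklerGroup p Γ) := by
  have := exists_abelianization_eq x
  rw [h] at this
  rw [← Abelianization.ker_of, MonoidHom.mem_ker, this]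
  simp

theorem mem_center_of_vec_eq_zero [Fintype V] [Fact p.Prime] {x : MeklerGroup p Γ}
    (h : vec x = 0) : x ∈ Subgroup.center (MeklerGroup p Γ) := by
  have h1 := mem_commutator_of_vec_eq_zero h
  have h2 : commutator (MeklerGroup p Γ) ≤ Subgroup.center (MeklerGroup p Γ) := by
    rw [commutator_def, Subgroup.commutator_le]
    intro a _ b _
    exact commutator_mem_center a b
  exact h2 h1

open Classical in
theorem vec_gen_self (v : V) : vec (gen p Γ v) v = 1 := by simp [vec_gen]

open Classical in
theorem vec_gen_of_ne {v w : V} (h : w ≠ v) : vec (gen p Γ v) w = 0 := by simp [vec_gen, h]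

/-- Elements with the same exponent vector differ by a central factor, which cancels in commutators.
So there are only finitely many commutators. -/
theorem commutator_congr [Fintype V] [Fact p.Prime] {x x' y y' : MeklerGroup p Γ}
    (hx : vec x = vec x') (hy : vec y = vec y') : ⁅x, y⁆ = ⁅x', y'⁆ := by
  have key : ∀ a b : MeklerGroup p Γ, vec a = vec b →
      ∃ z ∈ Subgroup.center (MeklerGroup p Γ), a = b * z := fun a b h =>
    ⟨b⁻¹ * a, mem_center_of_vec_eq_zero (by rw [vec_mul, vec_inv, h, neg_add_cancel]), by simp⟩
  obtain ⟨z, hz, rfl⟩ := key _ _ hx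
  obtain ⟨w, hw, rfl⟩ := key _ _ hy
  have hz' := fun g => Subgroup.mem_center_iff.1 hz g
  have hw' := fun g => Subgroup.mem_center_iff.1 hw g
  rw [commutatorElement_def, commutatorElement_def]
  calc x' * z * (y' * w) * (x' * z)⁻¹ * (y' * w)⁻¹
      = x' * (z * y') * w * z⁻¹ * x'⁻¹ * w⁻¹ * y'⁻¹ := by group
    _ = x' * y' * (z * w) * z⁻¹ * x'⁻¹ * w⁻¹ * y'⁻¹ := by rw [← hz' y']; group
    _ = x' * y' * (w * x'⁻¹) * w⁻¹ * y'⁻¹ := by rw [hw' z]; group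
    _ = x' * y' * x'⁻¹ * y'⁻¹ := by rw [← hw' x'⁻¹]; group

instance : CommGroup (Subgroup.center (MeklerGroup p Γ)) :=
  { (Subgroup.center (MeklerGroup p Γ)).toGroup with
    mul_comm := fun a b => Subtype.ext (Subgroup.mem_center_iff.1 b.2 a) }

/-- The homomorphism `x ↦ ⁅x, y⁆` to the center. -/
def commutatorHom (y : MeklerGroup p Γ) :
    MeklerGroup p Γ →* Subgroup.center (MeklerGroup p Γ) where
  toFun x := ⟨⁅x, y⁆, commutator_mem_center x y⟩
  map_one' := Subtype.ext (commutatorElement_one_left y)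
  map_mul' a b := Subtype.ext <| by
    have := Subgroup.mem_center_iff.1 (commutator_mem_center b y) a
    change ⁅a * b, y⁆ = ⁅a, y⁆ * ⁅b, y⁆
    calc ⁅a * b, y⁆ = a * ⁅b, y⁆ * y * a⁻¹ * y⁻¹ := by simp only [commutatorElement_def]; group
      _ = ⁅b, y⁆ * a * y * a⁻¹ * y⁻¹ := by rw [this]
      _ = ⁅b, y⁆ * ⁅a, y⁆ := by rw [commutatorElement_def a]; group
      _ = _ := (Subgroup.mem_center_iff.1 (commutator_mem_center b y) _).symm

theorem commutatorHom_inv (x y : MeklerGroup p Γ) :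
    (commutatorHom x y)⁻¹ = commutatorHom y x :=
  Subtype.ext (commutatorElement_inv y x)

theorem commutatorHom_eq_one_iff {x y : MeklerGroup p Γ} :
    commutatorHom y x = 1 ↔ Commute x y := by
  rw [← commutatorElement_eq_one_iff_commute, Subtype.ext_iff]; rfl

theorem hom_eq_prod [Fintype V] [Fact p.Prime] {A : Type*} [CommGroup A]
    (ψ : MeklerGroup p Γ →* A) (x : MeklerGroup p Γ) :
    ψ x = ∏ v, ψ (gen p Γ v) ^ (vec x v).val := by
  have := congrArg (Abelianization.lift ψ) (exists_abelianization_eq x)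
  simpa using this

/-- The model gives one direction. For the other, expand the commutator of `x` and `y` bilinearly
over pairs of generators: equal or adjacent pairs contribute nothing, and the contributions of `(u,
v)` and `(v, u)` cancel when the minor at `u`, `v` vanishes. -/
theorem commute_iff [Fintype V] [Fact p.Prime] {x y : MeklerGroup p Γ} : Commute x y ↔
    ∀ u v, u ≠ v → ¬ Γ.Adj u v → vec x u * vec y v = vec y u * vec x v := by
  refine ⟨fun h u v => mul_vec_eq_of_commute h, fun h => ?_⟩
  let c : V → V → Subgroup.center (MeklerGroup p Γ) :=
    fun u v => commutatorHom (gen p Γ u) (gen p Γ v)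
  have hcp : ∀ u v, c u v ^ p = 1 := fun u v => by
    rw [← map_pow, gen_pow, map_one]
  have hc1 : ∀ u v, (u = v ∨ Γ.Adj u v) → c u v = 1 := by
    rintro u v (rfl | hadj)
    · exact commutatorHom_eq_one_iff.2 (.refl _)
    · exact commutatorHom_eq_one_iff.2 (gen_commute hadj).symm
  have hcs : ∀ u v, (c u v)⁻¹ = c v u := fun u v => commutatorHom_inv _ _
  rw [← commutatorHom_eq_one_iff]
  refine (hom_eq_prod (A := Subgroup.center (MeklerGroup p Γ)) (commutatorHom y) x).trans ?_
  have h1 : ∀ u, commutatorHom y (gen p Γ u) = ∏ v, c v u ^ (vec y v).val := fun u => by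
    rw [← commutatorHom_inv]
    refine (congrArg _ (hom_eq_prod (A := Subgroup.center (MeklerGroup p Γ))
      (commutatorHom (gen p Γ u)) y)).trans ?_
    rw [← Finset.prod_inv_distrib]
    exact Finset.prod_congr rfl fun v _ => by rw [← inv_pow]; exact congrArg (· ^ _) (hcs u v)
  simp_rw [h1, ← Finset.prod_pow, ← pow_mul]
  rw [← Finset.prod_product']
  refine Finset.prod_involution (fun a _ => (a.2, a.1)) ?_ ?_ ?_ ?_
  · rintro ⟨u, v⟩ _
    change c v u ^ _ * c u v ^ _ = 1
    by_cases huv : u = v ∨ Γ.Adj u v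
    · rw [hc1 u v huv, hc1 v u (huv.imp Eq.symm SimpleGraph.Adj.symm), one_pow, one_pow, one_mul]
    · push Not at huv
      have h2 : ((vec y v).val * (vec x u).val) % p = ((vec y u).val * (vec x v).val) % p := by
        rw [← ZMod.natCast_eq_natCast_iff']
        push_cast
        simp only [ZMod.natCast_zmod_val]
        linear_combination h u v huv.1 huv.2
      rw [← hcs u v, pow_eq_pow_mod _ (hcp u v), ← h2,
        pow_eq_pow_mod (_ * _) (by rw [inv_pow, hcp, inv_one] : ((c u v)⁻¹) ^ p = 1),
        inv_pow, inv_mul_cancel]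
  · rintro ⟨u, v⟩ _ hne heq
    have : v = u := congrArg Prod.fst heq
    subst this
    exact hne (by change c v v ^ _ = 1; rw [hc1 v v (Or.inl rfl), one_pow])
  · intro a _; exact Finset.mem_univ _
  · intro a _; rfl

/-- Finitely many commutators generate a finite commutator subgroup (Schur), and an element is
determined by its exponent vector and its quotient by a fixed element with that vector. -/
instance [Fintype V] [Fact p.Prime] : Finite (MeklerGroup p Γ) := by
  have h1 : Finite (commutatorSet (MeklerGroup p Γ)) := by
    have hf : (Set.range fun a : (V → ZMod p) × (V → ZMod p) =>
        ⁅Function.invFun (vec (Γ := Γ)) a.1, Function.invFun (vec (Γ := Γ)) a.2⁆).Finite :=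
      Set.finite_range _
    refine (hf.subset ?_).to_subtype
    rintro _ ⟨x, y, rfl⟩
    exact ⟨(vec x, vec y), commutator_congr (Function.invFun_eq ⟨x, rfl⟩)
      (Function.invFun_eq ⟨y, rfl⟩)⟩
  have h2 : Finite (commutator (MeklerGroup p Γ)) := inferInstance
  let F : MeklerGroup p Γ → (V → ZMod p) × commutator (MeklerGroup p Γ) := fun x =>
    (vec x, ⟨(Function.invFun (vec (Γ := Γ)) (vec x))⁻¹ * x, mem_commutator_of_vec_eq_zero (by
      rw [vec_mul, vec_inv, Function.invFun_eq (f := vec (Γ := Γ)) ⟨x, rfl⟩, neg_add_cancel])⟩)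
  refine Finite.of_injective F fun x y h => ?_
  have ha : vec x = vec y := congrArg Prod.fst h
  have hb := congrArg Subtype.val (congrArg Prod.snd h)
  simp only [F, ha] at hb
  exact mul_left_cancel hb

end MeklerGroup

/-! ### Singular elements -/

/-- An element is singular if it is not central and its centralizer is not abelian. -/
def IsSingular {K : Type*} [Group K] (x : K) : Prop :=
  (∃ y, ¬ Commute x y) ∧ ∃ y, Commute x y ∧ ∃ z, Commute x z ∧ ¬ Commute y z

/-- Two elements have the same centralizer. -/
def SameCentralizer {K : Type*} [Group K] (x y : K) : Prop := ∀ z, Commute x z ↔ Commute y z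

theorem SameCentralizer.refl {K : Type*} [Group K] (x : K) : SameCentralizer x x :=
  fun _ => Iff.rfl

theorem SameCentralizer.symm {K : Type*} [Group K] {x y : K} (h : SameCentralizer x y) :
    SameCentralizer y x := fun z => (h z).symm

theorem SameCentralizer.trans {K : Type*} [Group K] {x y z : K} (h : SameCentralizer x y)
    (h' : SameCentralizer y z) : SameCentralizer x z := fun w => (h w).trans (h' w)

/-- The map `q` identifies the classes of singular elements with the vertices of `Δ`, such that
adjacency is commutation. -/
structure IsReading {K W : Type*} [Group K] (Δ : SimpleGraph W)
    (q : {x : K // IsSingular x} → W) : Prop where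
  surjective : Function.Surjective q
  eq_iff : ∀ x y, q x = q y ↔ SameCentralizer (x : K) y
  adj_iff : ∀ x y, Δ.Adj (q x) (q y) ↔ Commute (x : K) y ∧ ¬ SameCentralizer (x : K) y

theorem IsReading.comp_iso {K W W' : Type*} [Group K] {Δ : SimpleGraph W} {Δ' : SimpleGraph W'}
    {q : {x : K // IsSingular x} → W} (hq : IsReading Δ q) (e : Δ ≃g Δ') :
    IsReading Δ' (e ∘ q) where
  surjective := e.surjective.comp hq.surjective
  eq_iff x y := e.injective.eq_iff.trans (hq.eq_iff x y)
  adj_iff x y := e.map_rel_iff.trans (hq.adj_iff x y)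

/-- The setoid of singular elements with the same centralizer. -/
def singularSetoid (K : Type*) [Group K] : Setoid {x : K // IsSingular x} where
  r x y := SameCentralizer (x : K) y
  iseqv := ⟨fun _ => .refl _, fun h => h.symm, fun h h' => h.trans h'⟩

theorem sameCentralizer_commute_iff {K : Type*} [Group K] {x x' y y' : K}
    (hx : SameCentralizer x x') (hy : SameCentralizer y y') : Commute x y ↔ Commute x' y' := by
  rw [hx y, Commute.symm_iff, hy x', Commute.symm_iff]

/-- The commutation graph on the classes of singular elements. -/
def singularGraph (K : Type*) [Group K] : SimpleGraph (Quotient (singularSetoid K)) where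
  Adj := Quotient.lift₂ (fun x y => Commute (x : K) y ∧ ¬ SameCentralizer (x : K) y)
    fun _ _ _ _ hx hy => propext (and_congr (sameCentralizer_commute_iff hx hy)
      (not_congr ⟨fun h => hx.symm.trans (h.trans hy), fun h => hx.trans (h.trans hy.symm)⟩))
  symm := ⟨by
    rintro ⟨x⟩ ⟨y⟩ ⟨h1, h2⟩
    exact ⟨h1.symm, fun h => h2 h.symm⟩⟩
  loopless := ⟨by
    rintro ⟨x⟩ ⟨_, h⟩
    exact h (.refl _)⟩

theorem isReading_singularGraph (K : Type*) [Group K] :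
    IsReading (singularGraph K) (Quotient.mk (singularSetoid K)) where
  surjective := Quotient.mk_surjective
  eq_iff _ _ := Quotient.eq
  adj_iff _ _ := Iff.rfl

/-- The elements that are products of at most `m` singular elements modulo the center. -/
def WeightLE {K : Type*} [Group K] : ℕ → K → Prop
  | 0, x => ∀ y, Commute x y
  | m + 1, x => WeightLE m x ∨ ∃ d, IsSingular d ∧ WeightLE m (x * d)

/-- The class of the singular element `u` occurs in every shortest expression of `x`. -/
def InSupport {K : Type*} [Group K] (x u : K) : Prop :=
  ∃ m, ¬ WeightLE m x ∧ ∃ d, (IsSingular d ∧ SameCentralizer u d) ∧ WeightLE m (x * d)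

theorem InSupport.congr {K : Type*} [Group K] {x u u' : K} (h : SameCentralizer u u') :
    InSupport x u ↔ InSupport x u' :=
  exists_congr fun _ => and_congr_right fun _ => exists_congr fun _ =>
    and_congr_left fun _ => and_congr_right fun _ =>
      ⟨fun h' => h.symm.trans h', fun h' => h.trans h'⟩

/-- The products of `m` commutators. -/
def IsCommutatorProd {K : Type*} [Group K] : ℕ → K → Prop
  | 0, x => x = 1
  | m + 1, x => ∃ c : K, (∃ a b : K, c = ⁅a, b⁆) ∧ IsCommutatorProd m (x * c)

/-- Inverses of commutators are commutators, so products suffice. This splits membership into the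
predicates `IsCommutatorProd m`, each of which is visible to the refinement. -/
theorem mem_commutator_iff_exists_isCommutatorProd {K : Type*} [Group K] (x : K) :
    x ∈ commutator K ↔ ∃ m, IsCommutatorProd m x := by
  constructor
  · intro hx
    rw [commutator_eq_closure] at hx
    induction hx using Subgroup.closure_induction_right with
    | one => exact ⟨0, rfl⟩
    | mul_right y _ c hc ih =>
      obtain ⟨m, hm⟩ := ih
      obtain ⟨a, b, rfl⟩ := hc
      exact ⟨m + 1, ⁅b, a⁆, ⟨b, a, rfl⟩, by
        rwa [mul_assoc, ← commutatorElement_inv a b, mul_inv_cancel, mul_one]⟩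
    | mul_inv_cancel y _ c hc ih =>
      obtain ⟨m, hm⟩ := ih
      obtain ⟨a, b, rfl⟩ := hc
      exact ⟨m + 1, ⁅a, b⁆, ⟨a, b, rfl⟩, by rwa [mul_assoc, inv_mul_cancel, mul_one]⟩
  · rintro ⟨m, hm⟩
    induction m generalizing x with
    | zero => exact hm ▸ one_mem _
    | succ m ih =>
      obtain ⟨c, ⟨a, b, rfl⟩, h⟩ := hm
      have h1 : ⁅a, b⁆ ∈ commutator K :=
        Subgroup.commutator_mem_commutator (Subgroup.mem_top a) (Subgroup.mem_top b)
      exact (Subgroup.mul_mem_cancel_right _ h1).1 (ih _ h)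

/-- Graphs without triangles and `4`-cycles in which every vertex has at least two neighbours. -/
structure IsSparse {V : Type*} (Γ : SimpleGraph V) : Prop where
  eq_of_adj : ∀ {u v z z'}, u ≠ v → Γ.Adj u z → Γ.Adj v z → Γ.Adj u z' → Γ.Adj v z' → z = z'
  not_adj : ∀ {u v w}, Γ.Adj u v → Γ.Adj v w → ¬ Γ.Adj u w
  exists_two : ∀ v, ∃ w w', w ≠ w' ∧ Γ.Adj v w ∧ Γ.Adj v w'

/-- Two steps along edges, not returning to `u`, end at a nonneighbour since there are no triangles.
The generator there detects the exponent at `u`, so central elements have zero exponent vector. -/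
theorem IsSparse.exists_not_adj {V : Type*} {Γ : SimpleGraph V} (h : IsSparse Γ) (u : V) :
    ∃ v, u ≠ v ∧ ¬ Γ.Adj u v := by
  obtain ⟨w, _, _, hw, _⟩ := h.exists_two u
  obtain ⟨a, b, hab, ha, hb⟩ := h.exists_two w
  by_cases hau : u = a
  · exact ⟨b, fun hub => hab (hau.symm.trans hub), h.not_adj hw hb⟩
  · exact ⟨a, hau, h.not_adj hw ha⟩

/-! ### Supports, singular elements and weights in Mekler groups. -/

namespace MeklerGroup

variable {V : Type u} {p : ℕ} {Γ : SimpleGraph V}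

/-- The exponent vector of `x` is supported at exactly the vertex `v`. -/
def SupportedAt (x : MeklerGroup p Γ) (v : V) : Prop := vec x v ≠ 0 ∧ ∀ u, u ≠ v → vec x u = 0

theorem SupportedAt.eq {x : MeklerGroup p Γ} {u v : V} (hu : SupportedAt x u)
    (hv : SupportedAt x v) : u = v := by
  by_contra h
  exact hu.1 (hv.2 u h)

theorem supportedAt_gen [Fact p.Prime] (v : V) : SupportedAt (gen p Γ v) v :=
  ⟨by rw [vec_gen_self]; exact one_ne_zero, fun _ h => vec_gen_of_ne h⟩

theorem commute_gen_iff [Fact p.Prime] {u v : V} :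
    Commute (gen p Γ u) (gen p Γ v) ↔ u = v ∨ Γ.Adj u v := by
  constructor
  · intro h
    by_contra! hc
    have := mul_vec_eq_of_commute h hc.1 hc.2
    rw [vec_gen_self, vec_gen_self, vec_gen_of_ne hc.1] at this
    simp at this
  · rintro (rfl | h)
    · exact .refl _
    · exact gen_commute h

variable [Fact p.Prime]

theorem vec_gen_pow_val (v : V) (c : ZMod p) :
    vec (gen p Γ v ^ c.val) v = c ∧ ∀ u, u ≠ v → vec (gen p Γ v ^ c.val) u = 0 := by
  rw [vec_pow]
  refine ⟨?_, fun u hu => ?_⟩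
  · rw [Pi.smul_apply, vec_gen_self, nsmul_one, ZMod.natCast_zmod_val]
  · rw [Pi.smul_apply, vec_gen_of_ne hu, smul_zero]

theorem SupportedAt.exists_eq [Fintype V] {x : MeklerGroup p Γ} {v : V} (h : SupportedAt x v) :
    ∃ z ∈ Subgroup.center (MeklerGroup p Γ), x = gen p Γ v ^ (vec x v).val * z := by
  refine ⟨(gen p Γ v ^ (vec x v).val)⁻¹ * x, mem_center_of_vec_eq_zero (funext fun u => ?_),
    by simp⟩
  obtain ⟨h1, h2⟩ := vec_gen_pow_val (Γ := Γ) v (vec x v)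
  rw [vec_mul, vec_inv, Pi.add_apply, Pi.neg_apply, Pi.zero_apply]
  by_cases hu : u = v
  · subst hu; rw [h1, neg_add_cancel]
  · rw [h2 u hu, h.2 u hu]; simp

/-- Up to a central factor `x` is a power of the generator with exponent invertible modulo `p`, and
the generator is recovered by raising to the inverse exponent. -/
theorem SupportedAt.sameCentralizer_gen [Fintype V] {x : MeklerGroup p Γ} {v : V} (h : SupportedAt x v) :
    SameCentralizer x (gen p Γ v) := by
  obtain ⟨z, hz, hx⟩ := h.exists_eq
  have hzc : ∀ y, Commute z y := fun y => (Subgroup.mem_center_iff.1 hz y).symm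
  intro y
  have h1 : Commute x y ↔ Commute (gen p Γ v ^ (vec x v).val) y := by
    constructor
    · intro h
      have h2 := h.mul_left (hzc y).inv_left
      have h3 : x * z⁻¹ = gen p Γ v ^ (vec x v).val := mul_inv_eq_of_eq_mul hx
      rwa [h3] at h2
    · intro h
      have h2 := h.mul_left (hzc y)
      rwa [← hx] at h2
  rw [h1]
  refine ⟨fun h' => ?_, fun h' => h'.pow_left _⟩
  have h2 := h'.pow_left ((vec x v)⁻¹).val
  rw [← pow_mul] at h2
  have h3 : ((vec x v).val * ((vec x v)⁻¹).val) % p = 1 % p := by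
    rw [← ZMod.natCast_eq_natCast_iff']
    push_cast
    rw [ZMod.natCast_zmod_val, ZMod.natCast_zmod_val, mul_inv_cancel₀ h.1]
  rwa [pow_eq_pow_mod _ (gen_pow v), h3, ← pow_eq_pow_mod _ (gen_pow v), pow_one] at h2

theorem SupportedAt.sameCentralizer [Fintype V] {x y : MeklerGroup p Γ} {v : V} (hx : SupportedAt x v)
    (hy : SupportedAt y v) : SameCentralizer x y :=
  hx.sameCentralizer_gen.trans hy.sameCentralizer_gen.symm

theorem vec_eq_zero_of_central (hΓ : IsSparse Γ) {x : MeklerGroup p Γ}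
    (h : ∀ y, Commute x y) : vec x = 0 := by
  funext u
  obtain ⟨v, huv, hadj⟩ := hΓ.exists_not_adj u
  have := mul_vec_eq_of_commute (h (gen p Γ v)) huv hadj
  rwa [vec_gen_self, vec_gen_of_ne huv, mul_one, zero_mul] at this

theorem central_iff [Fintype V] (hΓ : IsSparse Γ) {x : MeklerGroup p Γ} :
    (∀ y, Commute x y) ↔ vec x = 0 :=
  ⟨vec_eq_zero_of_central hΓ, fun h y =>
    (Subgroup.mem_center_iff.1 (mem_center_of_vec_eq_zero h) y).symm⟩

theorem isSingular_gen (hΓ : IsSparse Γ) (v : V) : IsSingular (gen p Γ v) := by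
  obtain ⟨w, w', hww, hw, hw'⟩ := hΓ.exists_two v
  obtain ⟨u, hu, hadj⟩ := hΓ.exists_not_adj v
  refine ⟨⟨gen p Γ u, ?_⟩, gen p Γ w, gen_commute hw, gen p Γ w', gen_commute hw', ?_⟩
  · rw [commute_gen_iff]; tauto
  · rw [commute_gen_iff]
    rintro (h | h)
    · exact hww h
    · exact hΓ.not_adj hw h hw'

theorem _root_.SameCentralizer.isSingular {K : Type*} [Group K] {x y : K}
    (h : SameCentralizer x y) (hx : IsSingular x) : IsSingular y := by
  obtain ⟨⟨a, ha⟩, b, hb, c, hc, hbc⟩ := hx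
  exact ⟨⟨a, fun h' => ha ((h a).2 h')⟩, b, (h b).1 hb, c, (h c).1 hc, hbc⟩

/-- Let `y`, `z` commute with `x` but not with each other, with nonzero minor at nonadjacent `r`,
`s`. At `r`, `s` the vector of `x` is proportional to both, so it vanishes there. A vertex in the
support of `x` that is not adjacent to `r` would force `y` and `z` to vanish at `r`; likewise for
`s`. Hence the support consists of common neighbours of `r` and `s`, of which there is at most one.
-/
theorem isSingular_iff [Fintype V] (hΓ : IsSparse Γ) {x : MeklerGroup p Γ} :
    IsSingular x ↔ ∃ v, SupportedAt x v := by
  constructor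
  · rintro ⟨⟨a, ha⟩, y, hy, z, hz, hyz⟩
    have hx : vec x ≠ 0 := fun h => ha ((central_iff hΓ).2 h a)
    obtain ⟨t, ht⟩ := Function.ne_iff.1 hx
    refine ⟨t, ht, ?_⟩
    rw [commute_iff] at hyz
    push Not at hyz
    obtain ⟨r, s, hrs, hadj, hne⟩ := hyz
    have h1 := mul_vec_eq_of_commute hy hrs hadj
    have h2 := mul_vec_eq_of_commute hz hrs hadj
    have hr : vec x r = 0 := by
      by_contra hr
      exact hne (mul_left_cancel₀ hr (by linear_combination vec y r * h2 - vec z r * h1))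
    have hs : vec x s = 0 := by
      by_contra hs
      exact hne (mul_left_cancel₀ hs (by linear_combination vec y s * h2 - vec z s * h1))
    have adj_of_ne : ∀ u, vec x u ≠ 0 → Γ.Adj r u ∧ Γ.Adj s u := by
      intro t ht
      have key : ∀ w : MeklerGroup p Γ, Commute x w → ∀ u, ¬ Γ.Adj u t →
          vec x u = 0 → vec w u = 0 := fun w hw u hadj h0 => by
        have := mul_vec_eq_of_commute hw (fun h => ht (by rw [← h, h0])) hadj
        rw [h0, zero_mul] at this
        exact (mul_eq_zero.1 this.symm).resolve_right ht
      constructor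
      · by_contra h
        exact hne (by rw [key y hy r h hr, key z hz r h hr, zero_mul, zero_mul])
      · by_contra h
        exact hne (by rw [key y hy s h hs, key z hz s h hs, mul_zero, mul_zero])
    intro u hu
    by_contra h
    exact hu (hΓ.eq_of_adj hrs (adj_of_ne u h).1 (adj_of_ne u h).2 (adj_of_ne t ht).1
      (adj_of_ne t ht).2)
  · rintro ⟨v, hv⟩
    exact hv.sameCentralizer_gen.symm.isSingular (isSingular_gen hΓ v)

theorem exists_isReading [Fintype V] (hΓ : IsSparse Γ) :
    ∃ q : {x : MeklerGroup p Γ // IsSingular x} → V, IsReading Γ q ∧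
      ∀ x : {x : MeklerGroup p Γ // IsSingular x}, SupportedAt x.1 (q x) := by
  choose q hq using fun x : {x : MeklerGroup p Γ // IsSingular x} => (isSingular_iff hΓ).1 x.2
  have hadj : ∀ x y : {x : MeklerGroup p Γ // IsSingular x}, Commute x.1 y.1 ↔ q x = q y ∨ Γ.Adj (q x) (q y) :=
    fun x y => by
      rw [← commute_gen_iff (p := p), sameCentralizer_commute_iff (hq x).sameCentralizer_gen
        (hq y).sameCentralizer_gen]
  have heq : ∀ x y : {x : MeklerGroup p Γ // IsSingular x},
      q x = q y ↔ SameCentralizer x.1 y.1 := by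
    intro x y
    refine ⟨fun h => (hq x).sameCentralizer (h ▸ hq y), fun h => ?_⟩
    have h1 := (hq x).sameCentralizer_gen.symm.trans (h.trans (hq y).sameCentralizer_gen)
    by_contra hne
    have h2 : ∀ w, q x = w ∨ Γ.Adj (q x) w ↔ q y = w ∨ Γ.Adj (q y) w := fun w => by
      rw [← commute_gen_iff (p := p), ← commute_gen_iff (p := p)]
      exact h1 _
    -- Two different vertices with the same closed neighbourhood are adjacent, and any further
    -- neighbour would complete a triangle; but `q x` has a second neighbour.
    have hxy : Γ.Adj (q x) (q y) := ((h2 (q y)).2 (Or.inl rfl)).resolve_left hne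
    obtain ⟨a, b, hab, ha, hb⟩ := hΓ.exists_two (q x)
    have h3 : ∀ c, Γ.Adj (q x) c → q y = c := fun c hc =>
      ((h2 c).1 (Or.inr hc)).resolve_right fun h => hΓ.not_adj hxy h hc
    exact hab ((h3 a ha).symm.trans (h3 b hb))
  refine ⟨q, ⟨fun v => ⟨⟨gen p Γ v, isSingular_gen hΓ v⟩, ?_⟩, heq, fun x y => ?_⟩, hq⟩
  · exact (hq _).eq (supportedAt_gen v)
  · rw [hadj, ← heq]
    refine ⟨fun h => ⟨Or.inr h, h.ne⟩, fun h => h.1.resolve_left h.2⟩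

/-- Move the exponent at `v` to `w`. -/
noncomputable def moveSupport (v w : V) (x : MeklerGroup p Γ) : MeklerGroup p Γ :=
  x * (gen p Γ v ^ (vec x v).val)⁻¹ * gen p Γ w ^ (vec x v).val

theorem vec_moveSupport {v w : V} {x : MeklerGroup p Γ} (hx : SupportedAt x v) :
    vec (moveSupport v w x) w = vec x v ∧ ∀ u, u ≠ w → vec (moveSupport v w x) u = 0 := by
  have h1 : ∀ u, vec (moveSupport v w x) u = vec (gen p Γ w ^ (vec x v).val) u := fun u => by
    obtain ⟨h1, h2⟩ := vec_gen_pow_val (Γ := Γ) v (vec x v)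
    rw [moveSupport, vec_mul, vec_mul, vec_inv, Pi.add_apply, Pi.add_apply, Pi.neg_apply]
    by_cases hu : u = v
    · subst hu; rw [h1]; ring
    · rw [h2 u hu, hx.2 u hu]; ring
  obtain ⟨h2, h3⟩ := vec_gen_pow_val (Γ := Γ) w (vec x v)
  exact ⟨by rw [h1, h2], fun u hu => by rw [h1, h3 u hu]⟩

theorem moveSupport_moveSupport {v w : V} {x : MeklerGroup p Γ} (hx : SupportedAt x v) :
    moveSupport w v (moveSupport v w x) = x := by
  rw [moveSupport, (vec_moveSupport hx).1, moveSupport]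
  group

/-- Equal class sizes are what allows multisets of colours over singular elements to be compared
with multisets over vertices. -/
theorem card_supportedAt (v w : V) :
    Nat.card {x : MeklerGroup p Γ // SupportedAt x v} =
      Nat.card {x : MeklerGroup p Γ // SupportedAt x w} := by
  have h : ∀ {v w : V} {x : MeklerGroup p Γ}, SupportedAt x v →
      SupportedAt (moveSupport v w x) w := fun hx =>
    ⟨by rw [(vec_moveSupport hx).1]; exact hx.1, (vec_moveSupport hx).2⟩
  exact Nat.card_congr
    { toFun := fun x => ⟨_, h x.2⟩
      invFun := fun x => ⟨_, h x.2⟩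
      left_inv := fun x => Subtype.ext (moveSupport_moveSupport x.2)
      right_inv := fun x => Subtype.ext (moveSupport_moveSupport x.2) }

/-- A singular factor changes a single exponent, and a suitable power of the generator at `v` erases
the exponent at `v`. So the weight is the size of the support. -/
theorem weightLE_iff [Fintype V] (hΓ : IsSparse Γ) {m : ℕ} {x : MeklerGroup p Γ} :
    WeightLE m x ↔ {v | vec x v ≠ 0}.ncard ≤ m := by
  induction m generalizing x with
  | zero =>
    rw [Nat.le_zero, Set.ncard_eq_zero, WeightLE, central_iff hΓ, Set.eq_empty_iff_forall_notMem]
    exact ⟨fun h v hv => hv (congrFun h v), fun h => funext fun v => not_not.1 (h v)⟩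
  | succ m ih =>
    rw [WeightLE, ih]
    constructor
    · rintro (h | ⟨d, hd, h⟩)
      · exact h.trans m.le_succ
      · obtain ⟨v, hv⟩ := (isSingular_iff hΓ).1 hd
        rw [ih] at h
        have hsub : {u | vec x u ≠ 0} ⊆ insert v {u | vec (x * d) u ≠ 0} := by
          intro u hu
          by_cases huv : u = v
          · exact Or.inl huv
          · right
            change vec (x * d) u ≠ 0
            rwa [vec_mul, Pi.add_apply, hv.2 u huv, add_zero]
        exact (Set.ncard_le_ncard hsub).trans ((Set.ncard_insert_le _ _).trans (by omega))
    · intro h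
      by_cases hz : {v | vec x v ≠ 0} = ∅
      · left; rw [hz]; simp
      · obtain ⟨v, hv⟩ := Set.nonempty_iff_ne_empty.2 hz
        obtain ⟨h1, h2⟩ := vec_gen_pow_val (Γ := Γ) v (-vec x v)
        refine Or.inr ⟨gen p Γ v ^ (-vec x v).val,
          (isSingular_iff hΓ).2 ⟨v, by rw [h1]; exact neg_ne_zero.2 hv, h2⟩, ?_⟩
        rw [ih]
        have : {u | vec (x * gen p Γ v ^ (-vec x v).val) u ≠ 0} = {u | vec x u ≠ 0} \ {v} := by
          ext u
          simp only [Set.mem_ofPred_eq, vec_mul, Pi.add_apply, Set.mem_sdiff,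
            Set.mem_singleton_iff]
          by_cases hu : u = v
          · subst hu; simp [h1]
          · simp [h2 u hu, hu]
        rw [this, Set.ncard_sdiff_singleton_of_mem hv]
        omega

/-- A factor supported at `v` can shrink the support only by removing `v`, and it can do so exactly
if `v` belongs to it. -/
theorem inSupport_iff [Fintype V] (hΓ : IsSparse Γ) {x y : MeklerGroup p Γ} {v : V}
    (hy : SupportedAt y v) : InSupport x y ↔ vec x v ≠ 0 := by
  constructor
  · rintro ⟨m, hm, d, ⟨hd, hyd⟩, h⟩ h0
    obtain ⟨w, hw⟩ := (isSingular_iff hΓ).1 hd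
    obtain ⟨q, hq, hqs⟩ := exists_isReading (p := p) hΓ
    have hvw : v = w := by
      have h1 := (hqs ⟨y, (isSingular_iff hΓ).2 ⟨v, hy⟩⟩).eq hy
      have h2 := (hqs ⟨d, hd⟩).eq hw
      rw [← h1, ← h2, hq.eq_iff]
      exact hyd
    subst hvw
    rw [weightLE_iff hΓ] at hm h
    refine hm ((Set.ncard_le_ncard ?_).trans h)
    intro u hu
    have huv : u ≠ v := fun h => hu (h ▸ h0)
    change vec (x * d) u ≠ 0
    rwa [vec_mul, Pi.add_apply, hw.2 u huv, add_zero]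
  · intro hv
    obtain ⟨h1, h2⟩ := vec_gen_pow_val (Γ := Γ) v (-vec x v)
    have hs : SupportedAt (gen p Γ v ^ (-vec x v).val) v :=
      ⟨by rw [h1]; exact neg_ne_zero.2 hv, h2⟩
    have hlt : {u | vec (x * gen p Γ v ^ (-vec x v).val) u ≠ 0}.ncard <
        {u | vec x u ≠ 0}.ncard := by
      refine Set.ncard_lt_ncard ⟨fun u hu => ?_, fun h => ?_⟩
      · by_cases huv : u = v
        · exact huv ▸ hv
        · rwa [Set.mem_ofPred_eq, vec_mul, Pi.add_apply, h2 u huv, add_zero] at hu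
      · have := h hv
        rw [Set.mem_ofPred_eq, vec_mul, Pi.add_apply, h1, add_neg_cancel] at this
        exact this rfl
    refine ⟨{u | vec (x * gen p Γ v ^ (-vec x v).val) u ≠ 0}.ncard, ?_, _,
      ⟨(isSingular_iff hΓ).2 ⟨v, hs⟩, hy.sameCentralizer hs⟩, ?_⟩
    · rw [weightLE_iff hΓ]; omega
    · rw [weightLE_iff hΓ]

/-- One group element, hence one pebble, encodes an arbitrary set of vertices. -/
theorem exists_vec_ne_zero_iff [Fintype V] (S : Set V) :
    ∃ x : MeklerGroup p Γ, ∀ v, vec x v ≠ 0 ↔ v ∈ S := by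
  classical
  have : ∀ s : Finset V, ∃ x : MeklerGroup p Γ, ∀ v, vec x v = if v ∈ s then 1 else 0 := by
    intro s
    induction s using Finset.induction_on with
    | empty => exact ⟨1, fun v => by simp [vec_one]⟩
    | insert a s ha ih =>
      obtain ⟨x, hx⟩ := ih
      refine ⟨x * gen p Γ a, fun v => ?_⟩
      rw [vec_mul, Pi.add_apply, hx]
      by_cases hv : v = a
      · subst hv; simp [ha, vec_gen_self]
      · simp [hv, vec_gen_of_ne hv]
  obtain ⟨x, hx⟩ := this S.toFinset
  exact ⟨x, fun v => by rw [hx]; simp⟩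

end MeklerGroup

/-! ### The game on groups -/

theorem groupWLEquiv_isBackForth {G H : Type*} [Group G] [Group H] [Finite G] [Finite H]
    (h : GroupWLEquiv 3 G H) :
    IsBackForth fun (g : Fin 3 → G) (h : Fin 3 → H) =>
      wlFinalColor markedType g = wlFinalColor markedType h := by
  obtain ⟨f, hf⟩ := h
  exact isBackForth_wlFinalColor ⟨1, f 1, hf 1⟩

namespace IsBackForth

variable {G H : Type*} [Group G] [Group H] {R : (Fin 3 → G) → (Fin 3 → H) → Prop}

theorem lift_eq_one_iff (h0 : ∀ g h, R g h → markedType g = markedType h) {g : Fin 3 → G}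
    {h : Fin 3 → H} (hgh : R g h) (w : FreeGroup (Fin 3)) :
    FreeGroup.lift g w = 1 ↔ FreeGroup.lift h w = 1 := by
  have := h0 g h hgh
  unfold markedType at this
  rw [← MonoidHom.mem_ker, this, MonoidHom.mem_ker]

theorem inv₂_eq (h0 : ∀ g h, R g h → markedType g = markedType h) :
    Inv₂ R (fun x y => x = y) (fun x y => x = y) := by
  intro g h hgh i j
  have := lift_eq_one_iff h0 hgh (.of i * (.of j)⁻¹)
  simpa [mul_inv_eq_one] using this

theorem inv₂_commute (h0 : ∀ g h, R g h → markedType g = markedType h) :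
    Inv₂ R Commute Commute := by
  intro g h hgh i j
  have := lift_eq_one_iff h0 hgh ⁅FreeGroup.of i, FreeGroup.of j⁆
  simpa [map_commutatorElement, commutatorElement_eq_one_iff_commute] using this

theorem inv₃_commutator (h0 : ∀ g h, R g h → markedType g = markedType h) :
    Inv₃ R (fun x y z => x = ⁅y, z⁆) (fun x y z => x = ⁅y, z⁆) := by
  intro g h hgh i j k
  have := lift_eq_one_iff h0 hgh (.of i * ⁅FreeGroup.of j, FreeGroup.of k⁆⁻¹)
  simpa only [map_mul, map_inv, map_commutatorElement, FreeGroup.lift_apply_of,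
    mul_inv_eq_one] using this

theorem inv₃_class (h0 : ∀ g h, R g h → markedType g = markedType h) :
    Inv₃ R (fun x y z => ⁅⁅x, y⁆, z⁆ = 1) (fun x y z => ⁅⁅x, y⁆, z⁆ = 1) := by
  intro g h hgh i j k
  have := lift_eq_one_iff h0 hgh ⁅⁅FreeGroup.of i, FreeGroup.of j⁆, FreeGroup.of k⁆
  simpa [map_commutatorElement] using this

theorem inv₁_pow (h0 : ∀ g h, R g h → markedType g = markedType h) (n : ℕ) :
    Inv₁ R (fun x => x ^ n = 1) (fun x => x ^ n = 1) := by
  intro g h hgh i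
  have := lift_eq_one_iff h0 hgh (.of i ^ n)
  simpa using this

/-- `P` speaks only of entries of the triples, so the product is named by a third pebble `z`. -/
theorem inv₂_mul_pow (hR : IsBackForth R) (h0 : ∀ g h, R g h → markedType g = markedType h)
    (n : ℕ) {P : G → Prop} {P' : H → Prop} (hP : Inv₁ R P P') :
    Inv₂ R (fun x y => P (x * y ^ n)) (fun x y => P' (x * y ^ n)) := by
  have h1 : Inv₃ R (fun x y z => x * y ^ n = z ∧ P z) (fun x y z => x * y ^ n = z ∧ P' z) := by
    intro g h hgh i j k
    have := lift_eq_one_iff h0 hgh (.of i * .of j ^ n * (.of k)⁻¹)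
    refine and_congr ?_ (hP g h hgh k)
    simpa [mul_inv_eq_one] using this
  have h2 := hR.inv₂_ex h1
  simpa using h2

theorem inv₂_mul (hR : IsBackForth R) (h0 : ∀ g h, R g h → markedType g = markedType h)
    {P : G → Prop} {P' : H → Prop} (hP : Inv₁ R P P') :
    Inv₂ R (fun x y => P (x * y)) (fun x y => P' (x * y)) := by
  simpa using hR.inv₂_mul_pow h0 1 hP

theorem inv₁_central (hR : IsBackForth R) (h0 : ∀ g h, R g h → markedType g = markedType h) :
    Inv₁ R (fun x => ∀ y, Commute x y) (fun x => ∀ y, Commute x y) :=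
  hR.inv₁_all (inv₂_commute h0)

theorem inv₁_isSingular (hR : IsBackForth R)
    (h0 : ∀ g h, R g h → markedType g = markedType h) :
    Inv₁ R IsSingular IsSingular := by
  have hc := inv₂_commute h0
  have h1 : Inv₂ R (fun x y => ¬ Commute x y) (fun x y => ¬ Commute x y) :=
    fun g h hgh i j => not_congr (hc g h hgh i j)
  have h2 : Inv₃ R (fun x y z : G => Commute x z ∧ ¬ Commute y z)
      (fun x y z : H => Commute x z ∧ ¬ Commute y z) :=
    fun g h hgh i j k => and_congr (hc g h hgh i k) (h1 g h hgh j k)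
  have h3 : Inv₂ R (fun x y : G => Commute x y ∧ ∃ z, Commute x z ∧ ¬ Commute y z)
      (fun x y : H => Commute x y ∧ ∃ z, Commute x z ∧ ¬ Commute y z) :=
    fun g h hgh i j => and_congr (hc g h hgh i j) (hR.inv₂_ex h2 g h hgh i j)
  exact fun g h hgh i =>
    and_congr (hR.inv₁_ex h1 g h hgh i) (hR.inv₁_ex h3 g h hgh i)

theorem inv₂_sameCentralizer (hR : IsBackForth R)
    (h0 : ∀ g h, R g h → markedType g = markedType h) :
    Inv₂ R SameCentralizer SameCentralizer :=
  hR.inv₂_all fun g h hgh i j k =>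
    iff_congr (inv₂_commute h0 g h hgh i k) (inv₂_commute h0 g h hgh j k)

theorem inv₁_weightLE (hR : IsBackForth R) (h0 : ∀ g h, R g h → markedType g = markedType h)
    (m : ℕ) : Inv₁ R (WeightLE m) (WeightLE m) := by
  induction m with
  | zero => exact hR.inv₁_central h0
  | succ m ih =>
    have h1 : Inv₂ R (fun x d => IsSingular d ∧ WeightLE m (x * d))
        (fun x d => IsSingular d ∧ WeightLE m (x * d)) := fun g h hgh i j =>
      and_congr (hR.inv₁_isSingular h0 g h hgh j) (hR.inv₂_mul h0 ih g h hgh i j)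
    exact fun g h hgh i => or_congr (ih g h hgh i) (hR.inv₁_ex h1 g h hgh i)

theorem inv₂_inSupport (hR : IsBackForth R)
    (h0 : ∀ g h, R g h → markedType g = markedType h) :
    Inv₂ R InSupport InSupport := by
  have h1 : ∀ m, Inv₃ R
      (fun x u d => (IsSingular d ∧ SameCentralizer u d) ∧ WeightLE m (x * d))
      (fun x u d => (IsSingular d ∧ SameCentralizer u d) ∧ WeightLE m (x * d)) :=
    fun m g h hgh i j k => and_congr (and_congr (hR.inv₁_isSingular h0 g h hgh k)
      (hR.inv₂_sameCentralizer h0 g h hgh j k))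
      (hR.inv₂_mul h0 (hR.inv₁_weightLE h0 m) g h hgh i k)
  exact fun g h hgh i j => exists_congr fun m =>
    and_congr (not_congr (hR.inv₁_weightLE h0 m g h hgh i)) (hR.inv₂_ex (h1 m) g h hgh i j)

theorem inv₁_isCommutatorProd (hR : IsBackForth R)
    (h0 : ∀ g h, R g h → markedType g = markedType h) (m : ℕ) :
    Inv₁ R (IsCommutatorProd m) (IsCommutatorProd m) := by
  induction m with
  | zero =>
    intro g h hgh i
    simpa [IsCommutatorProd] using inv₁_pow h0 1 g h hgh i
  | succ m ih =>
    have h1 : Inv₁ R (fun c => ∃ a b, c = ⁅a, b⁆) (fun c => ∃ a b, c = ⁅a, b⁆) :=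
      hR.inv₁_ex (hR.inv₂_ex (inv₃_commutator h0))
    exact hR.inv₁_ex fun g h hgh i j =>
      and_congr (h1 g h hgh j) (hR.inv₂_mul h0 ih g h hgh i j)

end IsBackForth

/-! ### From the game on groups to games on commutation graphs. -/

theorem IsReading.card_fiber {K W : Type*} [Group K] {Δ : SimpleGraph W}
    {q : {x : K // IsSingular x} → W} (hq : IsReading Δ q) (x : {x : K // IsSingular x}) :
    Nat.card {y // q y = q x} = Nat.card {y : K // IsSingular y ∧ SameCentralizer (x : K) y} :=
  Nat.card_congr
    { toFun := fun y => ⟨y.1.1, y.1.2, (hq.eq_iff _ _).1 y.2.symm⟩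
      invFun := fun y => ⟨⟨y.1, y.2.1⟩, ((hq.eq_iff x ⟨y.1, y.2.1⟩).2 y.2.2).symm⟩
      left_inv := fun _ => rfl
      right_inv := fun _ => rfl }

/-- The class of a singular element is an invariant binary relation, so its size is the same at
partner elements. -/
theorem IsReading.card_fiber_eq {G H A B : Type*} [Group G] [Group H]
    {R : (Fin 3 → G) → (Fin 3 → H) → Prop} {Δ : SimpleGraph A} {Δ' : SimpleGraph B}
    {q : {x : G // IsSingular x} → A} {q' : {x : H // IsSingular x} → B} (hR : IsBackForth R)
    (h0 : ∀ g h, R g h → markedType g = markedType h) (hq : IsReading Δ q)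
    (hq' : IsReading Δ' q') {m : ℕ} (hm : ∀ a, Nat.card {x // q x = a} = m) (b : B) :
    Nat.card {y // q' y = b} = m := by
  obtain ⟨y, rfl⟩ := hq'.surjective b
  obtain ⟨g, hg⟩ := hR.exists_left fun _ => (y : H)
  have hs : IsSingular (g 0) := (hR.inv₁_isSingular h0 _ _ hg 0).2 y.2
  rw [hq'.card_fiber, ← hm (q ⟨g 0, hs⟩), hq.card_fiber]
  exact (hR.card_eq_of_inv₂ (A := fun x w => IsSingular w ∧ SameCentralizer x w)
    (A' := fun x w => IsSingular w ∧ SameCentralizer x w) (fun g h hgh i j =>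
      and_congr (hR.inv₁_isSingular h0 g h hgh j) (hR.inv₂_sameCentralizer h0 g h hgh i j))
    hg 0).symm

/-- A game position on two groups together with readings of their singular elements as the
vertices of two graphs, such that all classes have the same size. -/
structure ReadingGame {G H A B : Type*} [Group G] [Group H] (R : (Fin 3 → G) → (Fin 3 → H) → Prop)
    (Δ : SimpleGraph A) (Δ' : SimpleGraph B) (q : {x : G // IsSingular x} → A)
    (q' : {x : H // IsSingular x} → B) (m : ℕ) : Prop where
  back : IsBackForth R
  type_eq : ∀ g h, R g h → markedType g = markedType h
  left : IsReading Δ q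
  right : IsReading Δ' q'
  pos : 0 < m
  card_left : ∀ a, Nat.card {x // q x = a} = m
  ne : ∃ x : G, IsSingular x

namespace ReadingGame

variable {G H A B : Type*} [Group G] [Group H]
  {R : (Fin 3 → G) → (Fin 3 → H) → Prop} {Δ : SimpleGraph A} {Δ' : SimpleGraph B}
  {q : {x : G // IsSingular x} → A} {q' : {x : H // IsSingular x} → B} {m : ℕ}

theorem finite_left [Finite G] (h : ReadingGame R Δ Δ' q q' m) : Finite A :=
  Finite.of_surjective q h.left.surjective

theorem finite_right [Finite H] (h : ReadingGame R Δ Δ' q q' m) : Finite B :=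
  Finite.of_surjective q' h.right.surjective

theorem restrict (hG : ReadingGame R Δ Δ' q q' m) :
    IsBackForth fun (g : Fin 3 → {x : G // IsSingular x}) (h : Fin 3 → {x : H // IsSingular x}) =>
      R (fun j => (g j : G)) (fun j => (h j : H)) :=
  hG.back.restrict (D := {x | IsSingular x}) (D' := {x | IsSingular x})
    (hG.back.inv₁_isSingular hG.type_eq) hG.ne (by decide)

/-- Equality and adjacency of vertices are the invariant relations `SameCentralizer` and
noncentralizer-equal commutation, and all classes have size `m`. So refinement on groups is at least
as fine as on the graphs. -/
theorem wlFinalColor_eq [Finite G] [Finite H] (hG : ReadingGame R Δ Δ' q q' m)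
    (g : Fin 3 → {x : G // IsSingular x}) (h : Fin 3 → {x : H // IsSingular x})
    (hgh : R (fun j => (g j : G)) (fun j => (h j : H))) :
    wlFinalColor (graphType Δ) (q ∘ g) = wlFinalColor (graphType Δ') (q' ∘ h) := by
  have := hG.finite_left
  have := hG.finite_right
  refine hG.restrict.wlFinalColor_comp_eq q q' m hG.pos hG.card_left
    (hG.left.card_fiber_eq hG.back hG.type_eq hG.right hG.card_left) ?_ g h hgh
  intro g h hgh
  funext i j
  have h1 := hG.back.inv₂_sameCentralizer hG.type_eq _ _ hgh i j
  have h2 := IsBackForth.inv₂_commute hG.type_eq _ _ hgh i j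
  refine Prod.ext (propext ?_) (propext ?_)
  · exact (hG.left.eq_iff _ _).trans (h1.trans (hG.right.eq_iff _ _).symm)
  · exact (hG.left.adj_iff _ _).trans ((and_congr h2 (not_congr h1)).trans
      (hG.right.adj_iff _ _).symm)

theorem isBackForth [Finite G] [Finite H] (hG : ReadingGame R Δ Δ' q q' m) :
    IsBackForth fun (g : Fin 3 → A) (h : Fin 3 → B) =>
      wlFinalColor (graphType Δ) g = wlFinalColor (graphType Δ') h := by
  have := hG.finite_left
  have := hG.finite_right
  obtain ⟨g, h, hgh⟩ := hG.restrict.nonempty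
  exact isBackForth_wlFinalColor ⟨_, _, hG.wlFinalColor_eq g h hgh⟩

/-- For every element of the first group there is a set of vertices of the second graph such that
pairs of vertices are related by a game that preserves membership in the supports. -/
theorem exists_isBackForth_support [Finite G] [Finite H]
    (hG : ReadingGame R Δ Δ' q q' m) (x : G) :
    ∃ (S' : Set B) (Q : (Fin 2 → A) → (Fin 2 → B) → Prop), IsBackForth Q ∧
      ∀ g h, Q g h → (∀ i, (∃ u, q u = g i ∧ InSupport x (u : G)) ↔ h i ∈ S') ∧
        wlFinalColor (graphType Δ) ![g 0, g 0, g 1] =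
          wlFinalColor (graphType Δ') ![h 0, h 0, h 1] := by
  have := hG.finite_left
  have := hG.finite_right
  obtain ⟨h, hxh⟩ := hG.back.exists_right fun _ => x
  let S : Set A := {a | ∃ u, q u = a ∧ InSupport x (u : G)}
  let S' : Set B := {b | ∃ u, q' u = b ∧ InSupport (h 0) (u : H)}
  have hS : ∀ u, q u ∈ S ↔ InSupport x (u : G) := fun u =>
    ⟨fun ⟨v, hv, h⟩ => (InSupport.congr ((hG.left.eq_iff _ _).1 hv)).1 h, fun h => ⟨u, rfl, h⟩⟩
  have hS' : ∀ u, q' u ∈ S' ↔ InSupport (h 0) (u : H) := fun u =>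
    ⟨fun ⟨v, hv, h⟩ => (InSupport.congr ((hG.right.eq_iff _ _).1 hv)).1 h, fun h => ⟨u, rfl, h⟩⟩
  have h1 := hG.back.cons (x := x) (y := h 0) ⟨fun _ => x, Fin.tail h, by
    rw [Fin.cons_self_tail]
    convert hxh using 1
    funext i
    refine Fin.cases rfl (fun _ => rfl) i⟩
  have h2 := h1.restrict (D := {x | IsSingular x}) (D' := {x | IsSingular x})
    (fun g h hgh j => hG.back.inv₁_isSingular hG.type_eq _ _ hgh j.succ) hG.ne (by decide)
  -- The initial colours of the two-pebble game already contain the final colours of the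
  -- three-pebble game on the graph, so nothing is lost by leaving one pebble on `x`.
  let χ : (Fin 2 → A) → (Fin 2 → Prop) × (∀ i, WLColor (Fin 3 → Fin 3 → Prop × Prop) 3 i) :=
    fun g => (fun i => g i ∈ S, wlFinalColor (graphType Δ) ![g 0, g 0, g 1])
  let χ' : (Fin 2 → B) → (Fin 2 → Prop) × (∀ i, WLColor (Fin 3 → Fin 3 → Prop × Prop) 3 i) :=
    fun g => (fun i => g i ∈ S', wlFinalColor (graphType Δ') ![g 0, g 0, g 1])
  have h3 := fun g h hgh => h2.wlFinalColor_comp_eq q q' m hG.pos hG.card_left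
    (hG.left.card_fiber_eq hG.back hG.type_eq hG.right hG.card_left) (χ := χ) (χ' := χ')
    (by
      intro u u' huu
      refine Prod.ext (funext fun i => propext ?_) ?_
      · exact (hS _).trans (Iff.trans
          (hG.back.inv₂_inSupport hG.type_eq _ _ huu 0 i.succ) (hS' _).symm)
      -- Moving the pebble from `x` to `u 0` gives a related triple of singular elements. Its
      -- partner duplicates `u' 0`, because equality of entries is invariant.
      · obtain ⟨π, hπ⟩ := hG.back.step _ _ huu
        have h4 := hπ 0 (u 0)
        have h5 : π (u 0) = (u' 0 : H) := by
          have := IsBackForth.inv₂_eq hG.type_eq _ _ h4 0 1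
          exact this.1 rfl
        rw [h5, Fin.update_cons_zero, Fin.update_cons_zero] at h4
        have h6 := hG.wlFinalColor_eq ![u 0, u 0, u 1] ![u' 0, u' 0, u' 1] (by
          convert h4 using 1
          · funext i; fin_cases i <;> rfl
          · funext i; fin_cases i <;> rfl)
        have e1 : q ∘ ![u 0, u 0, u 1] = ![q (u 0), q (u 0), q (u 1)] := by
          funext i; fin_cases i <;> rfl
        have e2 : q' ∘ ![u' 0, u' 0, u' 1] = ![q' (u' 0), q' (u' 0), q' (u' 1)] := by
          funext i; fin_cases i <;> rfl
        rw [e1, e2] at h6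
        exact h6) g h hgh
  obtain ⟨u, u', huu⟩ := h2.nonempty
  refine ⟨S', _, isBackForth_wlFinalColor ⟨_, _, h3 u u' huu⟩, fun g h hgh => ?_⟩
  have h4 : χ g = χ' h := congrFun hgh 0
  exact ⟨fun i => iff_of_eq (congrFun (congrArg Prod.fst h4) i), congrArg Prod.snd h4⟩

end ReadingGame

/-! ### Recovering the group from its commutation graph. -/

namespace MeklerGroup

variable {V : Type u} [Fintype V] {p : ℕ} [Fact p.Prime] {Γ : SimpleGraph V} {H : Type*} [Group H]
  [Finite H]

/-- The game between a Mekler group and a group that `3`-WL does not distinguish from it. -/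
theorem exists_readingGame [Nonempty V] (hΓ : IsSparse Γ)
    (h : GroupWLEquiv 3 (MeklerGroup p Γ) H) {B : Type*} {Δ : SimpleGraph B}
    {q' : {x : H // IsSingular x} → B} (hq' : IsReading Δ q') :
    ∃ R : (Fin 3 → MeklerGroup p Γ) → (Fin 3 → H) → Prop,
      ∃ (q : {x : MeklerGroup p Γ // IsSingular x} → V) (m : ℕ), ReadingGame R Γ Δ q q' m ∧
        ∀ x : {x : MeklerGroup p Γ // IsSingular x}, SupportedAt x.1 (q x) := by
  obtain ⟨q, hq, hqs⟩ := exists_isReading (p := p) hΓ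
  obtain ⟨v₀⟩ := (inferInstance : Nonempty V)
  have hcard : ∀ v, Nat.card {x // q x = v} =
      Nat.card {x : MeklerGroup p Γ // SupportedAt x v} := fun v => Nat.card_congr
    { toFun := fun x => ⟨x.1.1, by have := hqs x.1; rwa [x.2] at this⟩
      invFun := fun x => ⟨⟨x.1, (isSingular_iff hΓ).2 ⟨v, x.2⟩⟩, (hqs _).eq x.2⟩
      left_inv := fun _ => rfl
      right_inv := fun _ => rfl }
  refine ⟨_, q, Nat.card {x : MeklerGroup p Γ // SupportedAt x v₀},
    ⟨groupWLEquiv_isBackForth h, fun g h hgh => congrFun hgh 0, hq, hq', ?_,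
      fun v => (hcard v).trans (card_supportedAt v v₀), ⟨_, isSingular_gen hΓ v₀⟩⟩, hqs⟩
  have : Nonempty {x : MeklerGroup p Γ // SupportedAt x v₀} := ⟨⟨_, supportedAt_gen v₀⟩⟩
  exact Nat.card_pos

/-- A finite group that `3`-WL does not distinguish from the Mekler group of `Γ` is isomorphic to
it, provided that its commutation graph is `Γ`. -/
theorem nonempty_mulEquiv [Nonempty V] (hΓ : IsSparse Γ) (h : GroupWLEquiv 3 (MeklerGroup p Γ) H)
    {q' : {x : H // IsSingular x} → V} (hq' : IsReading Γ q') :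
    Nonempty (MeklerGroup p Γ ≃* H) := by
  obtain ⟨R, q, m, hG, hqs⟩ := exists_readingGame hΓ h hq'
  have hR := hG.back
  have h0 := hG.type_eq
  have hsing := hR.inv₁_isSingular h0
  have hcent := hR.inv₁_central h0
  -- representatives
  have hrep : ∀ v, ∃ x : H, x ^ p = 1 ∧ ∃ hx : IsSingular x, q' ⟨x, hx⟩ = v := by
    have h1 : Inv₁ R
        (fun x => ¬ IsSingular x ∨ ∃ y, (y ^ p = 1 ∧ IsSingular y) ∧ SameCentralizer y x)
        (fun x => ¬ IsSingular x ∨ ∃ y, (y ^ p = 1 ∧ IsSingular y) ∧ SameCentralizer y x) :=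
      fun g h hgh i => or_congr (not_congr (hsing g h hgh i)) (hR.inv₁_ex
        (A := fun x y => (y ^ p = 1 ∧ IsSingular y) ∧ SameCentralizer y x)
        (A' := fun x y => (y ^ p = 1 ∧ IsSingular y) ∧ SameCentralizer y x)
        (fun g h hgh i j => and_congr (and_congr (IsBackForth.inv₁_pow h0 p g h hgh j)
          (hsing g h hgh j)) (hR.inv₂_sameCentralizer h0 g h hgh j i)) g h hgh i)
    intro v
    obtain ⟨x, rfl⟩ := hq'.surjective v
    rcases hR.forall₁ h1 (fun x => by
      by_cases hx : IsSingular x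
      · obtain ⟨v, hv⟩ := (isSingular_iff hΓ).1 hx
        exact Or.inr ⟨gen p Γ v, ⟨gen_pow v, isSingular_gen hΓ v⟩,
          hv.sameCentralizer_gen.symm⟩
      · exact Or.inl hx) x with hx | ⟨y, ⟨hy, hys⟩, hyx⟩
    · exact absurd x.2 hx
    · exact ⟨y, hy, hys, (hq'.eq_iff _ _).2 hyx⟩
  choose r hrp hrs hrq using hrep
  have hclass := hR.forall₃ (IsBackForth.inv₃_class h0) fun x y z => by
    rw [commutatorElement_eq_one_iff_commute]
    exact (Subgroup.mem_center_iff.1 (commutator_mem_center x y) z).symm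
  let F : MeklerGroup p Γ →* H := lift r hrp (fun u v w => hclass _ _ _) fun u v huv => by
    rw [← hrq u, ← hrq v] at huv
    exact ((hq'.adj_iff _ _).1 huv).1
  have hFr : ∀ v, r v ∈ F.range := fun v => ⟨gen p Γ v, lift_gen _ _ _ _ v⟩
  -- singular elements of `H` are products of powers of representatives and central elements
  have hpow : ∀ x : H, IsSingular x → ∃ c ∈ F.range, ∃ z, (∀ y, Commute z y) ∧ x = c * z := by
    have h1 : Inv₂ R (fun x y => IsSingular x ∧ SameCentralizer x y →
          ∃ j : ℕ, ∀ w, Commute (x * y ^ j) w)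
        (fun x y => IsSingular x ∧ SameCentralizer x y →
          ∃ j : ℕ, ∀ w, Commute (x * y ^ j) w) := fun g h hgh i j =>
      imp_congr (and_congr (hsing g h hgh i) (hR.inv₂_sameCentralizer h0 g h hgh i j))
        (exists_congr fun n => hR.inv₂_mul_pow h0 n hcent g h hgh i j)
    have h2 := hR.forall₂ h1 (by
      rintro x y ⟨hx, hxy⟩
      have hqxy := (hG.left.eq_iff ⟨x, hx⟩ ⟨y, hxy.isSingular hx⟩).2 hxy
      have hxs := hqs ⟨x, hx⟩
      have hys := hqs ⟨y, hxy.isSingular hx⟩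
      rw [← hqxy] at hys
      -- The exponent `j` that solves `vec x + j • vec y = 0` at the only vertex where the two
      -- vectors do not vanish.
      refine ⟨(-(vec x (q ⟨x, hx⟩)) * (vec y (q ⟨x, hx⟩))⁻¹).val, ?_⟩
      rw [central_iff hΓ]
      funext u
      rw [vec_mul, vec_pow, Pi.add_apply, Pi.smul_apply, Pi.zero_apply, nsmul_eq_mul,
        ZMod.natCast_zmod_val]
      by_cases hu : u = q ⟨x, hx⟩
      · subst hu
        rw [mul_assoc, inv_mul_cancel₀ hys.1]
        ring
      · rw [hxs.2 u hu, hys.2 u hu]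
        simp)
    intro x hx
    obtain ⟨j, hj⟩ := h2 x (r (q' ⟨x, hx⟩)) ⟨hx, (hq'.eq_iff ⟨x, hx⟩ ⟨_, hrs _⟩).1 (hrq _).symm⟩
    refine ⟨(r (q' ⟨x, hx⟩) ^ j)⁻¹, inv_mem (pow_mem (hFr _) j), _, hj, ?_⟩
    have := hj (r (q' ⟨x, hx⟩) ^ j)⁻¹
    rw [← this.eq, mul_assoc, mul_inv_cancel, mul_one]
  -- Every element of the Mekler group has some finite weight. This transfers since each `WeightLE
  -- m` is invariant, and induction on the weight strips off singular factors.
  have hgen : ∀ x : H, ∃ c ∈ F.range, ∃ z, (∀ y, Commute z y) ∧ x = c * z := by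
    have h1 : Inv₁ R (fun x => ∃ m, WeightLE m x) (fun x => ∃ m, WeightLE m x) :=
      fun g h hgh i => exists_congr fun m => hR.inv₁_weightLE h0 m g h hgh i
    intro x
    obtain ⟨n, hn⟩ := hR.forall₁ h1 (fun x => ⟨_, (weightLE_iff hΓ).2 le_rfl⟩) x
    induction n generalizing x with
    | zero => exact ⟨1, one_mem _, x, hn, (one_mul x).symm⟩
    | succ n ih =>
      rcases hn with hn | ⟨d, hd, hn⟩
      · exact ih x hn
      · obtain ⟨c, hc, z, hz, hxd⟩ := ih _ hn
        obtain ⟨c', hc', z', hz', rfl⟩ := hpow d hd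
        refine ⟨c * c'⁻¹, mul_mem hc (inv_mem hc'), z * z'⁻¹,
          fun y => (hz y).mul_left (hz' y).inv_left, ?_⟩
        calc x = x * (c' * z') * (z'⁻¹ * c'⁻¹) := by group
          _ = c * z * (z'⁻¹ * c'⁻¹) := by rw [hxd]
          _ = c * (z * z'⁻¹ * c'⁻¹) := by group
          _ = c * (c'⁻¹ * (z * z'⁻¹)) := by
            rw [((hz c'⁻¹).mul_left (hz' c'⁻¹).inv_left).eq]
          _ = _ := by group
  -- the center of `H` is contained in the range
  have hcomm : ∀ a b : H, ⁅a, b⁆ ∈ F.range := by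
    intro a b
    obtain ⟨c, hc, z, hz, rfl⟩ := hgen a
    obtain ⟨c', hc', z', hz', rfl⟩ := hgen b
    have : ⁅c * z, c' * z'⁆ = ⁅c, c'⁆ := by
      rw [commutatorElement_def, commutatorElement_def]
      calc c * z * (c' * z') * (c * z)⁻¹ * (c' * z')⁻¹
          = c * (z * c') * z' * z⁻¹ * c⁻¹ * z'⁻¹ * c'⁻¹ := by group
        _ = c * c' * (z * z') * z⁻¹ * c⁻¹ * z'⁻¹ * c'⁻¹ := by rw [(hz c').eq]; group
        _ = c * c' * (z' * c⁻¹) * z'⁻¹ * c'⁻¹ := by rw [(hz z').eq]; group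
        _ = c * c' * c⁻¹ * c'⁻¹ := by rw [(hz' c⁻¹).eq]; group
    rw [this, commutatorElement_def]
    exact mul_mem (mul_mem (mul_mem hc hc') (inv_mem hc)) (inv_mem hc')
  have hcen : ∀ z : H, (∀ y, Commute z y) → z ∈ F.range := by
    -- Central elements of the Mekler group have zero exponent vector and are therefore products of
    -- commutators. This passes to `H`, where all commutators lie in the range of `F`.
    have h1 : Inv₁ R (fun x => (∀ y, Commute x y) → ∃ m, IsCommutatorProd m x)
        (fun x => (∀ y, Commute x y) → ∃ m, IsCommutatorProd m x) := fun g h hgh i =>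
      imp_congr (hcent g h hgh i)
        (exists_congr fun m => hR.inv₁_isCommutatorProd h0 m g h hgh i)
    have h2 := hR.forall₁ h1 fun x hx => (mem_commutator_iff_exists_isCommutatorProd x).1
      (mem_commutator_of_vec_eq_zero ((central_iff hΓ).1 hx))
    have h3 : commutator H ≤ F.range := by
      rw [commutator_def, Subgroup.commutator_le]
      exact fun a _ b _ => hcomm a b
    exact fun z hz => h3 ((mem_commutator_iff_exists_isCommutatorProd z).2 (h2 z hz))
  have hsurj : Function.Surjective F := fun x => by
    obtain ⟨c, hc, z, hz, rfl⟩ := hgen x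
    exact mul_mem hc (hcen z hz)
  obtain ⟨g, h, hgh⟩ := hR.nonempty
  obtain ⟨π, -⟩ := hR.step g h hgh
  -- The bijection `π` of the ground sets shows that the two groups have the same order.
  have hbij : Function.Bijective F := (Nat.bijective_iff_surjective_and_card F).2
    ⟨hsurj, Nat.card_congr π⟩
  exact ⟨MulEquiv.ofBijective F hbij⟩

end MeklerGroup

/-! ### Even strings on a three-element set -/

section Strings

variable {N : Type*} (hN : Nat.card N = 3)

include hN

theorem exists_third {a b : N} (hab : a ≠ b) :
    ∃ c, c ≠ a ∧ c ≠ b ∧ ∀ x, x = a ∨ x = b ∨ x = c := by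
  classical
  have : Finite N := Nat.finite_of_card_ne_zero (by omega)
  have := Fintype.ofFinite N
  rw [Nat.card_eq_fintype_card] at hN
  have h1 : (Finset.univ \ {a, b} : Finset N).card = 1 := by
    rw [Finset.card_sdiff_of_subset (Finset.subset_univ _), Finset.card_univ, hN,
      Finset.card_pair hab]
  obtain ⟨c, hc⟩ := Finset.card_eq_one.1 h1
  have hmem : ∀ x, x ∈ (Finset.univ \ {a, b} : Finset N) ↔ x = c := fun x => by simp [hc]
  simp only [Finset.mem_sdiff, Finset.mem_univ, true_and, Finset.mem_insert,
    Finset.mem_singleton, not_or] at hmem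
  refine ⟨c, ((hmem c).2 rfl).1, ((hmem c).2 rfl).2, fun x => ?_⟩
  have := hmem x
  tauto

theorem exists_ne_of_card_eq_three (a : N) : ∃ b, b ≠ a := by
  by_contra! h
  have : Subsingleton N := ⟨fun x y => (h x).trans (h y).symm⟩
  have : Unique N := uniqueOfSubsingleton a
  simp at hN

theorem even_card_iff {a b c : N} (hab : a ≠ b) (hca : c ≠ a) (hcb : c ≠ b)
    (hcov : ∀ x, x = a ∨ x = b ∨ x = c) (s : N → Bool) :
    Even (Nat.card {w // s w = true}) ↔ (s a ^^ (s b ^^ s c)) = false := by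
  classical
  have : Finite N := Nat.finite_of_card_ne_zero (by omega)
  have := Fintype.ofFinite N
  have huniv : (Finset.univ : Finset N) = {a, b, c} := by
    ext x; simpa using hcov x
  rw [Nat.card_eq_fintype_card, Fintype.card_subtype, huniv, Finset.filter_insert,
    Finset.filter_insert, Finset.filter_singleton]
  cases s a <;> cases s b <;> cases s c <;> simp [hab, hca.symm, hcb.symm]
  decide

theorem exists_even {a b : N} (hab : a ≠ b) (x y : Bool) :
    ∃ s : N → Bool, Even (Nat.card {w // s w = true}) ∧ s a = x ∧ s b = y := by
  classical
  obtain ⟨c, hca, hcb, hcov⟩ := exists_third hN hab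
  refine ⟨fun w => if w = a then x else if w = b then y else (x ^^ y), ?_, ?_, ?_⟩
  · rw [even_card_iff hN hab hca hcb hcov]
    cases x <;> cases y <;> simp [hab.symm, hca, hcb]
  · simp
  · simp [hab.symm]

theorem even_ext {a b : N} (hab : a ≠ b) {s t : N → Bool}
    (hs : Even (Nat.card {w // s w = true})) (ht : Even (Nat.card {w // t w = true}))
    (ha : s a = t a) (hb : s b = t b) : s = t := by
  obtain ⟨c, hca, hcb, hcov⟩ := exists_third hN hab
  rw [even_card_iff hN hab hca hcb hcov] at hs ht
  have hc : s c = t c := by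
    rw [ha, hb] at hs
    revert hs ht
    cases t a <;> cases t b <;> cases s c <;> cases t c <;> simp
  funext x
  rcases hcov x with rfl | rfl | rfl <;> assumption

/-- Complementary strings of odd length have different parities. -/
theorem exists_eq_of_even {s t : N → Bool}
    (hs : Even (Nat.card {w // s w = true})) (ht : Even (Nat.card {w // t w = true})) :
    ∃ a, s a = t a := by
  have hne : Nonempty N := by
    by_contra h
    rw [not_nonempty_iff] at h
    simp at hN
  obtain ⟨a⟩ := hne
  obtain ⟨b, hb⟩ := exists_ne_of_card_eq_three hN a
  obtain ⟨c, hca, hcb, hcov⟩ := exists_third hN hb.symm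
  rw [even_card_iff hN hb.symm hca hcb hcov] at hs ht
  by_contra! h
  have h1 := h a
  have h2 := h b
  have h3 := h c
  revert hs ht h1 h2 h3
  cases s a <;> cases s b <;> cases s c <;> cases t a <;> cases t b <;> cases t c <;> simp

/-- An even string is determined by two of its three bits, so at most two even strings share a given
bit. -/
theorem eq_of_even_of_eq_at {a : N} {s t r : N → Bool}
    (hs : Even (Nat.card {w // s w = true})) (ht : Even (Nat.card {w // t w = true}))
    (hr : Even (Nat.card {w // r w = true})) (hst : s a = t a) (hsr : s a = r a) :
    s = t ∨ s = r ∨ t = r := by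
  obtain ⟨b, hb⟩ := exists_ne_of_card_eq_three hN a
  have h : s b = t b ∨ s b = r b ∨ t b = r b := by
    cases s b <;> cases t b <;> cases r b <;> simp
  rcases h with h | h | h
  · exact Or.inl (even_ext hN hb.symm hs ht hst h)
  · exact Or.inr (Or.inl (even_ext hN hb.symm hs hr hsr h))
  · exact Or.inr (Or.inr (even_ext hN hb.symm ht hr (hst.symm.trans hsr) h))

theorem card_even : Nat.card {s : N → Bool // Even (Nat.card {w // s w = true})} = 4 := by
  have hne : Nonempty N := by
    by_contra h
    rw [not_nonempty_iff] at h
    simp at hN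
  obtain ⟨a⟩ := hne
  obtain ⟨b, hb⟩ := exists_ne_of_card_eq_three hN a
  have hbij : Function.Bijective
      fun s : {s : N → Bool // Even (Nat.card {w // s w = true})} => (s.1 a, s.1 b) := by
    constructor
    · rintro ⟨s, hs⟩ ⟨t, ht⟩ h
      exact Subtype.ext (even_ext hN hb.symm hs ht (congrArg Prod.fst h) (congrArg Prod.snd h))
    · rintro ⟨x, y⟩
      obtain ⟨s, hs, hx, hy⟩ := exists_even hN hb.symm x y
      exact ⟨⟨s, hs⟩, Prod.ext hx hy⟩
  rw [Nat.card_congr (Equiv.ofBijective _ hbij)]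
  simp

end Strings

/-! ### Relations on the vertices of a graph -/

section Relations

variable {V : Type*} (Γ : SimpleGraph V)

/-- Two different vertices have a common neighbour. -/
def AtTwo (x y : V) : Prop := x ≠ y ∧ ∃ z, Γ.Adj x z ∧ Γ.Adj z y

/-- Two vertices belong to a set of four vertices any two of which have a common neighbour. -/
def Twin (x y : V) : Prop :=
  AtTwo Γ x y ∧ ∃ a, (AtTwo Γ x a ∧ AtTwo Γ y a) ∧ ∃ b, AtTwo Γ x b ∧ AtTwo Γ y b ∧ AtTwo Γ a b

/-- The vertex has a twin. -/
def IsInner (x : V) : Prop := ∃ y, Twin Γ x y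

/-- The vertices are equal or twins. -/
def SameGadget (x y : V) : Prop := x = y ∨ Twin Γ x y

/-- Inner vertices that are joined by a walk of length three. -/
def Matched (x y : V) : Prop := (IsInner Γ x ∧ IsInner Γ y) ∧ ∃ z, AtTwo Γ x z ∧ Γ.Adj z y

/-- Inner vertices in adjacent gadgets. -/
def BaseAdj (x y : V) : Prop := ∃ y', SameGadget Γ y y' ∧ Matched Γ x y'

/-- The outer vertex `z` belongs to the gadget of the inner vertex `x`. -/
def Near (z x : V) : Prop :=
  (¬ IsInner Γ z ∧ IsInner Γ x) ∧ ∃ x', SameGadget Γ x x' ∧ Γ.Adj z x'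

/-- The outer vertex `z` has a neighbour in the gadget of the inner vertex `x`, but is not part
of it. -/
def Far (z x : V) : Prop :=
  (¬ IsInner Γ z ∧ IsInner Γ x) ∧ ∃ x', SameGadget Γ x x' ∧ AtTwo Γ z x'

end Relations

theorem AtTwo.symm {V : Type*} {Γ : SimpleGraph V} {x y : V} (h : AtTwo Γ x y) : AtTwo Γ y x :=
  ⟨h.1.symm, h.2.imp fun _ hz => ⟨hz.2.symm, hz.1.symm⟩⟩

/-! ### The relations in CFI graphs -/

namespace CFIVertex

variable {V : Type u} {Γ : SimpleGraph V}

/-- The gadget of a vertex. -/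
def base : CFIVertex Γ → V
  | ext v _ _ _ => v
  | int v _ _ => v

/-- The gadget that an external vertex is directed to. -/
def far : CFIVertex Γ → V
  | ext _ w _ _ => w
  | int v _ _ => v

/-- The internal vertices. -/
def Internal : CFIVertex Γ → Prop
  | ext _ _ _ _ => False
  | int _ _ _ => True

theorem adj_int_ext {T : Set (Sym2 V)} {v w : V} {s hs h b} :
    (cfiTwist Γ T).Adj (int v s hs) (ext v w h b) ↔ s ⟨w, h⟩ = b :=
  ⟨fun ⟨_, h⟩ => h, fun h => ⟨rfl, h⟩⟩

theorem adj_ext_int {T : Set (Sym2 V)} {v w : V} {s hs h b} :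
    (cfiTwist Γ T).Adj (ext v w h b) (int v s hs) ↔ s ⟨w, h⟩ = b :=
  ⟨fun ⟨_, h⟩ => h, fun h => ⟨rfl, h⟩⟩

theorem adj_ext_ext {T : Set (Sym2 V)} {v w : V} {h h' b b'} :
    (cfiTwist Γ T).Adj (ext v w h b) (ext w v h' b') ↔ (b = b' ↔ s(v, w) ∉ T) :=
  ⟨fun h => h.2.2, fun h => ⟨rfl, rfl, h⟩⟩

theorem exists_adj_ext_ext (T : Set (Sym2 V)) {v w : V} (h : Γ.Adj v w) (b : Bool) :
    ∃ b', (cfiTwist Γ T).Adj (ext v w h b) (ext w v h.symm b') := by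
  by_cases hT : s(v, w) ∈ T
  · exact ⟨!b, adj_ext_ext.2 (by simp [hT])⟩
  · exact ⟨b, adj_ext_ext.2 (by simp [hT])⟩

variable (hΓ : ∀ v, Nat.card (Γ.neighborSet v) = 3) (T : Set (Sym2 V))

include hΓ

theorem atTwo_int_int {v : V} {s t hs ht} :
    AtTwo (cfiTwist Γ T) (int v s hs) (int v t ht) ↔ s ≠ t := by
  constructor
  · rintro ⟨h, -⟩ rfl
    exact h rfl
  · intro h
    refine ⟨fun he => h (by cases he; rfl), ?_⟩
    obtain ⟨⟨w, hw⟩, ha⟩ := exists_eq_of_even (hΓ v) hs ht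
    exact ⟨ext v w hw (s ⟨w, hw⟩), adj_int_ext.2 rfl, adj_ext_int.2 ha.symm⟩

omit hΓ in
theorem base_eq_of_atTwo_int_int {v v' : V} {s t hs ht}
    (h : AtTwo (cfiTwist Γ T) (int v s hs) (int v' t ht)) : v = v' := by
  obtain ⟨-, (⟨a, b, hab, c⟩ | ⟨a, r, hr⟩), h1, h2⟩ := h
  · obtain ⟨rfl, -⟩ := h1
    obtain ⟨rfl, -⟩ := h2
    rfl
  · exact h1.elim

/-- External vertices have only one external neighbour, so a common neighbour is internal.
Conversely, two bits of an even string can be prescribed. -/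
theorem atTwo_ext_ext {v w v' w' : V} {h h' b b'} :
    AtTwo (cfiTwist Γ T) (ext v w h b) (ext v' w' h' b') ↔ v = v' ∧ w ≠ w' := by
  constructor
  · rintro ⟨hne, (⟨a, b, hab, c⟩ | ⟨a, r, hr⟩), h1, h2⟩
    · obtain ⟨rfl, rfl, h1⟩ := h1
      obtain ⟨rfl, rfl, h2⟩ := h2
      refine absurd ?_ hne
      rw [Sym2.eq_swap] at h2
      congr 1
      revert h1 h2
      by_cases hT : s(w', v') ∈ T <;> rw [Sym2.eq_swap] at hT <;> cases b <;> cases b' <;>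
        cases c <;> simp [hT]
    · obtain ⟨rfl, h1⟩ := h1
      obtain ⟨rfl, h2⟩ := h2
      refine ⟨rfl, ?_⟩
      rintro rfl
      exact hne (by rw [← h1, ← h2])
  · rintro ⟨rfl, hw⟩
    refine ⟨fun he => hw (by cases he; rfl), ?_⟩
    obtain ⟨s, hs, h1, h2⟩ := exists_even (hΓ v) (a := ⟨w, h⟩) (b := ⟨w', h'⟩)
      (fun he => hw (congrArg Subtype.val he)) b b'
    exact ⟨int v s hs, adj_ext_int.2 h1, adj_int_ext.2 h2⟩

omit hΓ in
theorem atTwo_ext_int {v w : V} {s hs h b} :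
    AtTwo (cfiTwist Γ T) (ext w v h b) (int v s hs) ↔
      (b = s ⟨w, h.symm⟩ ↔ s(w, v) ∉ T) := by
  constructor
  · rintro ⟨hne, (⟨a, b, hab, c⟩ | ⟨a, r, hr⟩), h1, h2⟩
    · obtain ⟨rfl, rfl, h1⟩ := h1
      rwa [← adj_int_ext.1 h2.symm] at h1
    · exact h2.elim
  · intro h1
    exact ⟨by simp, ext v w h.symm (s ⟨w, h.symm⟩), adj_ext_ext.2 h1, adj_ext_int.2 rfl⟩

omit hΓ in
theorem far_eq_of_atTwo_ext_int {v w v' : V} {s hs h b}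
    (h : AtTwo (cfiTwist Γ T) (ext w v h b) (int v' s hs)) : v = v' := by
  obtain ⟨-, (⟨a, b, hab, c⟩ | ⟨a, r, hr⟩), h1, h2⟩ := h
  · obtain ⟨rfl, rfl, -⟩ := h1
    obtain ⟨rfl, -⟩ := h2
    rfl
  · exact h2.elim

/-- An internal `z` would lie in the gadget that both `x` and `y` are directed to, but two external
vertices with a common neighbour have different directions. -/
theorem not_internal_of_triangle {x y z : CFIVertex Γ} (hxy : AtTwo (cfiTwist Γ T) x y)
    (hxz : AtTwo (cfiTwist Γ T) x z) (hyz : AtTwo (cfiTwist Γ T) y z) (hx : ¬ x.Internal)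
    (hy : ¬ y.Internal) : ¬ z.Internal := by
  rcases x with ⟨v, w, h, i⟩ | ⟨v, s, hs⟩
  · rcases y with ⟨v', w', h', i'⟩ | ⟨v', s', hs'⟩
    · rcases z with ⟨v'', w'', h'', i''⟩ | ⟨v'', s'', hs''⟩
      · exact id
      · have h1 := far_eq_of_atTwo_ext_int T hxz
        have h2 := far_eq_of_atTwo_ext_int T hyz
        exact (((atTwo_ext_ext hΓ T).1 hxy).2 (h1.trans h2.symm)).elim
    · exact (hy trivial).elim
  · exact (hx trivial).elim

/-- Four vertices with pairwise common neighbours cannot include an external one. All four external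
would need four directions in one gadget; exactly one external would need three even strings that
share a bit; the other mixtures contain a triangle excluded by `not_internal_of_triangle`. -/
theorem internal_of_clique {x y a b : CFIVertex Γ} (hxy : AtTwo (cfiTwist Γ T) x y)
    (hxa : AtTwo (cfiTwist Γ T) x a) (hya : AtTwo (cfiTwist Γ T) y a)
    (hxb : AtTwo (cfiTwist Γ T) x b) (hyb : AtTwo (cfiTwist Γ T) y b)
    (hab : AtTwo (cfiTwist Γ T) a b) : x.Internal := by
  by_contra hx
  by_cases hy : y.Internal
  · have ha : a.Internal := by
      by_contra ha
      exact not_internal_of_triangle hΓ T hxa hxy hya.symm hx ha hy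
    have hb : b.Internal := by
      by_contra hb
      exact not_internal_of_triangle hΓ T hxb hxy hyb.symm hx hb hy
    rcases x with ⟨v, w, h, i⟩ | ⟨v, s, hs⟩
    · rcases y with ⟨v', w', h', i'⟩ | ⟨v₁, s₁, hs₁⟩
      · exact hy
      rcases a with ⟨v', w', h', i'⟩ | ⟨v₂, s₂, hs₂⟩
      · exact ha
      rcases b with ⟨v', w', h', i'⟩ | ⟨v₃, s₃, hs₃⟩
      · exact hb
      obtain rfl := far_eq_of_atTwo_ext_int T hxy
      obtain rfl := far_eq_of_atTwo_ext_int T hxa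
      obtain rfl := far_eq_of_atTwo_ext_int T hxb
      rw [atTwo_ext_int] at hxy hxa hxb
      rw [atTwo_int_int hΓ] at hya hyb hab
      have e : ∀ {b₁ b₂ b₃ : Bool} {P : Prop}, (b₁ = b₂ ↔ P) → (b₁ = b₃ ↔ P) → b₂ = b₃ := by
        intro b₁ b₂ b₃ P h1 h2
        by_cases hP : P <;> cases b₁ <;> cases b₂ <;> cases b₃ <;> simp_all
      rcases eq_of_even_of_eq_at (hΓ _) hs₁ hs₂ hs₃ (e hxy hxa) (e hxy hxb) with h | h | h
      · exact hya h
      · exact hyb h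
      · exact hab h
    · exact hx trivial
  · have ha := not_internal_of_triangle hΓ T hxy hxa hya hx hy
    have hb := not_internal_of_triangle hΓ T hxy hxb hyb hx hy
    rcases x with ⟨v, w, h, i⟩ | ⟨v, s, hs⟩
    · rcases y with ⟨v₁, w₁, h₁, i₁⟩ | ⟨v₁, s₁, hs₁⟩
      · rcases a with ⟨v₂, w₂, h₂, i₂⟩ | ⟨v₂, s₂, hs₂⟩
        · rcases b with ⟨v₃, w₃, h₃, i₃⟩ | ⟨v₃, s₃, hs₃⟩
          · rw [atTwo_ext_ext hΓ] at *
            obtain ⟨rfl, h01⟩ := hxy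
            obtain ⟨rfl, h02⟩ := hxa
            obtain ⟨rfl, h03⟩ := hxb
            obtain ⟨c, -, -, hcov⟩ := exists_third (hΓ v) (a := ⟨w, h⟩) (b := ⟨w₁, h₁⟩)
              (fun he => h01 (congrArg Subtype.val he))
            have h2 := hcov ⟨w₂, h₂⟩
            have h3 := hcov ⟨w₃, h₃⟩
            simp only [Subtype.ext_iff] at h2 h3
            have := hya.2
            have := hyb.2
            have := hab.2
            grind
          · exact hb trivial
        · exact ha trivial
      · exact hy trivial
    · exact hx trivial

theorem twin_iff {x y : CFIVertex Γ} : Twin (cfiTwist Γ T) x y ↔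
    x.Internal ∧ y.Internal ∧ x.base = y.base ∧ x ≠ y := by
  constructor
  · rintro ⟨hxy, a, ⟨hxa, hya⟩, b, hxb, hyb, hab⟩
    have hx := internal_of_clique hΓ T hxy hxa hya hxb hyb hab
    have hy := internal_of_clique hΓ T hxy.symm hya hxa hyb hxb hab
    refine ⟨hx, hy, ?_, hxy.1⟩
    rcases x with ⟨v, w, h, i⟩ | ⟨v, s, hs⟩
    · exact hx.elim
    rcases y with ⟨v₁, w₁, h₁, i₁⟩ | ⟨v₁, s₁, hs₁⟩
    · exact hy.elim
    exact base_eq_of_atTwo_int_int T hxy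
  · rintro ⟨hx, hy, hb, hne⟩
    rcases x with ⟨v, w, h, i⟩ | ⟨v, s, hs⟩
    · exact hx.elim
    rcases y with ⟨v₁, w₁, h₁, i₁⟩ | ⟨v₁, t, ht⟩
    · exact hy.elim
    obtain rfl : v = v₁ := hb
    have hst : s ≠ t := by rintro rfl; exact hne rfl
    have hfin : Finite (Γ.neighborSet v → Bool) := by
      have : Finite (Γ.neighborSet v) := Nat.finite_of_card_ne_zero (by rw [hΓ]; decide)
      infer_instance
    have := Fintype.ofFinite {s : Γ.neighborSet v → Bool // Even (Nat.card {w // s w = true})}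
    have hcard := card_even (hΓ v)
    rw [Nat.card_eq_fintype_card] at hcard
    classical
    -- There are four even strings; the two besides `s` and `t` complete the clique.
    have h2 : (Finset.univ \ {⟨s, hs⟩, ⟨t, ht⟩} : Finset {s : Γ.neighborSet v → Bool //
        Even (Nat.card {w // s w = true})}).card = 2 := by
      rw [Finset.card_sdiff_of_subset (Finset.subset_univ _), Finset.card_univ, hcard,
        Finset.card_pair (fun h => hst (congrArg Subtype.val h))]
    obtain ⟨⟨a, ha⟩, ⟨b, hb⟩, hab, heq⟩ := Finset.card_eq_two.1 h2
    have ha' : (⟨a, ha⟩ : {s : Γ.neighborSet v → Bool // Even (Nat.card {w // s w = true})}) ∈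
      (Finset.univ \ {⟨s, hs⟩, ⟨t, ht⟩} : Finset _) := by rw [heq]; simp
    have hb' : (⟨b, hb⟩ : {s : Γ.neighborSet v → Bool // Even (Nat.card {w // s w = true})}) ∈
      (Finset.univ \ {⟨s, hs⟩, ⟨t, ht⟩} : Finset _) := by rw [heq]; simp
    simp only [Finset.mem_sdiff, Finset.mem_univ, true_and, Finset.mem_insert,
      Finset.mem_singleton, not_or, Subtype.mk.injEq] at ha' hb'
    refine ⟨(atTwo_int_int hΓ T).2 hst, int v a ha,
      ⟨(atTwo_int_int hΓ T).2 (Ne.symm ha'.1), (atTwo_int_int hΓ T).2 (Ne.symm ha'.2)⟩,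
      int v b hb, (atTwo_int_int hΓ T).2 (Ne.symm hb'.1),
      (atTwo_int_int hΓ T).2 (Ne.symm hb'.2), (atTwo_int_int hΓ T).2 ?_⟩
    exact fun h => hab (Subtype.ext h)

theorem isInner_iff {x : CFIVertex Γ} : IsInner (cfiTwist Γ T) x ↔ x.Internal := by
  constructor
  · rintro ⟨y, hy⟩
    exact ((twin_iff hΓ T).1 hy).1
  · intro hx
    rcases x with ⟨v, w, h, i⟩ | ⟨v, s, hs⟩
    · exact hx.elim
    have hne : Nonempty (Γ.neighborSet v) := by
      by_contra h
      rw [not_nonempty_iff] at h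
      have := hΓ v
      simp at this
    obtain ⟨a⟩ := hne
    obtain ⟨b, hb⟩ := exists_ne_of_card_eq_three (hΓ v) a
    obtain ⟨t, ht, h1, -⟩ := exists_even (hΓ v) hb.symm (!s a) true
    refine ⟨int v t ht, (twin_iff hΓ T).2 ⟨trivial, trivial, rfl, ?_⟩⟩
    intro he
    cases he
    simp at h1

theorem sameGadget_iff {x y : CFIVertex Γ} (hx : x.Internal) :
    SameGadget (cfiTwist Γ T) x y ↔ y.Internal ∧ x.base = y.base := by
  rw [SameGadget, twin_iff hΓ T]
  by_cases h : x = y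
  · subst h; simp [hx]
  · simp [h, hx]

omit hΓ in
/-- The zero string has an even number of ones. -/
theorem even_zero (v : V) :
    Even (Nat.card {w : Γ.neighborSet v // (fun _ => false : Γ.neighborSet v → Bool) w = true}) := by
  simp

theorem exists_string {v w : V} (h : Γ.Adj v w) (b : Bool) :
    ∃ s : Γ.neighborSet v → Bool, Even (Nat.card {w // s w = true}) ∧ s ⟨w, h⟩ = b := by
  obtain ⟨c, hc⟩ := exists_ne_of_card_eq_three (hΓ v) ⟨w, h⟩
  obtain ⟨s, hs, h1, -⟩ := exists_even (hΓ v) hc.symm b b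
  exact ⟨s, hs, h1⟩

/-- A suitable walk of length three passes through the external vertices of both gadgets along one
edge, so it compares the two bits at that edge, up to the twist. -/
theorem matched_int_int {v w : V} {s hs t ht} :
    Matched (cfiTwist Γ T) (int v s hs) (int w t ht) ↔
      ∃ h : Γ.Adj v w, (s ⟨w, h⟩ = t ⟨v, h.symm⟩ ↔ s(v, w) ∉ T) := by
  constructor
  · rintro ⟨-, (⟨a, b, hab, c⟩ | ⟨a, r, hr⟩), h1, h2⟩
    · obtain ⟨rfl, h2⟩ := h2
      obtain rfl := far_eq_of_atTwo_ext_int T h1.symm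
      have h3 := (atTwo_ext_int T).1 h1.symm
      refine ⟨hab.symm, ?_⟩
      rw [Sym2.eq_swap, ← h3, ← h2]
      exact eq_comm
    · exact h2.elim
  · rintro ⟨h, h1⟩
    refine ⟨⟨(isInner_iff hΓ T).2 trivial, (isInner_iff hΓ T).2 trivial⟩,
      ext w v h.symm (t ⟨v, h.symm⟩), AtTwo.symm ((atTwo_ext_int T).2 ?_), adj_ext_int.2 rfl⟩
    rw [Sym2.eq_swap, ← h1]
    exact eq_comm

theorem baseAdj_iff {x y : CFIVertex Γ} : BaseAdj (cfiTwist Γ T) x y ↔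
    x.Internal ∧ y.Internal ∧ Γ.Adj x.base y.base := by
  constructor
  · rintro ⟨y', hyy, hxy⟩
    have hx := (isInner_iff hΓ T).1 hxy.1.1
    have hy' := (isInner_iff hΓ T).1 hxy.1.2
    have hy : y.Internal ∧ y.base = y'.base := by
      rcases hyy with rfl | h
      · exact ⟨hy', rfl⟩
      · have := (twin_iff hΓ T).1 h
        exact ⟨this.1, this.2.2.1⟩
    refine ⟨hx, hy.1, ?_⟩
    rw [hy.2]
    rcases x with ⟨v, w, h, i⟩ | ⟨v, s, hs⟩
    · exact hx.elim
    rcases y' with ⟨v₁, w₁, h₁, i₁⟩ | ⟨v₁, t, ht⟩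
    · exact hy'.elim
    exact ((matched_int_int hΓ T).1 hxy).1
  · rintro ⟨hx, hy, hadj⟩
    rcases x with ⟨v, w, h, i⟩ | ⟨v, s, hs⟩
    · exact hx.elim
    rcases y with ⟨v₁, w₁, h₁, i₁⟩ | ⟨w, t, ht⟩
    · exact hy.elim
    change Γ.Adj v w at hadj
    obtain ⟨b, hb⟩ := exists_adj_ext_ext T hadj (s ⟨w, hadj⟩)
    obtain ⟨t', ht', htb⟩ := exists_string hΓ hadj.symm b
    exact ⟨int w t' ht', (sameGadget_iff hΓ T (x := int w t ht) trivial).2 ⟨trivial, rfl⟩,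
      (matched_int_int hΓ T).2 ⟨hadj, by rw [htb]; exact adj_ext_ext.1 hb⟩⟩

theorem near_iff {z x : CFIVertex Γ} : Near (cfiTwist Γ T) z x ↔
    ¬ z.Internal ∧ x.Internal ∧ z.base = x.base := by
  rw [Near, isInner_iff hΓ, isInner_iff hΓ]
  constructor
  · rintro ⟨⟨hz, hx⟩, x', hxx, hadj⟩
    rw [sameGadget_iff hΓ T hx] at hxx
    refine ⟨hz, hx, ?_⟩
    rw [hxx.2]
    rcases z with ⟨v, w, h, i⟩ | ⟨v, s, hs⟩
    · rcases x' with ⟨v₁, w₁, h₁, i₁⟩ | ⟨v₁, t, ht⟩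
      · exact hxx.1.elim
      exact hadj.1
    · exact (hz trivial).elim
  · rintro ⟨hz, hx, hb⟩
    refine ⟨⟨hz, hx⟩, ?_⟩
    rcases z with ⟨v, w, h, i⟩ | ⟨v, s, hs⟩
    · obtain ⟨s, hs, h1⟩ := exists_string hΓ h i
      exact ⟨int v s hs, (sameGadget_iff hΓ T hx).2 ⟨trivial, hb.symm⟩, adj_ext_int.2 h1⟩
    · exact (hz trivial).elim

theorem far_iff {z x : CFIVertex Γ} : Far (cfiTwist Γ T) z x ↔
    ¬ z.Internal ∧ x.Internal ∧ z.far = x.base := by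
  rw [Far, isInner_iff hΓ, isInner_iff hΓ]
  constructor
  · rintro ⟨⟨hz, hx⟩, x', hxx, hadj⟩
    rw [sameGadget_iff hΓ T hx] at hxx
    refine ⟨hz, hx, ?_⟩
    rw [hxx.2]
    rcases z with ⟨v, w, h, i⟩ | ⟨v, s, hs⟩
    · rcases x' with ⟨v₁, w₁, h₁, i₁⟩ | ⟨v₁, t, ht⟩
      · exact hxx.1.elim
      exact far_eq_of_atTwo_ext_int T hadj
    · exact (hz trivial).elim
  · rintro ⟨hz, hx, hb⟩
    refine ⟨⟨hz, hx⟩, ?_⟩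
    rcases z with ⟨v, w, h, i⟩ | ⟨v, s, hs⟩
    · obtain ⟨b, hb'⟩ := exists_adj_ext_ext T h i
      obtain ⟨s, hs, h1⟩ := exists_string hΓ h.symm b
      exact ⟨int w s hs, (sameGadget_iff hΓ T hx).2 ⟨trivial, hb.symm⟩,
        (atTwo_ext_int T).2 (by rw [h1]; exact adj_ext_ext.1 hb')⟩
    · exact (hz trivial).elim

/-! ### Sparsity of CFI graphs -/

omit hΓ in
theorem not_adj_of_internal {x y : CFIVertex Γ} (hx : x.Internal) (hy : y.Internal) :
    ¬ (cfiTwist Γ T).Adj x y := by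
  rcases x with ⟨v, w, h, i⟩ | ⟨v, s, hs⟩
  · exact hx.elim
  rcases y with ⟨v₁, w₁, h₁, i₁⟩ | ⟨v₁, t, ht⟩
  · exact hy.elim
  exact id

omit hΓ in
theorem base_eq_of_adj {x y : CFIVertex Γ} (hx : ¬ x.Internal) (hy : y.Internal)
    (h : (cfiTwist Γ T).Adj x y) : x.base = y.base := by
  rcases x with ⟨v, w, h', i⟩ | ⟨v, s, hs⟩
  · rcases y with ⟨v₁, w₁, h₁, i₁⟩ | ⟨v₁, t, ht⟩
    · exact hy.elim
    exact h.1
  · exact (hx trivial).elim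

omit hΓ in
theorem base_eq_far_of_adj {x y : CFIVertex Γ} (hx : ¬ x.Internal) (hy : ¬ y.Internal)
    (h : (cfiTwist Γ T).Adj x y) : y.base = x.far ∧ y.far = x.base := by
  rcases x with ⟨v, w, h', i⟩ | ⟨v, s, hs⟩
  · rcases y with ⟨v₁, w₁, h₁, i₁⟩ | ⟨v₁, t, ht⟩
    · exact ⟨h.1, h.2.1⟩
    exact (hy trivial).elim
  · exact (hx trivial).elim

omit hΓ in
theorem adj_base_far {x : CFIVertex Γ} (hx : ¬ x.Internal) : Γ.Adj x.base x.far := by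
  rcases x with ⟨v, w, h', i⟩ | ⟨v, s, hs⟩
  · exact h'
  · exact (hx trivial).elim

omit hΓ in
/-- The external neighbour of an external vertex is unique. -/
theorem eq_of_adj_external {x y z : CFIVertex Γ} (hx : ¬ x.Internal) (hy : ¬ y.Internal)
    (hz : ¬ z.Internal) (hxy : (cfiTwist Γ T).Adj x y) (hxz : (cfiTwist Γ T).Adj x z) :
    y = z := by
  rcases x with ⟨v, w, h', i⟩ | ⟨v, s, hs⟩
  · rcases y with ⟨v₁, w₁, h₁, i₁⟩ | ⟨v₁, t, ht⟩
    · rcases z with ⟨v₂, w₂, h₂, i₂⟩ | ⟨v₂, t, ht⟩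
      · obtain ⟨rfl, rfl, h1⟩ := hxy
        obtain ⟨rfl, rfl, h2⟩ := hxz
        congr 1
        by_cases hT : s(w₂, v₂) ∈ T <;> cases i <;> cases i₁ <;> cases i₂ <;> simp_all
      · exact (hz trivial).elim
    · exact (hy trivial).elim
  · exact (hx trivial).elim

omit hΓ in
/-- An internal vertex has at most one neighbour in each direction. -/
theorem eq_of_adj_internal {x y z : CFIVertex Γ} (hx : x.Internal)
    (hxy : (cfiTwist Γ T).Adj x y) (hxz : (cfiTwist Γ T).Adj x z) (h : y.far = z.far) :
    y = z := by
  rcases x with ⟨v, w, h', i⟩ | ⟨v, s, hs⟩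
  · exact hx.elim
  rcases y with ⟨v₁, w₁, h₁, i₁⟩ | ⟨v₁, t, ht⟩
  · rcases z with ⟨v₂, w₂, h₂, i₂⟩ | ⟨v₂, t, ht⟩
    · obtain ⟨rfl, h1⟩ := hxy
      obtain ⟨rfl, h2⟩ := hxz
      obtain rfl : w₁ = w₂ := h
      rw [← h1, ← h2]
    · exact hxz.elim
  · exact hxy.elim

/-- Twins have at most one common neighbour. -/
theorem eq_of_adj_twins {x x' y z : CFIVertex Γ} (hx : x.Internal) (hx' : x'.Internal)
    (hne : x ≠ x') (hxy : (cfiTwist Γ T).Adj x y) (hxy' : (cfiTwist Γ T).Adj x' y)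
    (hxz : (cfiTwist Γ T).Adj x z) (hxz' : (cfiTwist Γ T).Adj x' z) : y = z := by
  rcases x with ⟨v, w, h', i⟩ | ⟨v, s, hs⟩
  · exact hx.elim
  rcases x' with ⟨v, w, h', i⟩ | ⟨v', s', hs'⟩
  · exact hx'.elim
  rcases y with ⟨v₁, w₁, h₁, i₁⟩ | ⟨v₁, t, ht⟩
  · rcases z with ⟨v₂, w₂, h₂, i₂⟩ | ⟨v₂, t, ht⟩
    · obtain ⟨rfl, h1⟩ := hxy
      obtain ⟨rfl, h2⟩ := hxz
      obtain ⟨rfl, h3⟩ := hxy'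
      obtain ⟨_, h4⟩ := hxz'
      by_cases hw : w₁ = w₂
      · subst hw; rw [← h1, ← h2]
      · refine absurd ?_ hne
        have := even_ext (hΓ _) (a := ⟨w₁, h₁⟩) (b := ⟨w₂, h₂⟩)
          (fun h => hw (congrArg Subtype.val h)) hs hs' (h1.trans h3.symm) (h2.trans h4.symm)
        subst this
        rfl
    · exact hxz.elim
  · exact hxy.elim

/-- Two strings of a gadget that agree twice are equal, and external vertices have one external
neighbour; this excludes 4-cycles. A triangle would have an edge between internal vertices, or lead
to a gadget that is adjacent to itself in `Γ`. -/
theorem isSparse : IsSparse (cfiTwist Γ T) where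
  eq_of_adj := by
    intro x x' y z hne hxy hxy' hxz hxz'
    by_cases hx : x.Internal
    · by_cases hx' : x'.Internal
      · exact eq_of_adj_twins hΓ T hx hx' hne hxy hxy' hxz hxz'
      · exact eq_of_adj_external T hx' (fun h => not_adj_of_internal T hx h hxy)
          (fun h => not_adj_of_internal T hx h hxz) hxy' hxz'
    · by_cases hx' : x'.Internal
      · exact eq_of_adj_external T hx (fun h => not_adj_of_internal T hx' h hxy')
          (fun h => not_adj_of_internal T hx' h hxz') hxy hxz
      · by_contra hyz
        have key : ∀ {y}, (cfiTwist Γ T).Adj x y → (cfiTwist Γ T).Adj x' y → y.Internal := by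
          intro y h h'
          by_contra hy
          exact hne (eq_of_adj_external T hy hx hx' h.symm h'.symm)
        have hy := key hxy hxy'
        have hz := key hxz hxz'
        exact hne (eq_of_adj_twins hΓ T hy hz hyz hxy.symm hxz.symm hxy'.symm hxz'.symm)
  not_adj := by
    intro x y z hxy hyz hxz
    have key : ∀ {x y z}, (cfiTwist Γ T).Adj x y → (cfiTwist Γ T).Adj y z →
        (cfiTwist Γ T).Adj x z → ¬ x.Internal := by
      intro x y z hxy hyz hxz hx
      have hy : ¬ y.Internal := fun h => not_adj_of_internal T hx h hxy
      have hz : ¬ z.Internal := fun h => not_adj_of_internal T hx h hxz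
      have h1 := base_eq_of_adj T hy hx hxy.symm
      have h2 := base_eq_of_adj T hz hx hxz.symm
      have h3 := base_eq_far_of_adj T hy hz hyz
      exact (adj_base_far hy).ne (h1.trans (h2.symm.trans h3.1))
    have hx := key hxy hyz hxz
    have hy := key hyz hxz.symm hxy.symm
    have hz := key hxz.symm hxy hyz.symm
    have h1 := base_eq_far_of_adj T hx hy hxy
    have h2 := base_eq_far_of_adj T hx hz hxz
    have h3 := base_eq_far_of_adj T hy hz hyz
    exact (adj_base_far hx).ne (by rw [← h1.2, ← h3.1, h2.1])
  exists_two := by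
    rintro (⟨v, w, h, i⟩ | ⟨v, s, hs⟩)
    · obtain ⟨c, hc⟩ := exists_ne_of_card_eq_three (hΓ v) ⟨w, h⟩
      obtain ⟨s, hs, h1, h2⟩ := exists_even (hΓ v) hc.symm i true
      obtain ⟨t, ht, h3, h4⟩ := exists_even (hΓ v) hc.symm i false
      refine ⟨int v s hs, int v t ht, ?_, adj_ext_int.2 h1, adj_ext_int.2 h3⟩
      intro he
      cases he
      rw [h2] at h4
      exact absurd h4 (by decide)
    · have hne : Nonempty (Γ.neighborSet v) := by
        by_contra h
        rw [not_nonempty_iff] at h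
        have := hΓ v
        simp at this
      obtain ⟨a⟩ := hne
      obtain ⟨b, hb⟩ := exists_ne_of_card_eq_three (hΓ v) a
      refine ⟨ext v a a.2 _, ext v b b.2 _, ?_, adj_int_ext.2 rfl, adj_int_ext.2 rfl⟩
      intro he
      injection he with _ he
      exact hb (Subtype.ext he.symm)

omit hΓ in
instance [Finite V] : Finite (CFIVertex Γ) := by
  let F : CFIVertex Γ → (V × V × Bool) ⊕ (Σ v, Γ.neighborSet v → Bool) := fun x =>
    match x with
    | ext v w _ b => Sum.inl (v, w, b)
    | int v s _ => Sum.inr ⟨v, s⟩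
  refine Finite.of_injective F ?_
  rintro (⟨v, w, h, i⟩ | ⟨v, s, hs⟩) (⟨v₁, w₁, h₁, i₁⟩ | ⟨v₁, t, ht⟩) he
  · simp only [F, Sum.inl.injEq, Prod.mk.injEq] at he
    obtain ⟨rfl, rfl, rfl⟩ := he
    rfl
  · exact Sum.inl_ne_inr he |>.elim
  · exact Sum.inr_ne_inl he |>.elim
  · simp only [F, Sum.inr.injEq, Sigma.mk.injEq] at he
    obtain ⟨rfl, he⟩ := he
    obtain rfl := eq_of_heq he
    rfl

end CFIVertex

/-! ### Recognition of CFI graphs -/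

/-- The graph `Δ` looks like a CFI graph over `Γ`, where `inn` are the internal vertices, `γ` maps
a vertex to its gadget, and `δ` maps an external vertex to the gadget that it is directed to. -/
structure IsCFILike {V W : Type*} (Γ : SimpleGraph V) (Δ : SimpleGraph W) (inn : W → Prop)
    (γ δ : W → V) : Prop where
  not_adj : ∀ {x y}, inn x → inn y → ¬ Δ.Adj x y
  exists_outer : ∀ {z}, ¬ inn z → ∃ z', ¬ inn z' ∧ Δ.Adj z z'
  outer_unique : ∀ {x y z}, ¬ inn x → ¬ inn y → ¬ inn z → Δ.Adj x y → Δ.Adj x z → y = z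
  base_eq : ∀ {z x}, ¬ inn z → inn x → Δ.Adj z x → γ z = γ x
  base_adj : ∀ {z}, ¬ inn z → Γ.Adj (γ z) (δ z)
  far_eq : ∀ {z z'}, ¬ inn z → ¬ inn z' → Δ.Adj z z' → γ z' = δ z
  exists_dir : ∀ {x w}, inn x → Γ.Adj (γ x) w → ∃ z, Δ.Adj x z ∧ δ z = w
  dir_unique : ∀ {x y z}, inn x → Δ.Adj x y → Δ.Adj x z → δ y = δ z → y = z
  outer_eq : ∀ {o y z}, inn o → ¬ inn y → ¬ inn z → γ y = γ o → γ z = γ o → δ y = δ z →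
    ¬ Δ.Adj y o → ¬ Δ.Adj z o → y = z
  exists_common : ∀ {x y}, inn x → inn y → x ≠ y → γ x = γ y → ∃ z, Δ.Adj x z ∧ Δ.Adj y z
  common_unique : ∀ {x y z z'}, inn x → inn y → x ≠ y → Δ.Adj x z → Δ.Adj y z → Δ.Adj x z' →
    Δ.Adj y z' → z' = z
  exists_inner : ∀ v, ∃ x, inn x ∧ γ x = v

namespace IsCFILike

variable {V : Type u} {W : Type*} {Γ : SimpleGraph V} {Δ : SimpleGraph W} {inn : W → Prop}
  {γ δ : W → V}

/-- The choice of an internal vertex in every gadget. -/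
noncomputable def origin (h : IsCFILike Γ Δ inn γ δ) (v : V) : W := (h.exists_inner v).choose

theorem inn_origin (h : IsCFILike Γ Δ inn γ δ) (v : V) : inn (h.origin v) :=
  (h.exists_inner v).choose_spec.1

theorem base_origin (h : IsCFILike Γ Δ inn γ δ) (v : V) : γ (h.origin v) = v :=
  (h.exists_inner v).choose_spec.2

open Classical in
/-- The label of an external vertex. -/
noncomputable def bit (h : IsCFILike Γ Δ inn γ δ) (z : W) : Bool :=
  decide (¬ Δ.Adj z (h.origin (γ z)))

open Classical in
/-- The string of an internal vertex. -/
noncomputable def str (h : IsCFILike Γ Δ inn γ δ) (x : W) : Γ.neighborSet (γ x) → Bool :=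
  fun w => decide (∃ z, Δ.Adj x z ∧ δ z = w ∧ h.bit z = true)

variable (h : IsCFILike Γ Δ inn γ δ)

include h

/-- In a given direction at most one external vertex of a gadget is adjacent to the origin and at
most one is not. -/
theorem eq_of_bit_eq {y z : W} (hy : ¬ inn y) (hz : ¬ inn z) (h1 : γ y = γ z) (h2 : δ y = δ z)
    (h3 : h.bit y = h.bit z) : y = z := by
  by_cases hb : Δ.Adj z (h.origin (γ z))
  · have hb' : Δ.Adj y (h.origin (γ z)) := by simpa [bit, hb, h1] using h3
    exact h.dir_unique (h.inn_origin _) hb'.symm hb.symm h2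
  · have hb' : ¬ Δ.Adj y (h.origin (γ z)) := by simpa [bit, hb, h1] using h3
    exact h.outer_eq (h.inn_origin _) hy hz (h1.trans (h.base_origin _).symm)
      (h.base_origin _).symm h2 hb' hb

theorem not_inn_of_adj {x y : W} (hx : inn x) (hxy : Δ.Adj x y) : ¬ inn y :=
  fun hy => h.not_adj hx hy hxy

theorem str_apply {x y : W} (hx : inn x) (hxy : Δ.Adj x y) (hadj : Γ.Adj (γ x) (δ y)) :
    h.str x ⟨δ y, hadj⟩ = h.bit y := by
  classical
  unfold str
  cases hb : h.bit y
  · rw [decide_eq_false_iff_not]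
    rintro ⟨z, hz, hzy, hzb⟩
    rw [h.dir_unique hx hz hxy hzy, hb] at hzb
    exact absurd hzb (by decide)
  · rw [decide_eq_true_iff]
    exact ⟨y, hxy, rfl, hb⟩

/-- The origin gets the zero string. Any other internal vertex shares exactly one neighbour with the
origin, so exactly two of its three bits are one. -/
theorem even_str (hΓ : ∀ v, Nat.card (Γ.neighborSet v) = 3) {x : W} (hx : inn x) :
    Even (Nat.card {w // h.str x w = true}) := by
  classical
  have key : ∀ z, Δ.Adj x z → γ z = γ x := fun z hz =>
    h.base_eq (h.not_inn_of_adj hx hz) hx hz.symm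
  by_cases hxo : x = h.origin (γ x)
  · have : h.str x = fun _ => false := by
      funext w
      rw [str, decide_eq_false_iff_not]
      rintro ⟨z, hz, -, hb⟩
      rw [bit, decide_eq_true_iff, key z hz, ← hxo] at hb
      exact hb hz.symm
    rw [this]
    simp
  · obtain ⟨z, hz, hz'⟩ := h.exists_common hx (h.inn_origin (γ x)) hxo (h.base_origin _).symm
    have hzo := h.not_inn_of_adj hx hz
    have hzadj : Γ.Adj (γ x) (δ z) := key z hz ▸ h.base_adj hzo
    obtain ⟨b, hb⟩ := exists_ne_of_card_eq_three (hΓ (γ x)) ⟨δ z, hzadj⟩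
    obtain ⟨c, hca, hcb, hcov⟩ := exists_third (hΓ (γ x)) hb.symm
    rw [even_card_iff (hΓ _) hb.symm hca hcb hcov]
    have h1 : h.str x ⟨δ z, hzadj⟩ = false := by
      rw [h.str_apply hx hz, bit, decide_eq_false_iff_not, not_not, key z hz]
      exact hz'.symm
    have h2 : ∀ d : Γ.neighborSet (γ x), d ≠ ⟨δ z, hzadj⟩ → h.str x d = true := by
      intro d hd
      obtain ⟨y, hy, hyd⟩ := h.exists_dir hx d.2
      have := h.str_apply hx hy (hyd ▸ d.2)
      have hd' : (⟨δ y, hyd ▸ d.2⟩ : Γ.neighborSet (γ x)) = d := Subtype.ext hyd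
      rw [hd'] at this
      rw [this, bit, decide_eq_true_iff, key y hy]
      intro hyo
      exact hd (Subtype.ext (by
        rw [← hyd, h.common_unique hx (h.inn_origin _) hxo hz hz' hy hyo.symm]))
    rw [h1, h2 b hb, h2 c hca]
    rfl

/-- The twisted edges. -/
def twists : Set (Sym2 V) :=
  {t | ∃ z z', ¬ inn z ∧ ¬ inn z' ∧ Δ.Adj z z' ∧ t = s(γ z, δ z) ∧ h.bit z ≠ h.bit z'}

/-- The set of twists records one bad pair per edge. This is unambiguous: if one of the two parallel
external edges preserves the bit, so does the other, because each end is determined by its bit. -/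
theorem bit_eq_iff {z z' : W} (hz : ¬ inn z) (hz' : ¬ inn z') (hadj : Δ.Adj z z') :
    h.bit z = h.bit z' ↔ s(γ z, δ z) ∉ h.twists := by
  constructor
  · rintro hb ⟨y, y', hy, hy', hyy, heq, hne⟩
    have key : ∀ {y y'}, ¬ inn y → ¬ inn y' → Δ.Adj y y' → γ z = γ y → δ z = δ y →
        h.bit y ≠ h.bit y' → False := by
      intro y y' hy hy' hyy h1 h2 hne
      by_cases hyz : h.bit y = h.bit z
      · obtain rfl := h.eq_of_bit_eq hy hz h1.symm h2.symm hyz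
        obtain rfl := h.outer_unique hy hy' hz' hyy hadj
        exact hne hb
      · have hb' : h.bit y' = h.bit z' := by
          revert hyz hne hb
          cases h.bit y <;> cases h.bit y' <;> cases h.bit z <;> cases h.bit z' <;> simp
        have hg : γ y' = γ z' := by rw [h.far_eq hy hy' hyy, h.far_eq hz hz' hadj, h2]
        have hd : δ y' = δ z' := by
          rw [← h.far_eq hy' hy hyy.symm, ← h.far_eq hz' hz hadj.symm, h1]
        obtain rfl := h.eq_of_bit_eq hy' hz' hg hd hb'
        obtain rfl := h.outer_unique hy' hy hz hyy.symm hadj.symm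
        exact hyz rfl
    rw [Sym2.eq_iff] at heq
    rcases heq with ⟨h1, h2⟩ | ⟨h1, h2⟩
    · exact key hy hy' hyy h1 h2 hne
    · exact key hy' hy hyy.symm (h1.trans (h.far_eq hy hy' hyy).symm)
        (h2.trans (h.far_eq hy' hy hyy.symm)) hne.symm
  · intro hT
    by_contra hne
    exact hT ⟨z, z', hz, hz', hadj, rfl, hne⟩

theorem exists_iso [Finite W] [Finite V] (hΓ : ∀ v, Nat.card (Γ.neighborSet v) = 3)
    (hcard : Nat.card W = Nat.card (CFIVertex Γ)) :
    ∃ T : Set (Sym2 V), T ⊆ Γ.edgeSet ∧ Nonempty (Δ ≃g cfiTwist Γ T) := by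
  classical
  let F : W → CFIVertex Γ := fun x =>
    if hx : inn x then .int (γ x) (h.str x) (h.even_str hΓ hx)
    else .ext (γ x) (δ x) (h.base_adj hx) (h.bit x)
  have hFi : ∀ x (hx : inn x), F x = .int (γ x) (h.str x) (h.even_str hΓ hx) :=
    fun x hx => dif_pos hx
  have hFe : ∀ x (hx : ¬ inn x), F x = .ext (γ x) (δ x) (h.base_adj hx) (h.bit x) :=
    fun x hx => dif_neg hx
  -- Internal vertices with equal strings in one gadget would share a neighbour in every direction,
  -- whereas distinct ones share at most one. Surjectivity then follows from the cardinalities.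
  have hinj : Function.Injective F := by
    intro x y hxy
    by_cases hx : inn x <;> by_cases hy : inn y
    · rw [hFi x hx, hFi y hy] at hxy
      have key : ∀ {v v' s s' hs hs'}, (CFIVertex.int v s hs : CFIVertex Γ) = .int v' s' hs' →
          v = v' ∧ ∀ w a a', s ⟨w, a⟩ = s' ⟨w, a'⟩ := by
        intro v v' s s' hs hs' he
        cases he
        exact ⟨rfl, fun _ _ _ => rfl⟩
      obtain ⟨hg, hs⟩ := key hxy
      by_contra hne
      have hall : ∀ w, Γ.Adj (γ x) w → ∃ z, δ z = w ∧ Δ.Adj x z ∧ Δ.Adj y z := by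
        intro w hw
        obtain ⟨z, hz, rfl⟩ := h.exists_dir hx hw
        obtain ⟨z', hz', hzz⟩ := h.exists_dir hy (hg ▸ hw)
        have h1 := h.str_apply hx hz hw
        have h2 := h.str_apply hy hz' (hzz ▸ hg ▸ hw)
        have h3 := hs (δ z) hw (hg ▸ hw)
        have hb : h.bit z = h.bit z' := by
          rw [← h1, ← h2, h3]
          congr 1
          exact Subtype.ext hzz.symm
        have hz1 := h.not_inn_of_adj hx hz
        have hz2 := h.not_inn_of_adj hy hz'
        have := h.eq_of_bit_eq hz1 hz2 (by
          rw [h.base_eq hz1 hx hz.symm, h.base_eq hz2 hy hz'.symm, hg]) hzz.symm hb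
        exact ⟨z, rfl, hz, this ▸ hz'⟩
      have hne' : Nonempty (Γ.neighborSet (γ x)) := by
        by_contra hn
        rw [not_nonempty_iff] at hn
        have := hΓ (γ x)
        simp at this
      obtain ⟨a⟩ := hne'
      obtain ⟨b, hb⟩ := exists_ne_of_card_eq_three (hΓ (γ x)) a
      obtain ⟨z, hza, hz, hz'⟩ := hall a a.2
      obtain ⟨w, hwb, hw, hw'⟩ := hall b b.2
      have := h.common_unique hx hy hne hz hz' hw hw'
      exact hb (Subtype.ext (by rw [← hza, ← hwb, this]))
    · rw [hFi x hx, hFe y hy] at hxy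
      cases hxy
    · rw [hFe x hx, hFi y hy] at hxy
      cases hxy
    · rw [hFe x hx, hFe y hy] at hxy
      injection hxy with h1 h2 h3
      exact h.eq_of_bit_eq hx hy h1 h2 h3
  have hbij : Function.Bijective F := (Nat.bijective_iff_injective_and_card F).2 ⟨hinj, hcard⟩
  have hint : ∀ x z, inn x → ¬ inn z →
      ((cfiTwist Γ h.twists).Adj (F z) (F x) ↔ Δ.Adj z x) := by
    intro x z hx hz
    rw [hFi x hx, hFe z hz]
    constructor
    · rintro ⟨hv, hs⟩
      have hadj : Γ.Adj (γ x) (δ z) := hv ▸ h.base_adj hz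
      obtain ⟨y, hy, hyz⟩ := h.exists_dir hx hadj
      have h1 := h.str_apply hx hy (hyz ▸ hadj)
      have hyo := h.not_inn_of_adj hx hy
      have : y = z := h.eq_of_bit_eq hyo hz ((h.base_eq hyo hx hy.symm).trans hv.symm) hyz (by
        rw [← h1, ← hs]
        congr 1
        exact Subtype.ext hyz)
      exact this ▸ hy.symm
    · intro hzx
      exact ⟨h.base_eq hz hx hzx, h.str_apply hx hzx.symm _⟩
  refine ⟨h.twists, ?_, ⟨⟨Equiv.ofBijective F hbij, ?_⟩⟩⟩
  · rintro _ ⟨z, z', hz, -, -, rfl, -⟩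
    exact h.base_adj hz
  · intro x y
    change (cfiTwist Γ h.twists).Adj (F x) (F y) ↔ Δ.Adj x y
    by_cases hx : inn x <;> by_cases hy : inn y
    · rw [hFi x hx, hFi y hy]
      exact ⟨False.elim, fun hxy => h.not_adj hx hy hxy⟩
    · rw [SimpleGraph.adj_comm, hint x y hx hy, SimpleGraph.adj_comm]
    · exact hint y x hy hx
    · rw [hFe x hx, hFe y hy]
      constructor
      · rintro ⟨h1, h2, h3⟩
        -- The external neighbour of `x` has the same gadget, direction and bit as `y`, so it is
        -- `y`.
        obtain ⟨z, hz, hxz⟩ := h.exists_outer hx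
        have h4 := h.bit_eq_iff hx hz hxz
        have hb : h.bit z = h.bit y := by
          have := h3.trans h4.symm
          revert this
          cases h.bit x <;> cases h.bit y <;> cases h.bit z <;> simp
        have : z = y := h.eq_of_bit_eq hz hy ((h.far_eq hx hz hxz).trans h1.symm)
          ((h.far_eq hz hx hxz.symm).symm.trans h2.symm) hb
        exact this ▸ hxz
      · intro hxy
        exact ⟨h.far_eq hx hy hxy, (h.far_eq hy hx hxy.symm).symm, h.bit_eq_iff hx hy hxy⟩

end IsCFILike

/-! ### Transfer of the relations along back-and-forth systems -/

/-- Two outer vertices are directed to the same gadget. -/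
def SameFar {V : Type*} (Γ : SimpleGraph V) (y z : V) : Prop := ∃ t, Far Γ y t ∧ Far Γ z t

/-- The vertex has a neighbour that is directed to the gadget of `y`. -/
def HasDir {V : Type*} (Γ : SimpleGraph V) (x y : V) : Prop := ∃ z, Γ.Adj x z ∧ Far Γ z y

/-- The vertices `x` and `y` have a common neighbour different from `z`. -/
def OtherCommon {V : Type*} (Γ : SimpleGraph V) (x y z : V) : Prop :=
  ∃ w, Γ.Adj x w ∧ Γ.Adj y w ∧ w ≠ z

/-- Sentences in three variables that hold in CFI graphs. -/
structure IsGadgetGraph {V : Type*} (Γ : SimpleGraph V) : Prop where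
  same_symm : ∀ x y, SameGadget Γ x y → SameGadget Γ y x
  same_trans : ∀ x y z, SameGadget Γ x y → SameGadget Γ y z → SameGadget Γ x z
  isInner_of_same : ∀ x y, SameGadget Γ x y → IsInner Γ x → IsInner Γ y
  base_symm : ∀ x y, BaseAdj Γ x y → BaseAdj Γ y x
  base_not_same : ∀ x y, BaseAdj Γ x y → ¬ SameGadget Γ x y
  base_congr : ∀ x y z, SameGadget Γ y z → BaseAdj Γ x y → BaseAdj Γ x z
  exists_near : ∀ z, ¬ IsInner Γ z → ∃ x, Near Γ z x
  exists_far : ∀ z, ¬ IsInner Γ z → ∃ x, Far Γ z x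
  near_same : ∀ z x y, Near Γ z x → Near Γ z y → SameGadget Γ x y
  near_congr : ∀ z x y, Near Γ z x → SameGadget Γ x y → Near Γ z y
  far_same : ∀ z x y, Far Γ z x → Far Γ z y → SameGadget Γ x y
  far_congr : ∀ z x y, Far Γ z x → SameGadget Γ x y → Far Γ z y
  not_adj : ∀ x y, IsInner Γ x → IsInner Γ y → ¬ Γ.Adj x y
  exists_outer : ∀ z, ¬ IsInner Γ z → ∃ z', ¬ IsInner Γ z' ∧ Γ.Adj z z'
  outer_unique : ∀ x y z, ¬ IsInner Γ x → ¬ IsInner Γ y → ¬ IsInner Γ z → Γ.Adj x y →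
    Γ.Adj x z → y = z
  near_of_adj : ∀ z x, ¬ IsInner Γ z → IsInner Γ x → Γ.Adj z x → Near Γ z x
  base_of_near_far : ∀ z x y, Near Γ z x → Far Γ z y → BaseAdj Γ x y
  near_of_adj_of_far : ∀ z z' x, ¬ IsInner Γ z' → Γ.Adj z z' → Far Γ z x → Near Γ z' x
  exists_dir : ∀ x y, BaseAdj Γ x y → HasDir Γ x y
  dir_unique : ∀ x y z, IsInner Γ x → Γ.Adj x y → Γ.Adj x z → SameFar Γ y z → y = z
  outer_eq : ∀ o y z, Near Γ y o → Near Γ z o → SameFar Γ y z → ¬ Γ.Adj y o → ¬ Γ.Adj z o →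
    y = z
  common_unique : ∀ x y z, IsInner Γ x → SameGadget Γ x y → x ≠ y → Γ.Adj x z → Γ.Adj y z →
    ¬ OtherCommon Γ x y z

namespace IsBackForth

variable {X Y : Type*} {R : (Fin 3 → X) → (Fin 3 → Y) → Prop} {Γ : SimpleGraph X}
  {Δ : SimpleGraph Y} (hR : IsBackForth R) (h0 : ∀ g h, R g h → graphType Γ g = graphType Δ h)

include h0

omit hR in
theorem inv₂_vertex_eq : Inv₂ R (fun x y => x = y) (fun x y => x = y) := fun g h hgh i j =>
  iff_of_eq (congrArg Prod.fst (congrFun (congrFun (h0 g h hgh) i) j))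

omit hR in
theorem inv₂_adj : Inv₂ R Γ.Adj Δ.Adj := fun g h hgh i j =>
  iff_of_eq (congrArg Prod.snd (congrFun (congrFun (h0 g h hgh) i) j))

include hR

theorem inv₂_atTwo : Inv₂ R (AtTwo Γ) (AtTwo Δ) := by
  have h1 : Inv₃ R (fun x y z => Γ.Adj x z ∧ Γ.Adj z y) (fun x y z => Δ.Adj x z ∧ Δ.Adj z y) :=
    fun g h hgh i j k => and_congr (inv₂_adj h0 g h hgh i k) (inv₂_adj h0 g h hgh k j)
  exact fun g h hgh i j => and_congr (not_congr (inv₂_vertex_eq h0 g h hgh i j))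
    (hR.inv₂_ex h1 g h hgh i j)

theorem inv₂_twin : Inv₂ R (Twin Γ) (Twin Δ) := by
  have h1 := hR.inv₂_atTwo h0
  have h2 : Inv₃ R (fun x _ w => AtTwo Γ x w) (fun x _ w => AtTwo Δ x w) :=
    fun g h hgh i j k => h1 g h hgh i k
  have h3 : Inv₃ R (fun x y a => (AtTwo Γ x a ∧ AtTwo Γ y a) ∧
      ∃ b, AtTwo Γ x b ∧ AtTwo Γ y b ∧ AtTwo Γ a b)
      (fun x y a => (AtTwo Δ x a ∧ AtTwo Δ y a) ∧
      ∃ b, AtTwo Δ x b ∧ AtTwo Δ y b ∧ AtTwo Δ a b) := fun g h hgh i j k => by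
    refine and_congr (and_congr (h1 g h hgh i k) (h1 g h hgh j k)) ?_
    -- The clause has four variables `x`, `y`, `a`, `b`, but each conjunct joins `b` to only one of
    -- the others.
    have := hR.inv₃_ex (A := fun x _ w => AtTwo Γ x w) (A' := fun x _ w => AtTwo Δ x w)
      (B := fun y _ w => AtTwo Γ y w) (B' := fun y _ w => AtTwo Δ y w)
      (C := fun _ z w => AtTwo Γ z w) (C' := fun _ z w => AtTwo Δ z w)
      h2 h2 (fun g h hgh i j k => h1 g h hgh j k) g h hgh i j k
    exact this
  exact fun g h hgh i j => and_congr (h1 g h hgh i j) (hR.inv₂_ex h3 g h hgh i j)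

theorem inv₁_isInner : Inv₁ R (IsInner Γ) (IsInner Δ) := hR.inv₁_ex (hR.inv₂_twin h0)

theorem inv₂_sameGadget : Inv₂ R (SameGadget Γ) (SameGadget Δ) := fun g h hgh i j =>
  or_congr (inv₂_vertex_eq h0 g h hgh i j) (hR.inv₂_twin h0 g h hgh i j)

theorem inv₂_matched : Inv₂ R (Matched Γ) (Matched Δ) := by
  have h1 := hR.inv₁_isInner h0
  have h2 : Inv₃ R (fun x y z => AtTwo Γ x z ∧ Γ.Adj z y) (fun x y z => AtTwo Δ x z ∧ Δ.Adj z y) :=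
    fun g h hgh i j k => and_congr (hR.inv₂_atTwo h0 g h hgh i k) (inv₂_adj h0 g h hgh k j)
  exact fun g h hgh i j => and_congr (and_congr (h1 g h hgh i) (h1 g h hgh j))
    (hR.inv₂_ex h2 g h hgh i j)

theorem inv₂_baseAdj : Inv₂ R (BaseAdj Γ) (BaseAdj Δ) :=
  hR.inv₂_ex (A := fun x y y' => SameGadget Γ y y' ∧ Matched Γ x y')
    (A' := fun x y y' => SameGadget Δ y y' ∧ Matched Δ x y') fun g h hgh i j k =>
      and_congr (hR.inv₂_sameGadget h0 g h hgh j k) (hR.inv₂_matched h0 g h hgh i k)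

theorem inv₂_near : Inv₂ R (Near Γ) (Near Δ) := by
  have h1 := hR.inv₁_isInner h0
  have h2 : Inv₃ R (fun z x x' => SameGadget Γ x x' ∧ Γ.Adj z x')
      (fun z x x' => SameGadget Δ x x' ∧ Δ.Adj z x') := fun g h hgh i j k =>
    and_congr (hR.inv₂_sameGadget h0 g h hgh j k) (inv₂_adj h0 g h hgh i k)
  exact fun g h hgh i j => and_congr (and_congr (not_congr (h1 g h hgh i)) (h1 g h hgh j))
    (hR.inv₂_ex h2 g h hgh i j)

theorem inv₂_far : Inv₂ R (Far Γ) (Far Δ) := by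
  have h1 := hR.inv₁_isInner h0
  have h2 : Inv₃ R (fun z x x' => SameGadget Γ x x' ∧ AtTwo Γ z x')
      (fun z x x' => SameGadget Δ x x' ∧ AtTwo Δ z x') := fun g h hgh i j k =>
    and_congr (hR.inv₂_sameGadget h0 g h hgh j k) (hR.inv₂_atTwo h0 g h hgh i k)
  exact fun g h hgh i j => and_congr (and_congr (not_congr (h1 g h hgh i)) (h1 g h hgh j))
    (hR.inv₂_ex h2 g h hgh i j)

theorem inv₂_sameFar : Inv₂ R (SameFar Γ) (SameFar Δ) :=
  hR.inv₂_ex (A := fun y z t => Far Γ y t ∧ Far Γ z t) (A' := fun y z t => Far Δ y t ∧ Far Δ z t)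
    fun g h hgh i j k => and_congr (hR.inv₂_far h0 g h hgh i k) (hR.inv₂_far h0 g h hgh j k)

theorem inv₂_hasDir : Inv₂ R (HasDir Γ) (HasDir Δ) :=
  hR.inv₂_ex (A := fun x y z => Γ.Adj x z ∧ Far Γ z y) (A' := fun x y z => Δ.Adj x z ∧ Far Δ z y)
    fun g h hgh i j k => and_congr (inv₂_adj h0 g h hgh i k) (hR.inv₂_far h0 g h hgh k j)

theorem inv₃_otherCommon : Inv₃ R (OtherCommon Γ) (OtherCommon Δ) :=
  hR.inv₃_ex (A := fun x _ w => Γ.Adj x w) (A' := fun x _ w => Δ.Adj x w)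
    (B := fun y _ w => Γ.Adj y w) (B' := fun y _ w => Δ.Adj y w)
    (C := fun _ z w => w ≠ z) (C' := fun _ z w => w ≠ z)
    (fun g h hgh i _ k => inv₂_adj h0 g h hgh i k) (fun g h hgh i _ k => inv₂_adj h0 g h hgh i k)
    (fun g h hgh _ j k => not_congr (inv₂_vertex_eq h0 g h hgh k j))

theorem isGadgetGraph (hΓ : IsGadgetGraph Γ) : IsGadgetGraph Δ := by
  have he := inv₂_vertex_eq h0
  have ha := inv₂_adj h0
  have hI := hR.inv₁_isInner h0
  have hS := hR.inv₂_sameGadget h0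
  have hB := hR.inv₂_baseAdj h0
  have hN := hR.inv₂_near h0
  have hF := hR.inv₂_far h0
  have hSF := hR.inv₂_sameFar h0
  have hD := hR.inv₂_hasDir h0
  have hO := hR.inv₃_otherCommon h0
  have hEN := hR.inv₁_ex hN
  have hEF := hR.inv₁_ex hF
  have hEO := hR.inv₁_ex (A := fun z z' => ¬ IsInner Γ z' ∧ Γ.Adj z z')
    (A' := fun z z' => ¬ IsInner Δ z' ∧ Δ.Adj z z') fun g h hgh i j =>
      and_congr (not_congr (hI g h hgh j)) (ha g h hgh i j)
  constructor
  · exact hR.forall₂ (h0 := hΓ.same_symm) fun g h hgh i j => by simp only [hS g h hgh]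
  · exact hR.forall₃ (h0 := hΓ.same_trans) fun g h hgh i j k => by simp only [hS g h hgh]
  · exact hR.forall₂ (h0 := hΓ.isInner_of_same) fun g h hgh i j => by
      simp only [hS g h hgh, hI g h hgh]
  · exact hR.forall₂ (h0 := hΓ.base_symm) fun g h hgh i j => by simp only [hB g h hgh]
  · exact hR.forall₂ (h0 := hΓ.base_not_same) fun g h hgh i j => by
      simp only [hB g h hgh, hS g h hgh]
  · exact hR.forall₃ (h0 := hΓ.base_congr) fun g h hgh i j k => by
      simp only [hB g h hgh, hS g h hgh]
  · exact hR.forall₁ (h0 := hΓ.exists_near) fun g h hgh i =>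
      imp_congr (not_congr (hI g h hgh i)) (hEN g h hgh i)
  · exact hR.forall₁ (h0 := hΓ.exists_far) fun g h hgh i =>
      imp_congr (not_congr (hI g h hgh i)) (hEF g h hgh i)
  · exact hR.forall₃ (h0 := hΓ.near_same) fun g h hgh i j k => by
      simp only [hN g h hgh, hS g h hgh]
  · exact hR.forall₃ (h0 := hΓ.near_congr) fun g h hgh i j k => by
      simp only [hN g h hgh, hS g h hgh]
  · exact hR.forall₃ (h0 := hΓ.far_same) fun g h hgh i j k => by
      simp only [hF g h hgh, hS g h hgh]
  · exact hR.forall₃ (h0 := hΓ.far_congr) fun g h hgh i j k => by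
      simp only [hF g h hgh, hS g h hgh]
  · exact hR.forall₂ (h0 := hΓ.not_adj) fun g h hgh i j => by
      simp only [hI g h hgh, ha g h hgh]
  · exact hR.forall₁ (h0 := hΓ.exists_outer) fun g h hgh i =>
      imp_congr (not_congr (hI g h hgh i)) (hEO g h hgh i)
  · exact hR.forall₃ (h0 := hΓ.outer_unique) fun g h hgh i j k => by
      simp only [hI g h hgh, ha g h hgh, he g h hgh]
  · exact hR.forall₂ (h0 := hΓ.near_of_adj) fun g h hgh i j => by
      simp only [hI g h hgh, ha g h hgh, hN g h hgh]
  · exact hR.forall₃ (h0 := hΓ.base_of_near_far) fun g h hgh i j k => by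
      simp only [hN g h hgh, hF g h hgh, hB g h hgh]
  · exact hR.forall₃ (h0 := hΓ.near_of_adj_of_far) fun g h hgh i j k => by
      simp only [hN g h hgh, hF g h hgh, hI g h hgh, ha g h hgh]
  · exact hR.forall₂ (h0 := hΓ.exists_dir) fun g h hgh i j => by
      simp only [hB g h hgh, hD g h hgh]
  · exact hR.forall₃ (h0 := hΓ.dir_unique) fun g h hgh i j k => by
      simp only [hI g h hgh, hSF g h hgh, ha g h hgh, he g h hgh]
  · exact hR.forall₃ (h0 := hΓ.outer_eq) fun g h hgh i j k => by
      simp only [hN g h hgh, hSF g h hgh, ha g h hgh, he g h hgh]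
  · exact hR.forall₃ (h0 := hΓ.common_unique) fun g h hgh i j k => by
      simp only [hI g h hgh, hS g h hgh, hO g h hgh, ha g h hgh, ne_eq, he g h hgh]

end IsBackForth

/-! ### The sentences of `IsGadgetGraph` in CFI graphs. -/

namespace CFIVertex

variable {V : Type u} {Γ : SimpleGraph V} (hΓ : ∀ v, Nat.card (Γ.neighborSet v) = 3)
  (T : Set (Sym2 V))

include hΓ

omit hΓ in
theorem exists_internal_base (v : V) : ∃ x : CFIVertex Γ, x.Internal ∧ x.base = v :=
  ⟨int v _ (even_zero v), trivial, rfl⟩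

theorem sameGadget_iff_eq_or {x y : CFIVertex Γ} :
    SameGadget (cfiTwist Γ T) x y ↔ x = y ∨ x.Internal ∧ y.Internal ∧ x.base = y.base := by
  rw [SameGadget, twin_iff hΓ]
  tauto

theorem sameFar_iff {y z : CFIVertex Γ} :
    SameFar (cfiTwist Γ T) y z ↔ ¬ y.Internal ∧ ¬ z.Internal ∧ y.far = z.far := by
  simp only [SameFar, far_iff hΓ]
  constructor
  · rintro ⟨t, ⟨h1, h2, h3⟩, h4, -, h5⟩
    exact ⟨h1, h4, h3.trans h5.symm⟩
  · rintro ⟨h1, h2, h3⟩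
    obtain ⟨t, ht, hb⟩ := exists_internal_base y.far
    exact ⟨t, ⟨h1, ht, hb.symm⟩, h2, ht, by rw [hb, h3]⟩

theorem isGadgetGraph : IsGadgetGraph (cfiTwist Γ T) := by
  constructor <;> simp only [sameGadget_iff_eq_or hΓ T, isInner_iff hΓ T, baseAdj_iff hΓ T,
    near_iff hΓ T, far_iff hΓ T, sameFar_iff hΓ T]
  · grind
  · grind
  · grind
  · exact fun x y ⟨h1, h2, h3⟩ => ⟨h2, h1, h3.symm⟩
  · rintro x y ⟨h1, h2, h3⟩ (rfl | ⟨-, -, h⟩)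
    · exact h3.ne rfl
    · exact h3.ne h
  · rintro x y z (rfl | ⟨h1, h2, h3⟩) ⟨h4, h5, h6⟩
    · exact ⟨h4, h5, h6⟩
    · exact ⟨h4, h2, h3 ▸ h6⟩
  · intro z hz
    obtain ⟨t, ht, hb⟩ := exists_internal_base z.base
    exact ⟨t, hz, ht, hb.symm⟩
  · intro z hz
    obtain ⟨t, ht, hb⟩ := exists_internal_base z.far
    exact ⟨t, hz, ht, hb.symm⟩
  · grind
  · grind
  · grind
  · grind
  · exact fun x y hx hy => not_adj_of_internal T hx hy
  · rintro (⟨v, w, h, i⟩ | ⟨v, s, hs⟩) hz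
    · obtain ⟨b', hb⟩ := exists_adj_ext_ext T h i
      exact ⟨_, id, hb⟩
    · exact (hz trivial).elim
  · exact fun x y z hx hy hz => eq_of_adj_external T hx hy hz
  · exact fun z x hz hx h => ⟨hz, hx, base_eq_of_adj T hz hx h⟩
  · exact fun z x y ⟨h1, h2, h3⟩ ⟨_, h5, h6⟩ => ⟨h2, h5, h3 ▸ h6 ▸ adj_base_far h1⟩
  · exact fun z z' x hz' hadj ⟨h1, h2, h3⟩ =>
      ⟨hz', h2, (base_eq_far_of_adj T h1 hz' hadj).1.trans h3⟩
  · rintro (⟨v, w, h, i⟩ | ⟨v, s, hs⟩) y ⟨h1, h2, h3⟩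
    · exact h1.elim
    · exact ⟨ext v y.base h3 (s ⟨y.base, h3⟩), adj_int_ext.2 rfl,
        (far_iff hΓ T).2 ⟨id, h2, rfl⟩⟩
  · exact fun x y z hx hxy hxz ⟨_, _, h⟩ => eq_of_adj_internal T hx hxy hxz h
  · rintro (⟨v, w, h, i⟩ | ⟨v, s, hs⟩) (⟨v₁, w₁, h₁, i₁⟩ | ⟨v₁, s₁, hs₁⟩)
      (⟨v₂, w₂, h₂, i₂⟩ | ⟨v₂, s₂, hs₂⟩) ⟨a1, a2, a3⟩ ⟨a4, a5, a6⟩ ⟨a7, a8, a9⟩ a10 a11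
    all_goals first | exact (a1 trivial).elim | exact (a4 trivial).elim | exact a2.elim | skip
    change v₁ = v at a3
    change v₂ = v at a6
    change w₁ = w₂ at a9
    subst a3 a6 a9
    rw [adj_ext_int] at a10 a11
    congr 1
    revert a10 a11
    cases s ⟨w₁, h₁⟩ <;> cases i₁ <;> cases i₂ <;> simp
  · rintro x y z hx (rfl | ⟨-, hy, -⟩) hne h1 h2 ⟨w, h3, h4, h5⟩
    · exact hne rfl
    · exact h5 (eq_of_adj_twins hΓ T hx hy hne h3 h4 h1 h2)

theorem card_sameGadget {x : CFIVertex Γ} (hx : x.Internal) :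
    Nat.card {y // SameGadget (cfiTwist Γ T) x y} = 4 := by
  rcases x with ⟨v, w, h, i⟩ | ⟨v, s, hs⟩
  · exact hx.elim
  rw [← card_even (hΓ v)]
  refine (Nat.card_congr (Equiv.ofBijective
    (fun t => ⟨int v t.1 t.2, (sameGadget_iff hΓ T hx).2 ⟨trivial, rfl⟩⟩) ⟨?_, ?_⟩)).symm
  · intro t t' h
    have h' := congrArg Subtype.val h
    injection h' with _ h2
    exact Subtype.ext h2
  · rintro ⟨y, hy⟩
    rcases y with ⟨v₁, w₁, h₁, i₁⟩ | ⟨v₁, s₁, hs₁⟩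
    · exact ((sameGadget_iff hΓ T hx).1 hy).1.elim
    · obtain rfl : v = v₁ := ((sameGadget_iff hΓ T hx).1 hy).2
      exact ⟨⟨s₁, hs₁⟩, rfl⟩

end CFIVertex

/-! ### Reconstruction of the base graph -/

namespace IsGadgetGraph

variable {W : Type u} {Δ : SimpleGraph W} (hΔ : IsGadgetGraph Δ)

/-- The partition of the inner vertices into gadgets. -/
def setoid : Setoid {x // IsInner Δ x} where
  r x y := SameGadget Δ x y
  iseqv := ⟨fun _ => Or.inl rfl, fun h => hΔ.same_symm _ _ h, fun h h' => hΔ.same_trans _ _ _ h h'⟩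

/-- The graph on the set of gadgets. -/
def baseGraph : SimpleGraph (Quotient hΔ.setoid) where
  Adj := Quotient.lift₂ (fun x y => BaseAdj Δ x y) (by
    have key : ∀ x x' y y', SameGadget Δ x x' → SameGadget Δ y y' → BaseAdj Δ x y →
        BaseAdj Δ x' y' := fun x x' y y' hx hy h => by
      have h1 := hΔ.base_congr _ _ _ hy h
      exact hΔ.base_symm _ _ (hΔ.base_congr _ _ _ hx (hΔ.base_symm _ _ h1))
    intro x y x' y' hx hy
    exact propext ⟨key _ _ _ _ hx hy, key _ _ _ _ (hΔ.same_symm _ _ hx) (hΔ.same_symm _ _ hy)⟩)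
  symm := ⟨by
    rintro ⟨x⟩ ⟨y⟩ h
    exact hΔ.base_symm _ _ h⟩
  loopless := ⟨by
    rintro ⟨x⟩ h
    exact hΔ.base_not_same _ _ h (Or.inl rfl)⟩

theorem mk_eq_iff {x y : {x // IsInner Δ x}} :
    (Quotient.mk hΔ.setoid x = Quotient.mk hΔ.setoid y) ↔ SameGadget Δ x y := Quotient.eq

theorem baseGraph_adj {x y : {x // IsInner Δ x}} :
    hΔ.baseGraph.Adj (Quotient.mk hΔ.setoid x) (Quotient.mk hΔ.setoid y) ↔ BaseAdj Δ x y := Iff.rfl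

/-- The gadget and the direction of an outer vertex are the classes of the inner vertices that are
near and far; `near_same` and `far_same` make them well defined. -/
theorem isCFILike {V : Type*} {Γ : SimpleGraph V} (φ : hΔ.baseGraph ≃g Γ) :
    ∃ γ δ : W → V, IsCFILike Γ Δ (IsInner Δ) γ δ := by
  classical
  have hγ : ∀ z, ∃ v, (∀ h : IsInner Δ z, v = φ (Quotient.mk hΔ.setoid ⟨z, h⟩)) ∧
      ∀ x (h : IsInner Δ x), Near Δ z x → v = φ (Quotient.mk hΔ.setoid ⟨x, h⟩) := by
    intro z
    by_cases hz : IsInner Δ z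
    · exact ⟨φ (Quotient.mk hΔ.setoid ⟨z, hz⟩), fun _ => rfl, fun x h h' => absurd hz h'.1.1⟩
    · obtain ⟨x, hx⟩ := hΔ.exists_near z hz
      refine ⟨φ (Quotient.mk hΔ.setoid ⟨x, hx.1.2⟩), fun h => absurd h hz, fun y hy h => ?_⟩
      rw [φ.injective.eq_iff, hΔ.mk_eq_iff]
      exact hΔ.near_same _ _ _ hx h
  have hδ : ∀ z, ∃ v, ∀ x (h : IsInner Δ x), Far Δ z x →
      v = φ (Quotient.mk hΔ.setoid ⟨x, h⟩) := by
    intro z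
    by_cases hz : IsInner Δ z
    -- A default value: directions are used only at outer vertices.
    · exact ⟨φ (Quotient.mk hΔ.setoid ⟨z, hz⟩), fun x h h' => absurd hz h'.1.1⟩
    · obtain ⟨x, hx⟩ := hΔ.exists_far z hz
      refine ⟨φ (Quotient.mk hΔ.setoid ⟨x, hx.1.2⟩), fun y hy h => ?_⟩
      rw [φ.injective.eq_iff, hΔ.mk_eq_iff]
      exact hΔ.far_same _ _ _ hx h
  choose γ hγi hγn using hγ
  choose δ hδf using hδ
  have hγγ : ∀ {x y}, IsInner Δ x → IsInner Δ y → (γ x = γ y ↔ SameGadget Δ x y) := by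
    intro x y hx hy
    rw [hγi x hx, hγi y hy, φ.injective.eq_iff, hΔ.mk_eq_iff]
  have hnear : ∀ {z x}, ¬ IsInner Δ z → IsInner Δ x → (γ z = γ x ↔ Near Δ z x) := by
    intro z x hz hx
    obtain ⟨y, hy⟩ := hΔ.exists_near z hz
    rw [hγn z y hy.1.2 hy, hγi x hx, φ.injective.eq_iff, hΔ.mk_eq_iff]
    exact ⟨hΔ.near_congr _ _ _ hy, hΔ.near_same _ _ _ hy⟩
  have hfar : ∀ {z x}, ¬ IsInner Δ z → IsInner Δ x → (δ z = γ x ↔ Far Δ z x) := by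
    intro z x hz hx
    obtain ⟨y, hy⟩ := hΔ.exists_far z hz
    rw [hδf z y hy.1.2 hy, hγi x hx, φ.injective.eq_iff, hΔ.mk_eq_iff]
    exact ⟨hΔ.far_congr _ _ _ hy, hΔ.far_same _ _ _ hy⟩
  have hadj : ∀ {x y}, IsInner Δ x → IsInner Δ y → (Γ.Adj (γ x) (γ y) ↔ BaseAdj Δ x y) := by
    intro x y hx hy
    rw [hγi x hx, hγi y hy, φ.map_adj_iff]
    exact hΔ.baseGraph_adj
  have hsur : ∀ v, ∃ x, IsInner Δ x ∧ γ x = v := by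
    intro v
    obtain ⟨⟨x⟩, rfl⟩ := φ.surjective v
    exact ⟨x.1, x.2, hγi _ x.2⟩
  have hsf : ∀ {y z}, ¬ IsInner Δ y → ¬ IsInner Δ z → δ y = δ z → SameFar Δ y z := by
    intro y z hy hz h
    obtain ⟨x, hx⟩ := hΔ.exists_far y hy
    exact ⟨x, hx, (hfar hz hx.1.2).1 (h ▸ (hfar hy hx.1.2).2 hx)⟩
  have hout : ∀ {x y}, IsInner Δ x → Δ.Adj x y → ¬ IsInner Δ y :=
    fun hx hxy hy => hΔ.not_adj _ _ hx hy hxy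
  refine ⟨γ, δ, ?_⟩
  constructor
  · exact fun hx hy => hΔ.not_adj _ _ hx hy
  · exact fun hz => hΔ.exists_outer _ hz
  · exact fun hx hy hz => hΔ.outer_unique _ _ _ hx hy hz
  · exact fun hz hx h => (hnear hz hx).2 (hΔ.near_of_adj _ _ hz hx h)
  · intro z hz
    obtain ⟨x, hx⟩ := hΔ.exists_near z hz
    obtain ⟨y, hy⟩ := hΔ.exists_far z hz
    rw [(hnear hz hx.1.2).2 hx, (hfar hz hy.1.2).2 hy, hadj hx.1.2 hy.1.2]
    exact hΔ.base_of_near_far _ _ _ hx hy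
  · intro z z' hz hz' h
    obtain ⟨x, hx⟩ := hΔ.exists_far z hz
    rw [(hfar hz hx.1.2).2 hx, hnear hz' hx.1.2]
    exact hΔ.near_of_adj_of_far _ _ _ hz' h hx
  · intro x w hx hw
    obtain ⟨y, hy, rfl⟩ := hsur w
    obtain ⟨z, hz, hzf⟩ := hΔ.exists_dir _ _ ((hadj hx hy).1 hw)
    exact ⟨z, hz, (hfar hzf.1.1 hy).2 hzf⟩
  · exact fun hx hxy hxz h =>
      hΔ.dir_unique _ _ _ hx hxy hxz (hsf (hout hx hxy) (hout hx hxz) h)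
  · exact fun ho hy hz h1 h2 h3 => hΔ.outer_eq _ _ _ ((hnear hy ho).1 h1) ((hnear hz ho).1 h2)
      (hsf hy hz h3)
  · intro x y hx hy hne h
    obtain h | h := (hγγ hx hy).1 h
    · exact absurd h hne
    · obtain ⟨z, h1, h2⟩ := h.1.2
      exact ⟨z, h1, h2.symm⟩
  · intro x y z z' hx hy hne h1 h2 h3 h4
    have hz := hout hx h1
    have hxy := hΔ.near_same _ _ _ (hΔ.near_of_adj _ _ hz hx h1.symm)
      (hΔ.near_of_adj _ _ hz hy h2.symm)
    by_contra hzz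
    exact hΔ.common_unique _ _ _ hx hxy hne h1 h2 ⟨z', h3, h4, hzz⟩
  · exact hsur

end IsGadgetGraph

/-- A graph that cannot be told apart from a CFI graph over `Γ` is a CFI graph over `Γ`, provided
that `Γ` has Weisfeiler-Leman dimension at most three. -/
theorem IsBackForth.exists_iso_cfiTwist {V W : Type u} [Finite V] [Finite W] {Γ : SimpleGraph V}
    {Δ : SimpleGraph W} (hΓ : ∀ v, Nat.card (Γ.neighborSet v) = 3) [Nonempty V] {T : Set (Sym2 V)}
    {R : (Fin 3 → CFIVertex Γ) → (Fin 3 → W) → Prop} (hR : IsBackForth R)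
    (h0 : ∀ g h, R g h → graphType (cfiTwist Γ T) g = graphType Δ h) (hdim : GraphWLDimLE Γ 3) :
    ∃ T' ⊆ Γ.edgeSet, Nonempty (Δ ≃g cfiTwist Γ T') := by
  have hΔ : IsGadgetGraph Δ := hR.isGadgetGraph h0 (CFIVertex.isGadgetGraph hΓ T)
  have hI := hR.inv₁_isInner h0
  have hcard : Nat.card W = Nat.card (CFIVertex Γ) := by
    obtain ⟨g, h, hgh⟩ := hR.nonempty
    obtain ⟨π, -⟩ := hR.step g h hgh
    exact (Nat.card_congr π).symm
  obtain ⟨v₀⟩ := ‹Nonempty V›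
  have hRI := hR.restrict (D := {x | IsInner (cfiTwist Γ T) x}) (D' := {x | IsInner Δ x}) hI
    ⟨.int v₀ _ (CFIVertex.even_zero v₀), (CFIVertex.isInner_iff hΓ T).2 trivial⟩
    (by decide)
  let q : {x // IsInner (cfiTwist Γ T) x} → V := fun x => x.1.base
  let q' : {x // IsInner Δ x} → Quotient hΔ.setoid := Quotient.mk _
  have hin : ∀ x : {x // IsInner (cfiTwist Γ T) x}, x.1.Internal :=
    fun x => (CFIVertex.isInner_iff hΓ T).1 x.2
  have hq : ∀ v, Nat.card {x // q x = v} = 4 := by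
    intro v
    have hv : (CFIVertex.int v _ (CFIVertex.even_zero v) : CFIVertex Γ).Internal := trivial
    have hS := fun y => CFIVertex.sameGadget_iff hΓ T (y := y) hv
    rw [← CFIVertex.card_sameGadget hΓ T hv]
    exact Nat.card_congr ⟨fun x => ⟨x.1.1, (hS _).2 ⟨hin x.1, x.2.symm⟩⟩,
      fun x => ⟨⟨x.1, (CFIVertex.isInner_iff hΓ T).2 ((hS _).1 x.2).1⟩, ((hS _).1 x.2).2.symm⟩,
      fun _ => rfl, fun _ => rfl⟩
  have hq' : ∀ a, Nat.card {x // q' x = a} = 4 := by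
    rintro ⟨⟨y, hy⟩⟩
    obtain ⟨g, hg⟩ := hR.exists_left fun _ => y
    rw [← CFIVertex.card_sameGadget hΓ T ((CFIVertex.isInner_iff hΓ T).1 ((hI _ _ hg 0).2 hy)),
      hR.card_eq_of_inv₂ (hR.inv₂_sameGadget h0) hg 0]
    refine Nat.card_congr ⟨fun x => ⟨x.1.1, hΔ.same_symm _ _ (hΔ.mk_eq_iff.1 x.2)⟩,
      fun x => ⟨⟨x.1, hΔ.isInner_of_same _ _ x.2 hy⟩, hΔ.mk_eq_iff.2 (hΔ.same_symm _ _ x.2)⟩,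
      fun _ => rfl, fun _ => rfl⟩
  have hcol : ∀ (g : Fin 3 → {x // IsInner (cfiTwist Γ T) x}) (h : Fin 3 → {x // IsInner Δ x}),
      R (fun j => g j) (fun j => h j) →
      graphType Γ (q ∘ g) = graphType hΔ.baseGraph (q' ∘ h) := by
    intro g h hgh
    funext i j
    refine Prod.ext (propext ?_) (propext ?_)
    · change (g i).1.base = (g j).1.base ↔ q' (h i) = q' (h j)
      rw [hΔ.mk_eq_iff, ← hR.inv₂_sameGadget h0 _ _ hgh i j,
        CFIVertex.sameGadget_iff hΓ T (hin _)]
      exact ⟨fun h => ⟨hin _, h⟩, fun h => h.2⟩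
    · change Γ.Adj (g i).1.base (g j).1.base ↔ hΔ.baseGraph.Adj (q' (h i)) (q' (h j))
      rw [hΔ.baseGraph_adj, ← hR.inv₂_baseAdj h0 _ _ hgh i j, CFIVertex.baseAdj_iff hΓ T]
      exact ⟨fun h => ⟨hin _, hin _, h⟩, fun h => h.2.2⟩
  have hbase : IsBackForth fun (g : Fin 3 → V) (h : Fin 3 → Quotient hΔ.setoid) =>
      wlFinalColor (graphType Γ) g = wlFinalColor (graphType hΔ.baseGraph) h := by
    obtain ⟨g, h, hgh⟩ := hRI.nonempty
    exact isBackForth_wlFinalColor ⟨_, _, hRI.wlFinalColor_comp_eq q q' 4 (by decide) hq hq'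
      hcol g h hgh⟩
  have hiso : Nonempty (Γ ≃g hΔ.baseGraph) := by
    -- Otherwise 3-WL would tell the base graphs apart in their disjoint union, but the bijection
    -- that preserves their separately computed colours also preserves the colours in the union.
    by_contra hno
    refine hdim _ hΔ.baseGraph hno ?_
    obtain ⟨f, hf⟩ := hbase.exists_equiv
    exact ⟨f, fun g => wlFinalColor_sum_eq hbase (fun g h hgh => congrFun hgh 0) (hf g)⟩
  obtain ⟨φ⟩ := hiso
  obtain ⟨γ, δ, hlike⟩ := hΔ.isCFILike φ.symm
  exact hlike.exists_iso hΓ hcard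

/-! ### Switching twists -/

theorem even_xor {N : Type*} (hN : Nat.card N = 3) {s t : N → Bool}
    (hs : Even (Nat.card {w // s w = true})) (ht : Even (Nat.card {w // t w = true})) :
    Even (Nat.card {w // (s w ^^ t w) = true}) := by
  have hne : Nonempty N := by
    by_contra h
    rw [not_nonempty_iff] at h
    simp at hN
  obtain ⟨a⟩ := hne
  obtain ⟨b, hb⟩ := exists_ne_of_card_eq_three hN a
  obtain ⟨c, hca, hcb, hcov⟩ := exists_third hN hb.symm
  rw [even_card_iff hN hb.symm hca hcb hcov] at hs ht
  rw [even_card_iff hN hb.symm hca hcb hcov (fun w => s w ^^ t w)]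
  revert hs ht
  cases s a <;> cases s b <;> cases s c <;> cases t a <;> cases t b <;> cases t c <;> simp

namespace CFIVertex

variable {V : Type u} {Γ : SimpleGraph V} (hΓ : ∀ v, Nat.card (Γ.neighborSet v) = 3)

/-- The permutation of the vertices that exchanges the external vertices at the places given
by `f`. -/
def switch (f : V → V → Bool)
    (hf : ∀ v (s : Γ.neighborSet v → Bool), Even (Nat.card {w // s w = true}) →
      Even (Nat.card {w : Γ.neighborSet v // (s w ^^ f v w) = true})) :
    CFIVertex Γ ≃ CFIVertex Γ :=
  have hinv : Function.Involutive fun x : CFIVertex Γ => (match x with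
    | ext v w h b => ext v w h (b ^^ f v w)
    | int v s hs => int v (fun w => s w ^^ f v w) (hf v s hs) : CFIVertex Γ) := by
    rintro (⟨v, w, h, b⟩ | ⟨v, s, hs⟩) <;> simp
  hinv.toPerm

include hΓ

/-- An edge changes its twist iff exactly one of its two external pairs is exchanged. An even number
of exchanges in each gadget keeps all strings even. -/
theorem nonempty_iso_switch {T T' : Set (Sym2 V)} (f : V → V → Bool)
    (hf : ∀ v, Even (Nat.card {w : Γ.neighborSet v // f v w = true}))
    (hT : ∀ v w, (s(v, w) ∈ T' ↔ (s(v, w) ∈ T ↔ f v w = f w v))) :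
    Nonempty (cfiTwist Γ T ≃g cfiTwist Γ T') := by
  refine ⟨⟨switch f fun v s hs => even_xor (hΓ v) hs (hf v), ?_⟩⟩
  rintro (⟨v, w, h, b⟩ | ⟨v, s, hs⟩) (⟨v', w', h', b'⟩ | ⟨v', s', hs'⟩)
  · change (v' = w ∧ w' = v ∧ _) ↔ (v' = w ∧ w' = v ∧ _)
    refine and_congr_right fun h1 => and_congr_right fun h2 => ?_
    subst h1 h2
    have := hT w' v'
    by_cases h1 : s(w', v') ∈ T <;> by_cases h2 : s(w', v') ∈ T' <;>
      simp only [h1, h2, not_true, not_false_eq_true, iff_true, iff_false, true_iff, false_iff,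
        not_not] at this ⊢ <;> revert this <;>
      cases f w' v' <;> cases f v' w' <;> cases b <;> cases b' <;> simp
  · change (∃ hv : v = v', _) ↔ (∃ hv : v = v', _)
    refine exists_congr fun h1 => ?_
    subst h1
    simp
  · change (∃ hv : v' = v, _) ↔ (∃ hv : v' = v, _)
    refine exists_congr fun h1 => ?_
    subst h1
    simp
  · exact Iff.rfl

/-- Exchanging the pairs of `u` and `w` in the gadget of `v` toggles the twists of both edges. -/
theorem nonempty_iso_symmDiff_of_adj (T : Set (Sym2 V)) {v u w : V} (hu : Γ.Adj v u)
    (hw : Γ.Adj v w) :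
    Nonempty (cfiTwist Γ T ≃g cfiTwist Γ (symmDiff (symmDiff T {s(v, u)}) {s(v, w)})) := by
  classical
  by_cases huw : u = w
  · subst huw
    rw [symmDiff_assoc, symmDiff_self, symmDiff_bot]
    exact ⟨SimpleGraph.Iso.refl⟩
  refine nonempty_iso_switch hΓ (fun a b => decide (a = v ∧ (b = u ∨ b = w))) ?_ ?_
  · intro a
    by_cases ha : a = v
    · subst ha
      have : Nat.card {b : Γ.neighborSet a // decide (a = a ∧ (b.1 = u ∨ b.1 = w)) = true} = 2 := by
        rw [Nat.card_eq_two_iff]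
        refine ⟨⟨⟨u, hu⟩, by simp⟩, ⟨⟨w, hw⟩, by simp⟩, by simpa [Subtype.ext_iff] using huw, ?_⟩
        ext ⟨⟨b, hb⟩, hb'⟩
        simpa [Subtype.ext_iff] using hb'
      rw [this]
      decide
    · simp [ha]
  · intro a b
    have hu' := hu.ne
    have hw' := hw.ne
    simp only [Set.mem_symmDiff, Set.mem_singleton_iff, Sym2.eq_iff]
    by_cases h1 : s(a, b) ∈ T <;> by_cases ha : a = v <;> by_cases hb : b = v <;>
      simp only [h1, ha, hb] <;> grind

/-- Along a walk the intermediate edges are toggled twice, so only the first and the last one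
change. -/
theorem nonempty_iso_symmDiff (hc : Γ.Connected) {e e' : Sym2 V} (he : e ∈ Γ.edgeSet)
    (he' : e' ∈ Γ.edgeSet) (T : Set (Sym2 V)) :
    Nonempty (cfiTwist Γ T ≃g cfiTwist Γ (symmDiff (symmDiff T {e}) {e'})) := by
  have key : ∀ {v v' : V} (p : Γ.Walk v v') {u u' : V}, Γ.Adj v u → Γ.Adj v' u' →
      ∀ T, Nonempty (cfiTwist Γ T ≃g cfiTwist Γ (symmDiff (symmDiff T {s(v, u)}) {s(v', u')})) := by
    intro v v' p
    induction p with
    | nil => exact fun hu hu' T => nonempty_iso_symmDiff_of_adj hΓ T hu hu'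
    | @cons v v₁ v' h p ih =>
      intro u u' hu hu' T
      obtain ⟨φ⟩ := nonempty_iso_symmDiff_of_adj hΓ T hu h
      obtain ⟨ψ⟩ := ih h.symm hu' (symmDiff (symmDiff T {s(v, u)}) {s(v, v₁)})
      rw [Sym2.eq_swap (a := v₁), symmDiff_assoc (symmDiff T {s(v, u)}), symmDiff_self,
        symmDiff_bot] at ψ
      exact ⟨φ.trans ψ⟩
  induction e with | _ v u
  induction e' with | _ v' u'
  obtain ⟨p⟩ := hc.preconnected v v'
  exact key p he he' T

theorem nonempty_iso_cfi (hc : Γ.Connected) {e : Sym2 V} (he : e ∈ Γ.edgeSet) {T : Set (Sym2 V)}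
    (hfin : T.Finite) (hT : T ⊆ Γ.edgeSet) :
    Nonempty (cfiTwist Γ T ≃g CFI Γ) ∨ Nonempty (cfiTwist Γ T ≃g twistedCFI Γ e) := by
  -- The set `S` absorbs the edges as they are removed from `T`, so the induction needs it to be
  -- arbitrary; in the end it is empty.
  have key : ∀ S : Set (Sym2 V), Nonempty (cfiTwist Γ (symmDiff S T) ≃g cfiTwist Γ S) ∨
      Nonempty (cfiTwist Γ (symmDiff S T) ≃g cfiTwist Γ (symmDiff S {e})) := by
    induction T, hfin using Set.Finite.induction_on with
    | empty => exact fun S => Or.inl ⟨by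
        rw [← Set.bot_eq_empty, symmDiff_bot]⟩
    | @insert a T ha _ ih =>
      intro S
      have hae := hT (Set.mem_insert _ _)
      have h1 : symmDiff S (insert a T) = symmDiff (symmDiff S {a}) T := by
        rw [symmDiff_assoc]
        congr 1
        ext x
        by_cases hx : x = a
        · subst hx; simp [Set.mem_symmDiff, ha]
        · simp [Set.mem_symmDiff, hx]
      rw [h1]
      rcases ih (fun x hx => hT (Set.mem_insert_of_mem _ hx)) (symmDiff S {a}) with ⟨⟨φ⟩⟩ | ⟨⟨φ⟩⟩
      · obtain ⟨ψ⟩ := nonempty_iso_symmDiff hΓ hc hae he (symmDiff S {a})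
        rw [symmDiff_assoc S, symmDiff_self, symmDiff_bot] at ψ
        exact Or.inr ⟨φ.trans ψ⟩
      · obtain ⟨ψ⟩ := nonempty_iso_symmDiff hΓ hc he hae (symmDiff (symmDiff S {a}) {e})
        rw [symmDiff_assoc (symmDiff S {a}), symmDiff_self, symmDiff_bot,
          symmDiff_assoc S {a} {a}, symmDiff_self, symmDiff_bot] at ψ
        exact Or.inl ⟨φ.trans ψ⟩
  have := key ∅
  rwa [← Set.bot_eq_empty, bot_symmDiff, bot_symmDiff] at this

end CFIVertex

/-! ### Parity -/

/-- Off the diagonal, the pairs `(v, w)` and `(w, v)` contribute twice the same value. -/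
theorem even_sum_of_symm {V : Type*} [Fintype V] (f : V × V → ℤ) (hsymm : ∀ p, f p.swap = f p)
    (hdiag : ∀ v, f (v, v) = 0) : Even (∑ p : V × V, f p) := by
  rw [← ZMod.intCast_eq_zero_iff_even, Int.cast_sum]
  refine Finset.sum_involution (fun p _ => p.swap) ?_ ?_ (by simp) (by simp)
  · intro p _
    rw [hsymm]
    exact CharTwo.add_self_eq_zero _
  · rintro ⟨v, w⟩ _ h heq
    obtain rfl : w = v := congrArg Prod.fst heq
    exact h (by rw [hdiag]; simp)

-- On adjacent pairs the indicator is one minus the exclusive or of the bits `a p`, `a p.swap` and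
-- the twist `t p`, written as an integer polynomial. The two linear sums over bits are equal and
-- even, hence together divisible by 4. The quadratic part is symmetric and vanishes on the
-- diagonal, so twice its sum is divisible by 4. The strings drop out.
open Classical in
theorem card_matched_modEq {V : Type u} [Fintype V] (Γ : SimpleGraph V) {T : Set (Sym2 V)}
    (hT : T ⊆ Γ.edgeSet) (s : ∀ v, Γ.neighborSet v → Bool)
    (hs : ∀ v, Even (Nat.card {w // s v w = true})) :
    (Nat.card {p : V × V // ∃ h : Γ.Adj p.1 p.2,
        (s p.1 ⟨p.2, h⟩ = s p.2 ⟨p.1, h.symm⟩ ↔ s(p.1, p.2) ∉ T)} : ℤ) ≡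
      (∑ p : V × V, if Γ.Adj p.1 p.2 then 1 else 0) -
        ∑ p : V × V, if s(p.1, p.2) ∈ T then 1 else 0 [ZMOD 4] := by
  let α : V × V → Prop := fun p => ∃ h : Γ.Adj p.1 p.2, s p.1 ⟨p.2, h⟩ = true
  let A : V × V → ℤ := fun p => if Γ.Adj p.1 p.2 then 1 else 0
  let t : V × V → ℤ := fun p => if s(p.1, p.2) ∈ T then 1 else 0
  let a : V × V → ℤ := fun p => if α p then 1 else 0
  have hcard : (Nat.card {p : V × V // ∃ h : Γ.Adj p.1 p.2,
        (s p.1 ⟨p.2, h⟩ = s p.2 ⟨p.1, h.symm⟩ ↔ s(p.1, p.2) ∉ T)} : ℤ) =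
      ∑ p : V × V, (A p - a p - a p.swap - t p + 2 * (a p * a p.swap + a p * t p + a p.swap * t p) -
        4 * (a p * a p.swap * t p)) := by
    rw [Nat.card_eq_fintype_card, Fintype.card_subtype, Finset.card_filter, Nat.cast_sum]
    refine Finset.sum_congr rfl ?_
    rintro ⟨v, w⟩ -
    by_cases h : Γ.Adj v w
    · have h1 : α (v, w) ↔ s v ⟨w, h⟩ = true := ⟨fun ⟨_, h⟩ => h, fun h' => ⟨h, h'⟩⟩
      have h2 : α (w, v) ↔ s w ⟨v, h.symm⟩ = true :=
        ⟨fun ⟨_, h⟩ => h, fun h' => ⟨h.symm, h'⟩⟩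
      simp only [A, t, a, Prod.swap_prod_mk, h, h1, h2, exists_true_left]
      by_cases h3 : s(v, w) ∈ T <;> cases s v ⟨w, h⟩ <;> cases s w ⟨v, h.symm⟩ <;> simp [h3]
    · have h1 : ¬ α (v, w) := fun ⟨h', _⟩ => h h'
      have h2 : ¬ α (w, v) := fun ⟨h', _⟩ => h h'.symm
      have h3 : s(v, w) ∉ T := fun h' => h (hT h')
      simp [A, t, a, h, h1, h2, h3]
  have hswap : ∑ p : V × V, a p.swap = ∑ p : V × V, a p := Equiv.sum_comp (Equiv.prodComm V V) a
  have ha : Even (∑ p : V × V, a p) := by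
    rw [Fintype.sum_prod_type]
    refine Finset.even_sum _ fun v _ => ?_
    have : ∑ w, a (v, w) = (Nat.card {w // s v w = true} : ℤ) := by
      have e : {w // s v w = true} ≃ {w // α (v, w)} :=
        ⟨fun w => ⟨w.1.1, w.1.2, w.2⟩, fun w => ⟨⟨w.1, w.2.1⟩, w.2.2⟩, fun _ => rfl, fun _ => rfl⟩
      rw [Nat.card_congr e, Nat.card_eq_fintype_card, Fintype.card_subtype, Finset.card_filter,
        Nat.cast_sum]
      exact Finset.sum_congr rfl fun w _ => by simp [a]
    rw [this]
    exact_mod_cast hs v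
  have hsym : Even (∑ p : V × V, (a p * a p.swap + a p * t p + a p.swap * t p)) := by
    refine even_sum_of_symm _ ?_ ?_
    · rintro ⟨v, w⟩
      have : t (w, v) = t (v, w) := by simp only [t]; rw [Sym2.eq_swap]
      simp only [Prod.swap_prod_mk, this]
      ring
    · intro v
      have : ¬ α (v, v) := fun ⟨h, _⟩ => h.ne rfl
      simp [a, this]
  obtain ⟨k, hk⟩ := ha
  obtain ⟨l, hl⟩ := hsym
  rw [hcard]
  simp only [Finset.sum_sub_distrib, Finset.sum_add_distrib, ← Finset.mul_sum] at hl ⊢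
  rw [hswap, hl, hk]
  refine (Int.modEq_iff_dvd.2 ⟨k - l + ∑ p : V × V, a p * a p.swap * t p, ?_⟩)
  simp only [A, t]
  ring

/-! ### Transversals and the parity of the number of twists. -/

namespace CFIVertex

variable {V : Type u} {Γ : SimpleGraph V} (hΓ : ∀ v, Nat.card (Γ.neighborSet v) = 3)

/-- A set that contains one internal vertex of every gadget. -/
structure IsTransversal (S : Set (CFIVertex Γ)) : Prop where
  internal : ∀ x ∈ S, x.Internal
  exists_base : ∀ v, ∃ x ∈ S, x.base = v
  eq_of_base : ∀ x ∈ S, ∀ y ∈ S, x.base = y.base → x = y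

include hΓ

open Classical in
/-- The pairs of matched elements of a transversal, counted modulo four. -/
theorem IsTransversal.card_modEq [Fintype V] {S : Set (CFIVertex Γ)} (hS : IsTransversal S)
    {T : Set (Sym2 V)} (hT : T ⊆ Γ.edgeSet) :
    (Nat.card {g : Fin 2 → CFIVertex Γ //
      (g 0 ∈ S ∧ g 1 ∈ S) ∧ Matched (cfiTwist Γ T) (g 0) (g 1)} : ℤ) ≡
      (∑ p : V × V, if Γ.Adj p.1 p.2 then 1 else 0) -
        ∑ p : V × V, if s(p.1, p.2) ∈ T then 1 else 0 [ZMOD 4] := by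
  have h1 : ∀ v, ∃ s : Γ.neighborSet v → Bool, ∃ hs, int v s hs ∈ S := by
    intro v
    obtain ⟨(⟨v, w, h, b⟩ | ⟨v, s, hs⟩), hx, rfl⟩ := hS.exists_base v
    · exact (hS.internal _ hx).elim
    · exact ⟨s, hs, hx⟩
  choose s hs hsS using h1
  rw [← Nat.card_congr (Equiv.ofBijective (α := {p : V × V // ∃ h : Γ.Adj p.1 p.2,
    (s p.1 ⟨p.2, h⟩ = s p.2 ⟨p.1, h.symm⟩ ↔ s(p.1, p.2) ∉ T)})
    (fun p => ⟨![int p.1.1 _ (hs p.1.1), int p.1.2 _ (hs p.1.2)], ⟨hsS _, hsS _⟩,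
      (matched_int_int hΓ T).2 p.2⟩) ⟨?_, ?_⟩)]
  · exact card_matched_modEq Γ hT s hs
  · rintro ⟨⟨v, w⟩, hp⟩ ⟨⟨v', w'⟩, hp'⟩ h
    have h0 := congrArg (fun g => (g.1 0).base) h
    have h1 := congrArg (fun g => (g.1 1).base) h
    exact Subtype.ext (Prod.ext h0 h1)
  · rintro ⟨g, ⟨h0, h1⟩, hm⟩
    have e0 := hS.eq_of_base _ h0 _ (hsS (g 0).base) rfl
    have e1 := hS.eq_of_base _ h1 _ (hsS (g 1).base) rfl
    have hm' := hm
    rw [e0, e1, matched_int_int hΓ T] at hm'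
    refine ⟨⟨((g 0).base, (g 1).base), hm'⟩, Subtype.ext (funext fun i => ?_)⟩
    fin_cases i
    · exact e0.symm
    · exact e1.symm

/-- Two pebbles suffice: one rests on an internal vertex of a gadget while the other finds the
element of the set there, and uniqueness is a statement about pairs. -/
theorem IsTransversal.of_isBackForth [Finite V] {S S' : Set (CFIVertex Γ)} (hS : IsTransversal S)
    {T T' : Set (Sym2 V)} {Q : (Fin 2 → CFIVertex Γ) → (Fin 2 → CFIVertex Γ) → Prop}
    (hQ : IsBackForth Q) (hQS : ∀ g h, Q g h → ∀ i, g i ∈ S ↔ h i ∈ S')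
    (hI : ∀ g h, Q g h → (IsInner (cfiTwist Γ T) (g 0) ↔ IsInner (cfiTwist Γ T') (h 0)))
    (hG : ∀ g h, Q g h →
      (SameGadget (cfiTwist Γ T) (g 0) (g 1) ↔ SameGadget (cfiTwist Γ T') (h 0) (h 1)))
    (hE : ∀ g h, Q g h → (g 0 = g 1 ↔ h 0 = h 1)) : IsTransversal S' := by
  have hin : ∀ x ∈ S', x.Internal := by
    intro x hx
    obtain ⟨g, hg⟩ := hQ.exists_left ![x, x]
    have := hS.internal _ ((hQS _ _ hg 0).2 hx)
    exact (isInner_iff hΓ T').1 ((hI _ _ hg).1 ((isInner_iff hΓ T).2 this))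
  refine ⟨hin, fun v => ?_, fun x hx y hy hxy => ?_⟩
  · have hv : (int v _ (even_zero v) : CFIVertex Γ).Internal := trivial
    obtain ⟨g, hg⟩ := hQ.exists_left ![int v _ (even_zero v), int v _ (even_zero v)]
    have h0 : (g 0).Internal :=
      (isInner_iff hΓ T).1 ((hI _ _ hg).2 ((isInner_iff hΓ T').2 hv))
    obtain ⟨x, hx, hxb⟩ := hS.exists_base (g 0).base
    obtain ⟨π, hπ⟩ := hQ.step _ _ hg
    have h1 := hπ 1 x
    refine ⟨π x, ?_, ?_⟩
    · simpa using (hQS _ _ h1 1).1 (by simpa using hx)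
    · have := (hG _ _ h1).1 (by
        simpa using (sameGadget_iff hΓ T h0).2 ⟨hS.internal _ hx, hxb.symm⟩)
      exact ((sameGadget_iff hΓ T' hv).1 (by simpa using this)).2.symm
  · obtain ⟨g, hg⟩ := hQ.exists_left ![x, y]
    have h0 := (hQS _ _ hg 0).2 hx
    have h1 := (hQS _ _ hg 1).2 hy
    have := (hG _ _ hg).2 ((sameGadget_iff hΓ T' (hin _ hx)).2 ⟨hin _ hy, hxy⟩)
    exact (hE _ _ hg).1
      (hS.eq_of_base _ h0 _ h1 ((sameGadget_iff hΓ T (hS.internal _ h0)).1 this).2)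

end CFIVertex

theorem CFIVertex.isTransversal_range {V : Type u} {Γ : SimpleGraph V} :
    CFIVertex.IsTransversal
      (Set.range fun v => (CFIVertex.int v _ (CFIVertex.even_zero v) : CFIVertex Γ)) where
  internal := by
    rintro _ ⟨v, rfl⟩
    trivial
  exists_base v := ⟨_, ⟨v, rfl⟩, rfl⟩
  eq_of_base := by
    rintro _ ⟨v, rfl⟩ _ ⟨w, rfl⟩ (rfl : v = w)
    rfl

namespace CFIVertex

variable {V : Type u} {Γ : SimpleGraph V} {p : ℕ} [Fact p.Prime]

instance [Nonempty V] : Nonempty (CFIVertex Γ) :=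
  ⟨int (Classical.arbitrary V) _ (even_zero _)⟩

open Classical in
/-- If the group of a CFI graph cannot be told apart from a group that carries a reading as a second
CFI graph over the same base graph, then the numbers of twists have the same parity. -/
theorem sum_twists_modEq [Fintype V] [Nonempty V] (hΓ : ∀ v, Nat.card (Γ.neighborSet v) = 3)
    {T T' : Set (Sym2 V)} (hT : T ⊆ Γ.edgeSet) (hT' : T' ⊆ Γ.edgeSet) {H : Type*} [Group H]
    [Finite H] (h : GroupWLEquiv 3 (MeklerGroup p (cfiTwist Γ T)) H)
    {q' : {x : H // IsSingular x} → CFIVertex Γ} (hq' : IsReading (cfiTwist Γ T') q') :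
    (∑ p : V × V, if s(p.1, p.2) ∈ T then 1 else 0) ≡
      (∑ p : V × V, if s(p.1, p.2) ∈ T' then 1 else 0) [ZMOD 4] := by
  have := Fintype.ofFinite (CFIVertex Γ)
  obtain ⟨R, q, m, hG, hq⟩ := MeklerGroup.exists_readingGame (isSparse hΓ T) h hq'
  let S : Set (CFIVertex Γ) := Set.range fun v => int v _ (even_zero v)
  have hS : IsTransversal S := isTransversal_range
  -- The zero strings form a transversal, and `x` has it as its support.
  obtain ⟨x, hx⟩ := MeklerGroup.exists_vec_ne_zero_iff (p := p) (Γ := cfiTwist Γ T) S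
  obtain ⟨S', Q, hQ, hQS⟩ := hG.exists_isBackForth_support x
  have hR := hG.isBackForth
  have h0 : ∀ (g h : Fin 3 → CFIVertex Γ), wlFinalColor (graphType (cfiTwist Γ T)) g =
      wlFinalColor (graphType (cfiTwist Γ T')) h →
      graphType (cfiTwist Γ T) g = graphType (cfiTwist Γ T') h := fun g h hgh => congrFun hgh 0
  have hSS : ∀ g h, Q g h → ∀ i, g i ∈ S ↔ h i ∈ S' := by
    intro g h hgh i
    rw [← (hQS g h hgh).1 i, ← hx]
    constructor
    · intro hv
      obtain ⟨u, hu⟩ := hG.left.surjective (g i)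
      exact ⟨u, hu, (MeklerGroup.inSupport_iff (isSparse hΓ T) (hu ▸ hq u)).2 hv⟩
    · rintro ⟨u, hu, h⟩
      exact (MeklerGroup.inSupport_iff (isSparse hΓ T) (hu ▸ hq u)).1 h
  have hE := IsBackForth.inv₂_vertex_eq h0
  have hM := hR.inv₂_matched h0
  have hS' : IsTransversal S' := hS.of_isBackForth hΓ hQ hSS
    (fun g h hgh => hR.inv₁_isInner h0 _ _ (hQS g h hgh).2 0)
    -- Pairs are padded to triples by repeating the first entry, so the second entry has index 2.
    (fun g h hgh => hR.inv₂_sameGadget h0 _ _ (hQS g h hgh).2 0 2)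
    (fun g h hgh => hE _ _ (hQS g h hgh).2 0 2)
  obtain ⟨f, hf⟩ := hQ.exists_equiv
  have hcard := Nat.card_congr (f.subtypeEquiv (p := fun g : Fin 2 → CFIVertex Γ =>
      (g 0 ∈ S ∧ g 1 ∈ S) ∧ Matched (cfiTwist Γ T) (g 0) (g 1))
    (q := fun g : Fin 2 → CFIVertex Γ =>
      (g 0 ∈ S' ∧ g 1 ∈ S') ∧ Matched (cfiTwist Γ T') (g 0) (g 1)) fun g =>
    and_congr (and_congr (hSS _ _ (hf g) 0) (hSS _ _ (hf g) 1))
      (hM _ _ (hQS _ _ (hf g)).2 0 2))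
  have h1 := hS.card_modEq hΓ hT
  have h2 := hS'.card_modEq hΓ hT'
  rw [hcard] at h1
  simpa using (Int.ModEq.refl (∑ p : V × V, if Γ.Adj p.1 p.2 then 1 else 0)).sub (h1.symm.trans h2)

/-- An edge accounts for two ordered pairs, and 2 is not divisible by 4. -/
theorem not_sum_twists_modEq [Fintype V] [DecidableEq V] {e : Sym2 V} (he : e ∈ Γ.edgeSet) :
    ¬ 0 ≡ (∑ p : V × V, if s(p.1, p.2) = e then 1 else 0) [ZMOD 4] := by
  classical
  induction e with | _ v w
  have hvw : v ≠ w := SimpleGraph.Adj.ne he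
  have : (Finset.univ.filter fun p : V × V => s(p.1, p.2) = s(v, w)) = {(v, w), (w, v)} := by
    ext ⟨a, b⟩
    simp
  rw [Finset.sum_boole, this, Finset.card_pair (by simp [hvw])]
  decide

end CFIVertex

open CFIVertex in
theorem mainTheorem8 {V : Type u} [Fintype V] (Γ₀ : SimpleGraph V) [DecidableRel Γ₀.Adj]
    (hreg : Γ₀.IsRegularOfDegree 3) (hconn : Γ₀.Connected)
    (p : ℕ) (hp : p.Prime) (hp2 : p ≠ 2)
    (e : Sym2 V) (he : e ∈ Γ₀.edgeSet) :
    GroupWLDistinguishes 3 (MeklerGroup p (CFI Γ₀)) (MeklerGroup p (twistedCFI Γ₀ e)) ∧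
      (GraphWLDimLE Γ₀ 3 →
        GroupWLIdentifies 3 (MeklerGroup p (CFI Γ₀)) ∧
          GroupWLIdentifies 3 (MeklerGroup p (twistedCFI Γ₀ e))) := by
  classical
  have := Fact.mk hp
  have := hconn.nonempty
  have := Fintype.ofFinite (CFIVertex Γ₀)
  have hΓ : ∀ v, Nat.card (Γ₀.neighborSet v) = 3 := fun v => by
    rw [Nat.card_eq_fintype_card, SimpleGraph.card_neighborSet_eq_degree, hreg v]
  have he' : {e} ⊆ Γ₀.edgeSet := Set.singleton_subset_iff.2 he
  have hparity := not_sum_twists_modEq he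
  -- Only a reading of the singular elements of `H` matters, not that `H` is a Mekler group. So this
  -- settles the first claim and also excludes the wrong parity in the second.
  have h01 : ∀ {H : Type u} [Group H] [Finite H] {q' : {x : H // IsSingular x} → CFIVertex Γ₀},
      IsReading (twistedCFI Γ₀ e) q' → ¬ GroupWLEquiv 3 (MeklerGroup p (CFI Γ₀)) H := by
    intro H _ _ q' hq' h
    have := sum_twists_modEq hΓ (Set.empty_subset _) he' h hq'
    exact hparity (by simpa using this)
  have h10 : ∀ {H : Type u} [Group H] [Finite H] {q' : {x : H // IsSingular x} → CFIVertex Γ₀},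
      IsReading (CFI Γ₀) q' → ¬ GroupWLEquiv 3 (MeklerGroup p (twistedCFI Γ₀ e)) H := by
    intro H _ _ q' hq' h
    have := sum_twists_modEq hΓ he' (Set.empty_subset _) h hq'
    exact hparity (by simpa using this.symm)
  have hread : GraphWLDimLE Γ₀ 3 → ∀ {T : Set (Sym2 V)} {H : Type u} [Group H] [Finite H],
      GroupWLEquiv 3 (MeklerGroup p (cfiTwist Γ₀ T)) H →
      ∃ q' : {x : H // IsSingular x} → CFIVertex Γ₀,
        IsReading (CFI Γ₀) q' ∨ IsReading (twistedCFI Γ₀ e) q' := by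
    intro hdim T H _ _ h
    -- Nothing is known about `H` yet, so the reading starts with the tautological one, onto its
    -- classes of singular elements; the isomorphisms found below carry it to one of the two CFI
    -- graphs.
    have hH := isReading_singularGraph H
    obtain ⟨R, q, m, hG, -⟩ := MeklerGroup.exists_readingGame (isSparse hΓ T) h hH
    have := hG.finite_right
    obtain ⟨T', hT', ⟨φ⟩⟩ := hG.isBackForth.exists_iso_cfiTwist hΓ
      (fun g h hgh => congrFun hgh 0) hdim
    rcases nonempty_iso_cfi hΓ hconn he (Set.toFinite T') hT' with ⟨⟨ψ⟩⟩ | ⟨⟨ψ⟩⟩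
    · exact ⟨_, Or.inl ((hH.comp_iso φ).comp_iso ψ)⟩
    · exact ⟨_, Or.inr ((hH.comp_iso φ).comp_iso ψ)⟩
  refine ⟨fun h => ?_, fun hdim => ⟨fun H _ _ hno h => ?_, fun H _ _ hno h => ?_⟩⟩
  · obtain ⟨q', hq', -⟩ := MeklerGroup.exists_isReading (p := p) (isSparse hΓ {e})
    exact h01 hq' h
  · obtain ⟨q', hq' | hq'⟩ := hread hdim h
    · exact hno (MeklerGroup.nonempty_mulEquiv (isSparse hΓ ∅) h hq')
    · exact h01 hq' h
  · obtain ⟨q', hq' | hq'⟩ := hread hdim h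
    · exact h10 hq' h
    · exact hno (MeklerGroup.nonempty_mulEquiv (isSparse hΓ {e}) h hq')
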